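/- Equip $\mathbb{S}^2=\{x\in\mathbb{R}^3:\|x\|=1\}$ with the spherical distance $d_s(x,y)=\arccos\langle x,y\rangle$; diameters, balls, Hausdorff distance and congruence refer to $d_s$, and $\operatorname{area}$ is the two-dimensional Hausdorff measure. A set $K\subset\mathbb{S}^2$ is spherically convex if it lies in some open hemisphere and contains the shorter great-circle arc between any two of its points; a convex disk is a compact spherically convex set with nonempty interior. A spherical cap is a closed ball $\{y: d_s(x,y)\le r\}$ with $0<r<\pi$. Let $\bar L,\bar H$ be great circles meeting orthogonally at a point $c$, let $S$ be the open hemisphere centered at $c$, and put $L=\bar L\cap S$, $H=\bar H\cap S$. For $p\in S$ let $\theta_p$ be the signed distance of $p$ from $L$, and let $\varphi_p$ be the signed distance from $H$ of the orthogonal projection of $p$ onto $L$. For $-\frac{\pi}{2}<\theta<\frac{\pi}{2}$ let $C_\theta=\{p\in S:\theta_p=\theta\}$ (a distance curve with axis $L$). A set $X\subset S$ has the connectedness property if every $X\cap C_\theta$ is connected or empty. If $X \subset S$ is compact and has this property, its Steiner symmetral $\sigma_{L,H}(X)\subset S$ is defined by: $\sigma_{L,H}(X)\cap C_\theta$ is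 empty if $X\cap C_\theta$ is empty, and otherwise it is the closed arc of $C_\theta$ (possibly a single point) centered at the point $C_\theta\cap H$ and of the same length as $X\cap C_\theta$. The angular length of $X\cap C_\theta$ is $|\varphi_p-\varphi_q|$, where $p,q$ are its endpoints, and $0$ if $X\cap C_\theta$ is empty. A convex disk $K\subset S$ with the connectedness property satisfies the angular monotonicity property with respect to $\sigma_{L,H}$ if the angular length of $K\cap C_\theta$ is nonincreasing in $\theta$ for $\theta\ge0$ and nondecreasing for $\theta\le0$. A finite sequence $\sigma_{L_1,H_1},\dots,\sigma_{L_k,H_k}$ ($k\ge1$) is applicable to a convex disk $K$ if, with $K_0=K$ and $K_i=\sigma_{L_i,H_i}(K_{i-1})$, for each $i=1,\dots,k$ the set $K_{i-1}$ is contained in the open hemisphere centered at the point $L_i\cap H_i$ and satisfies the angular monotonicity property with respect to $\sigma_{L_i,H_i}$. Theorem. Let $K\subset\mathbb{S}^2$ be a convex disk of diameter less than $\frac{\pi}{2}$, and let $\mathcal{F}_K$ be the family of all congruent copies of the images $\sigma_{L_k,H_k}(\cdots\sigma_{L_1,H_1}(K))$ of $K$ under finite sequences of Steiner symmetrizations applicable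 to $K$. Then there exist a sequence $\{K_m\}_{m=1}^\infty\subset\mathcal{F}_K$ and a spherical cap $D(K)$ with $\operatorname{area}(D(K))=\operatorname{area}(K)$ such that $K_m\to D(K)$ in the Hausdorff metric. -/

import Mathlib

open Set Filter Topology MeasureTheory
open scoped Real ENNReal

noncomputable section

/-- The unit sphere `𝕊²` of Euclidean `3`-space. It is a type of its own (not a coercion of
`Metric.sphere`) so that it carries the spherical metric instead of the chordal one. -/
def S2 : Type := {x : EuclideanSpace ℝ (Fin 3) // ‖x‖ = 1}

namespace S2

/-- The position vector of a point of the sphere. -/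
def vec (x : S2) : EuclideanSpace ℝ (Fin 3) := x.1

theorem norm_vec (x : S2) : ‖x.vec‖ = 1 := x.2

theorem vec_injective : Function.Injective vec := fun _ _ h => Subtype.ext h

/-- The scalar product of (the position vectors of) two points. -/
def dot (x y : S2) : ℝ := inner ℝ x.vec y.vec

theorem arccos_dot (x y : S2) :
    Real.arccos (dot x y) = InnerProductGeometry.angle x.vec y.vec := by
  simp [InnerProductGeometry.angle, dot, norm_vec]

/-- The spherical metric `d(x, y) = arccos ⟨x, y⟩`. Below, balls, diameters, compactness,
interiors, isometries, Hausdorff distances and Hausdorff measures all refer to it. -/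
instance : MetricSpace S2 where
  dist x y := Real.arccos (dot x y)
  dist_self x := by
    simp [dot, norm_vec]
  dist_comm x y := by
    simp only [dot, real_inner_comm]
  dist_triangle x y z := by
    simp only [arccos_dot]
    exact InnerProductGeometry.angle_le_angle_add_angle x.vec y.vec z.vec
  eq_of_dist_eq_zero := by
    intro x y h
    have h' : Real.arccos (dot x y) = 0 := h
    rw [arccos_dot] at h'
    exact vec_injective ((InnerProductGeometry.inner_eq_mul_norm_iff_angle_eq_zero
      (norm_ne_zero_iff.1 (by simp [norm_vec])) (norm_ne_zero_iff.1 (by simp [norm_vec]))).2 h'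
      |> fun h1 => (inner_eq_one_iff_of_norm_eq_one (𝕜 := ℝ) x.norm_vec y.norm_vec).1
        (by simpa [norm_vec] using h1))

theorem dist_eq (x y : S2) : dist x y = Real.arccos (dot x y) := rfl

instance : MeasurableSpace S2 := borel S2

instance : BorelSpace S2 := ⟨rfl⟩

end S2

/-- The spherical segment `[x, y]`, for points `x`, `y` that are not antipodal: the shorter arc of
the great circle through `x` and `y` consists of the unit vectors in the cone spanned by
`x` and `y`. -/
def sphSegment (x y : S2) : Set S2 :=
  {z | ∃ a b : ℝ, 0 ≤ a ∧ 0 ≤ b ∧ z.vec = a • x.vec + b • y.vec}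

/-- The open hemisphere with centre `c`. -/
def openHemisphere (c : S2) : Set S2 := Metric.ball c (π / 2)

/-- A set is spherically convex if it lies in an open hemisphere and contains the spherical
segment between any two of its points. -/
def SphConvex (K : Set S2) : Prop :=
  (∃ c : S2, K ⊆ openHemisphere c) ∧ ∀ x ∈ K, ∀ y ∈ K, sphSegment x y ⊆ K

/-- A convex disk: a compact, spherically convex set with nonempty interior. -/
structure IsConvexDisk (K : Set S2) : Prop where
  isCompact : IsCompact K
  sphConvex : SphConvex K
  nonempty_interior : (interior K).Nonempty

/-- Area: the two-dimensional Hausdorff measure. (The normalising constant of Mathlib's `μH[2]`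
does not matter, since areas are only compared with each other.) -/
def sphArea (K : Set S2) : ℝ≥0∞ := μH[2] K

/-- A spherical cap: a closed ball of radius strictly between `0` and `π`. -/
def IsSphericalCap (D : Set S2) : Prop :=
  ∃ (x : S2) (r : ℝ), 0 < r ∧ r < π ∧ D = Metric.closedBall x r

/-- The data `(L, H)` of a Steiner symmetrization, by means of an adapted positively or negatively
oriented Cartesian coordinate system. The great circle spanned by `center` and `axisDir` and the
great circle spanned by `center` and `pole` are orthogonal at `center`; with `S` the open
hemisphere around `center`, the sets `L` and `H` are the parts in `S` of the first and of the
second circle. Every pair of great circles orthogonal at `center` arises in this way; the signs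
of `axisDir` and `pole` do not influence any of the notions defined below. -/
structure SteinerFrame where
  center : S2
  axisDir : S2
  pole : S2
  center_axisDir : S2.dot center axisDir = 0
  center_pole : S2.dot center pole = 0
  axisDir_pole : S2.dot axisDir pole = 0

namespace SteinerFrame

variable (F : SteinerFrame)

/-- The open hemisphere `S` centred at the intersection point of `L` and `H`. -/
def S : Set S2 := openHemisphere F.center

/-- The signed spherical distance `θ` of a point from `L`. -/
def theta (p : S2) : ℝ := Real.arcsin (S2.dot p F.pole)

/-- The signed spherical distance `φ` from `H` of the orthogonal projection to `L` of a point
of `S`. -/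
def phi (p : S2) : ℝ := Real.arctan (S2.dot p F.axisDir / S2.dot p F.center)

/-- The (signed) distance curve `C_θ` with axis `L`. It is empty unless `-π/2 < θ < π/2`. On it,
`φ` is a coordinate proportional to arc length, which takes all values in `(-π/2, π/2)`;
the point `C_θ ∩ H` is the one with `φ = 0`. -/
def distanceCurve (θ : ℝ) : Set S2 := {p | p ∈ F.S ∧ F.theta p = θ}

/-- The connectedness property: `X` meets every distance curve with axis `L` in a connected
(possibly empty) set. -/
def ConnectednessProperty (X : Set S2) : Prop :=
  ∀ θ : ℝ, IsPreconnected (X ∩ F.distanceCurve θ)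

/-- The angular length of `X ∩ C_θ`: if this set is an arc with end points `p` and `q`, it is
`|φ_p - φ_q|`; it is `0` for a singleton and for the empty set. -/
def angularLength (X : Set S2) (θ : ℝ) : ℝ :=
  Metric.diam (F.phi '' (X ∩ F.distanceCurve θ))

/-- The Steiner symmetral `σ_{L,H}(X)` of a compact set `X ⊆ S` with the connectedness property:
it does not meet the distance curves that `X` does not meet, and it meets every other distance
curve `C_θ` in the closed arc (or the single point) that is centred at `C_θ ∩ H` and has the same
length as `X ∩ C_θ`. -/
def symmetral (X : Set S2) : Set S2 :=
  {p | p ∈ F.S ∧ (X ∩ F.distanceCurve (F.theta p)).Nonempty ∧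
    |F.phi p| ≤ F.angularLength X (F.theta p) / 2}

/-- The angular monotonicity property of `K` with respect to `σ_{L,H}`: `K` is a convex disk in
`S` with the connectedness property, and the angular length of `K ∩ C_θ` is nonincreasing for
`θ ≥ 0` and nondecreasing for `θ ≤ 0`. -/
structure AngularMonotonicity (K : Set S2) : Prop where
  isConvexDisk : IsConvexDisk K
  subset_S : K ⊆ F.S
  connectednessProperty : F.ConnectednessProperty K
  antitoneOn : AntitoneOn (F.angularLength K) (Ico 0 (π / 2))
  monotoneOn : MonotoneOn (F.angularLength K) (Ioc (-(π / 2)) 0)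

/-- The image `σ_{L_k,H_k}(… σ_{L_1,H_1}(K))` of `K` under a finite sequence of Steiner
symmetrizations. -/
def iterSymmetral : List SteinerFrame → Set S2 → Set S2
  | [], K => K
  | F :: l, K => iterSymmetral l (F.symmetral K)

/-- A finite sequence of Steiner symmetrizations is applicable to `K` if at each step the current
image of `K` lies in the open hemisphere of the next symmetrization and has the angular
monotonicity property with respect to it. -/
def Applicable : List SteinerFrame → Set S2 → Prop
  | [], _ => True
  | F :: l, K => (K ⊆ F.S ∧ F.AngularMonotonicity K) ∧ Applicable l (F.symmetral K)

end SteinerFrame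

/-- The family `𝓕_K`: congruent copies (images under isometries of the sphere) of the images of
`K` under finite sequences, of length at least one, of Steiner symmetrizations applicable
to `K`. -/
def steinerFamily (K : Set S2) : Set (Set S2) :=
  {K' | ∃ l : List SteinerFrame, l ≠ [] ∧ SteinerFrame.Applicable l K ∧
    ∃ g : S2 ≃ᵢ S2, K' = g '' SteinerFrame.iterSymmetral l K}

end

/-! In the coordinates longitude `φ` and `t = tan θ`, a great circle missing the poles is a sinusoid
`t = A cos φ + B sin φ`, meridians are vertical lines and distance curves are horizontal lines.
Symmetrization centres the horizontal slices, and spherical convexity becomes closure under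
sinusoidal chords and vertical segments. The heart of the first half is `StripSym.chord`: angular
monotonicity makes the symmetral convex. The chords joining corresponding ends of two slices are
averaged, and the averaged boundary lies above the chord between the ends of the centred slices.
Area is preserved because averaging over the rotations about the pole expresses the area through the
lengths of the latitude slices.

The bound on the diameter serves to find a first admissible frame (`exists_good`). With a diametral
chord as axis, every point of `K` projects orthogonally into that chord, since otherwise it would be
too far from one of its ends. Hence `K` contains the meridian segments down to the axis, and its
slices are intervals that shrink away from the axis. The symmetral is mirror symmetric in the second
great circle, so the frame with the two circles exchanged is admissible next (`Good.swap`). After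
both steps the body is centrally symmetric about the common centre `c`. Central symmetry makes every
frame centred at `c` admissible (`good_of_centSym`), and it is inherited by the symmetral.

From there on only frames centred at `c` are used. They keep every concentric cap contained in the
body and never increase its circumradius about `c`. Let `r` be the infimum of the circumradii that
can be reached. If iterates with circumradius tending to `r` all missed a neighbourhood of some
point of the circle of radius `r`, their gaps would accumulate at one point; finitely many mirror
images of that gap cover the circle, and the corresponding symmetrizations would bring the
circumradius below `r` (`exists_list_push`, `exists_iter_near`). So some iterate comes within `ε` of
every point of the circle, and by convexity it contains the cap of radius `r - ε`. The iterates thus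
converge to the cap of radius `r`, whose area is found by continuity of the measure. -/

/-! ### Convex sets in longitude and tangent of latitude -/

/-- In the coordinates longitude and tangent of the latitude, a spherically convex subset of an
open hemisphere whose latitude slices have extreme points. -/
structure ConvexStrip (Q : ℝ → ℝ → Prop) : Prop where
  lt : ∀ {φ t}, Q φ t → |φ| < π / 2
  chord : ∀ {φ₁ t₁ φ₂ t₂ φ t}, Q φ₁ t₁ → Q φ₂ t₂ → φ₁ < φ₂ → φ₁ ≤ φ → φ ≤ φ₂ →
    t * Real.sin (φ₂ - φ₁) = t₁ * Real.sin (φ₂ - φ) + t₂ * Real.sin (φ - φ₁) → Q φ t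
  vert : ∀ {φ t₁ t₂ t}, Q φ t₁ → Q φ t₂ → t₁ ≤ t → t ≤ t₂ → Q φ t
  extreme : ∀ {φ t}, Q φ t → ∃ α β, Q α t ∧ Q β t ∧ ∀ ψ, Q ψ t → α ≤ ψ ∧ ψ ≤ β

/-- The Steiner symmetral in the coordinates of `ConvexStrip`. -/
def StripSym (Q : ℝ → ℝ → Prop) (φ t : ℝ) : Prop :=
  ∃ φ₁ φ₂, Q φ₁ t ∧ Q φ₂ t ∧ 2 * |φ| ≤ φ₂ - φ₁

/-- The slices get longer towards the axis. -/
def StripMono (Q : ℝ → ℝ → Prop) : Prop :=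
  ∀ ⦃φ t t'⦄, StripSym Q φ t' → (0 ≤ t ∧ t ≤ t' ∨ t' ≤ t ∧ t ≤ 0) → StripSym Q φ t

/-- Great circles are sinusoids in these coordinates, so this identity takes the place of linear
interpolation; the equation in `ConvexStrip.chord` is an instance of it. -/
theorem sinusoid_interp (A B x y z : ℝ) :
    (A * Real.cos y + B * Real.sin y) * Real.sin (z - x) =
      (A * Real.cos x + B * Real.sin x) * Real.sin (z - y) +
      (A * Real.cos z + B * Real.sin z) * Real.sin (y - x) := by
  simp only [Real.sin_sub]
  ring

/-- Subadditivity of the sine is the reason why, at nonnegative heights, a chord between two points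
of equal height bulges away from the axis. -/
theorem sin_add_le_sin_add_sin {x y : ℝ} (hx : 0 ≤ x) (hy : 0 ≤ y) (h : x + y ≤ π) :
    Real.sin (x + y) ≤ Real.sin x + Real.sin y := by
  rw [Real.sin_add]
  have h1 := Real.sin_nonneg_of_nonneg_of_le_pi hx (by linarith)
  have h2 := Real.sin_nonneg_of_nonneg_of_le_pi hy (by linarith)
  nlinarith [Real.cos_le_one x, Real.cos_le_one y]

namespace ConvexStrip

variable {Q : ℝ → ℝ → Prop}

theorem negT (h : ConvexStrip Q) : ConvexStrip (fun φ t => Q φ (-t)) where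
  lt := h.lt
  chord h1 h2 h12 h3 h4 e := h.chord h1 h2 h12 h3 h4 (by linear_combination -e)
  vert h1 h2 h3 h4 := h.vert h2 h1 (by linarith) (by linarith)
  extreme h1 := h.extreme h1

theorem negPhi (h : ConvexStrip Q) : ConvexStrip (fun φ t => Q (-φ) t) where
  lt h1 := by simpa using h.lt h1
  chord {φ₁ t₁ φ₂ t₂ φ t} h1 h2 h12 h3 h4 e :=
    h.chord h2 h1 (by linarith) (by linarith) (by linarith) (by
      rw [show -φ₁ - -φ₂ = φ₂ - φ₁ by ring, show -φ₁ - -φ = φ - φ₁ by ring,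
        show -φ - -φ₂ = φ₂ - φ by ring]
      linarith)
  vert h1 h2 h3 h4 := h.vert h1 h2 h3 h4
  extreme h1 := by
    obtain ⟨α, β, hα, hβ, h2⟩ := h.extreme h1
    refine ⟨-β, -α, by simpa using hβ, by simpa using hα, fun ψ hψ => ?_⟩
    have := h2 _ hψ
    constructor <;> linarith

end ConvexStrip

namespace StripSym

variable {Q : ℝ → ℝ → Prop}

theorem of_abs_le {φ ψ t : ℝ} (h : StripSym Q φ t) (hψ : |ψ| ≤ |φ|) : StripSym Q ψ t := by
  obtain ⟨a, b, ha, hb, h⟩ := h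
  exact ⟨a, b, ha, hb, by linarith⟩

theorem neg {φ t : ℝ} (h : StripSym Q φ t) : StripSym Q (-φ) t := h.of_abs_le (by simp)

theorem negPhi_iff {φ t : ℝ} : StripSym (fun φ t => Q (-φ) t) φ t ↔ StripSym Q φ t := by
  constructor
  · rintro ⟨a, b, ha, hb, h⟩
    exact ⟨-b, -a, hb, ha, by linarith⟩
  · rintro ⟨a, b, ha, hb, h⟩
    exact ⟨-b, -a, by simpa using hb, by simpa using ha, by linarith⟩

theorem abs_lt (hQ : ConvexStrip Q) {φ t : ℝ} (h : StripSym Q φ t) : |φ| < π / 2 := by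
  obtain ⟨a, b, ha, hb, h⟩ := h
  have h1 := _root_.abs_lt.1 (hQ.lt ha)
  have h2 := _root_.abs_lt.1 (hQ.lt hb)
  linarith

/-- The region below a chord with ends of equal height is in the symmetral. -/
theorem of_level_chord (hQ : ConvexStrip Q) (hM : StripMono Q) {ω τ ζ t : ℝ}
    (h : StripSym Q ω τ) (hζ : |ζ| ≤ |ω|) (ht : 0 ≤ t)
    (hle : t * Real.cos ω ≤ τ * Real.cos ζ) : StripSym Q ζ t := by
  obtain ⟨a, b, ha, hb, hab⟩ := h
  have h1 := _root_.abs_lt.1 (hQ.lt ha)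
  have h2 := _root_.abs_lt.1 (hQ.lt hb)
  rcases (show a ≤ b by linarith [abs_nonneg ω]).eq_or_lt with rfl | hlt
  · have hω0 : ω = 0 := abs_eq_zero.1 (by linarith [abs_nonneg ω])
    have hζ0 : ζ = 0 := abs_eq_zero.1 (by rw [hω0] at hζ; simpa using hζ)
    subst hω0 hζ0
    exact hM ⟨a, a, ha, hb, hab⟩ (Or.inl ⟨ht, by simpa using hle⟩)
  obtain ⟨w, hw⟩ : ∃ w, w = (b - a) / 2 := ⟨_, rfl⟩
  obtain ⟨m, hm⟩ : ∃ m, m = (a + b) / 2 := ⟨_, rfl⟩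
  have hwω : |ω| ≤ w := by linarith
  have hcw : 0 < Real.cos w := Real.cos_pos_of_mem_Ioo ⟨by linarith, by linarith⟩
  have hcos : Real.cos w ≤ Real.cos ω := by
    rw [← Real.cos_abs ω]
    exact Real.cos_le_cos_of_nonneg_of_le_pi (abs_nonneg _) (by linarith) hwω
  -- At offset `z` from the midpoint, the chord between the two points has height `τ cos z / cos w`.
  -- This is even in `z`, so it gives a whole pair of points at one height, and `hM` lowers that
  -- pair to `t`.
  have key : ∀ z, |z| = |ζ| → Q (m + z) (τ * Real.cos ζ / Real.cos w) := by
    intro z hz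
    have hz' := abs_le.1 (hz.trans_le (hζ.trans hwω))
    refine hQ.chord ha hb hlt (by linarith) (by linarith) ?_
    rw [show b - a = 2 * w by linarith, show b - (m + z) = w - z by linarith,
      show m + z - a = w + z by linarith, Real.sin_two_mul, Real.sin_sub, Real.sin_add,
      ← Real.cos_abs ζ, ← hz, Real.cos_abs]
    field_simp
    ring
  refine hM (t' := τ * Real.cos ζ / Real.cos w) ⟨m + -|ζ|, m + |ζ|, key _ (by simp), key _ (by simp), by linarith⟩
    (Or.inl ⟨ht, ?_⟩)
  rw [le_div_iff₀ hcw]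
  exact (mul_le_mul_of_nonneg_left hcos ht).trans hle

end StripSym

/-! ### Comparison of chords -/

/-- Intermediate value theorem for a chord. -/
theorem exists_chord_eq {s t₁ t₂ t : ℝ} (hs : 0 ≤ s) (hsπ : s < π) (h2 : t₂ ≤ t) (h1 : t ≤ t₁) :
    ∃ a ∈ Icc 0 s, t * Real.sin s = t₁ * Real.sin (s - a) + t₂ * Real.sin a := by
  have hsin := Real.sin_nonneg_of_nonneg_of_le_pi hs hsπ.le
  have hc : ContinuousOn (fun a => t₁ * Real.sin (s - a) + t₂ * Real.sin a) (Icc 0 s) := by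
    fun_prop
  have := intermediate_value_Icc' hs hc
  obtain ⟨a, ha, e⟩ := this (show t * Real.sin s ∈ _ by
    constructor
    · simpa using mul_le_mul_of_nonneg_right h2 hsin
    · simpa using mul_le_mul_of_nonneg_right h1 hsin)
  exact ⟨a, ha, e.symm⟩

/-- On a chord that starts above height `t`, all points before a point of height `≥ t` are higher
than `t`. -/
theorem chord_gt_of_lt {s t₁ t₂ t a x : ℝ} (ha : 0 < a) (has : a ≤ s) (hsπ : s < π) (ht : 0 ≤ t)
    (h1 : t < t₁) (hx : 0 ≤ x) (hxa : x < a)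
    (e : t * Real.sin s ≤ t₁ * Real.sin (s - a) + t₂ * Real.sin a) :
    t * Real.sin s < t₁ * Real.sin (s - x) + t₂ * Real.sin x := by
  have hsa : 0 < Real.sin a := Real.sin_pos_of_pos_of_lt_pi ha (by linarith)
  have hss : 0 < Real.sin s := Real.sin_pos_of_pos_of_lt_pi (by linarith) (by linarith)
  have hsax : 0 < Real.sin (a - x) := Real.sin_pos_of_pos_of_lt_pi (by linarith) (by linarith)
  have hsx : 0 ≤ Real.sin x := Real.sin_nonneg_of_nonneg_of_le_pi hx (by linarith)
  -- Interpolation between the offsets `0` and `a`: the chord is strictly above `t` at the first, at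
  -- least `t` at the second, and the sine is subadditive.
  have h := sinusoid_interp (t₁ * Real.sin s) (t₂ - t₁ * Real.cos s) 0 x a
  have hadd := sin_add_le_sin_add_sin (x := a - x) (y := x) (by linarith) hx (by linarith)
  simp only [sub_add_cancel] at hadd
  have e1 : ∀ y, t₁ * Real.sin s * Real.cos y + (t₂ - t₁ * Real.cos s) * Real.sin y =
      t₁ * Real.sin (s - y) + t₂ * Real.sin y := by
    intro y; rw [Real.sin_sub]; ring
  rw [e1, e1, e1] at h
  simp only [sub_zero, Real.sin_zero, mul_zero, add_zero] at h
  have h3 : t * Real.sin s * Real.sin a <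
      (t₁ * Real.sin (s - x) + t₂ * Real.sin x) * Real.sin a := by
    rw [h]
    calc t * Real.sin s * Real.sin a ≤ t * Real.sin s * (Real.sin (a - x) + Real.sin x) :=
          mul_le_mul_of_nonneg_left hadd (by positivity)
      _ < t₁ * Real.sin s * Real.sin (a - x) + t * Real.sin s * Real.sin x := by
          have : t * Real.sin s * Real.sin (a - x) < t₁ * Real.sin s * Real.sin (a - x) := by
            gcongr
          linarith
      _ ≤ _ := by gcongr
  exact lt_of_mul_lt_mul_right h3 hsa.le

/-- Comparison of two descending chords of different lengths. -/
theorem chord_crossing_mono {s σ t₁ t₂ t a b a' b' : ℝ} (hs : s < π) (hσ : 0 ≤ σ) (hσs : σ ≤ s)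
    (h2 : 0 ≤ t₂) (h2t : t₂ < t) (ht1 : t < t₁) (hno : t₂ ≤ t₁ * Real.cos s)
    (ha : 0 ≤ a) (hb : 0 ≤ b) (hab : a + b = s) (ha' : 0 ≤ a') (hb' : 0 ≤ b') (hab' : a' + b' = σ)
    (e : t * Real.sin s = t₁ * Real.sin b + t₂ * Real.sin a)
    (e' : t * Real.sin σ = t₁ * Real.sin b' + t₂ * Real.sin a') : a' ≤ a ∧ b' ≤ b := by
  rcases hσ.eq_or_lt with rfl | hσ0
  · constructor <;> linarith
  have ht1' : 0 < t₁ := by linarith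
  -- By `hno` the long chord does not rise at its upper end; as `t₂ ≥ 0`, this bounds its length by
  -- `π / 2`.
  have hcs : 0 ≤ Real.cos s := nonneg_of_mul_nonneg_right (h2.trans hno) ht1'
  have hs2 : s ≤ π / 2 := by
    by_contra hcon
    have := Real.cos_neg_of_pi_div_two_lt_of_lt (not_le.1 hcon) (by linarith)
    linarith
  have hss : 0 < Real.sin s := Real.sin_pos_of_pos_of_lt_pi (by linarith) (by linarith)
  have hsσ : 0 < Real.sin σ := Real.sin_pos_of_pos_of_lt_pi hσ0 (by linarith)
  have hss' : Real.sin σ ≤ Real.sin s :=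
    Real.sin_le_sin_of_le_of_le_pi_div_two (by linarith) hs2 hσs
  have hcc : Real.cos s ≤ Real.cos σ :=
    Real.cos_le_cos_of_nonneg_of_le_pi hσ0.le (by linarith) hσs
  have hsub : Real.sin (s - σ) = Real.sin s * Real.cos σ - Real.cos s * Real.sin σ :=
    Real.sin_sub _ _
  -- comparison at the upper end
  have hA : t₂ * (Real.sin s - Real.sin σ) ≤ t₁ * Real.sin (s - σ) := by
    calc t₂ * (Real.sin s - Real.sin σ) ≤ t₁ * Real.cos s * (Real.sin s - Real.sin σ) := by
          gcongr
      _ = t₁ * (Real.cos s * (Real.sin s - Real.sin σ)) := by ring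
      _ ≤ _ := by
          gcongr
          rw [hsub]
          nlinarith
  -- The comparison at the lower end: measured from there, the short chord is the higher one.
  have hB : t₂ * Real.sin (s - σ) ≤ t₁ * (Real.sin s - Real.sin σ) := by
    obtain ⟨u, hu⟩ : ∃ u, u = (s - σ) / 2 := ⟨_, rfl⟩
    have e1 : Real.sin (s - σ) = 2 * Real.sin u * Real.cos u := by
      rw [← Real.sin_two_mul]; congr 1; linarith
    have e2 : Real.sin s - Real.sin σ =
        2 * Real.sin u * (Real.cos s * Real.cos u + Real.sin s * Real.sin u) := by
      rw [Real.sin_sub_sin, ← Real.cos_sub, ← hu]; congr 2; linarith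
    have hu0 : 0 ≤ Real.sin u := Real.sin_nonneg_of_nonneg_of_le_pi (by linarith) (by linarith)
    have hcu : 0 ≤ Real.cos u := Real.cos_nonneg_of_mem_Icc ⟨by linarith, by linarith⟩
    rw [e1, e2]
    have := mul_le_mul_of_nonneg_right hno (show 0 ≤ 2 * Real.sin u * Real.cos u by positivity)
    have h3 : 0 ≤ t₁ * (2 * Real.sin u * (Real.sin s * Real.sin u)) := by positivity
    linarith
  constructor
  · by_contra hcon
    have hlt : a < a' := not_le.1 hcon
    -- the long chord is above the short one
    have h3 : t * Real.sin s ≤ t₁ * Real.sin (s - a') + t₂ * Real.sin a' := by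
      have e3 : b' = σ - a' := by linarith
      rw [e3] at e'
      have hsa' : 0 ≤ Real.sin a' := Real.sin_nonneg_of_nonneg_of_le_pi ha' (by linarith)
      have : (t * Real.sin s) * Real.sin σ ≤
          (t₁ * Real.sin (s - a') + t₂ * Real.sin a') * Real.sin σ := by
        have e4 : t * Real.sin s * Real.sin σ =
          (t₁ * Real.sin (σ - a') + t₂ * Real.sin a') * Real.sin s := by rw [← e']; ring
        rw [e4]
        have := mul_le_mul_of_nonneg_right hA hsa'
        rw [Real.sin_sub] at this
        rw [Real.sin_sub, Real.sin_sub]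
        linarith
      exact le_of_mul_le_mul_right this hsσ
    have := chord_gt_of_lt (a := a') (by linarith) (by linarith) hs (by linarith) ht1 ha hlt h3
    rw [show s - a = b by linarith] at this
    linarith
  · by_contra hcon
    have hlt : b < b' := not_le.1 hcon
    have h3 : t * Real.sin σ ≤ t₁ * Real.sin b + t₂ * Real.sin (σ - b) := by
      have e3 : a = s - b := by linarith
      rw [e3] at e
      have hsb : 0 ≤ Real.sin b := Real.sin_nonneg_of_nonneg_of_le_pi hb (by linarith)
      have : (t * Real.sin σ) * Real.sin s ≤
          (t₁ * Real.sin b + t₂ * Real.sin (σ - b)) * Real.sin s := by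
        have e4 : t * Real.sin σ * Real.sin s =
          (t₁ * Real.sin b + t₂ * Real.sin (s - b)) * Real.sin σ := by rw [← e]; ring
        rw [e4]
        have := mul_le_mul_of_nonneg_right hB hsb
        rw [Real.sin_sub] at this
        rw [Real.sin_sub, Real.sin_sub]
        linarith
      exact le_of_mul_le_mul_right this hss
    have := chord_gt_of_lt (a := σ - b) (x := a') (t₁ := t₁) (t₂ := t₂) (t := t) (s := σ)
      (by linarith) (by linarith) (by linarith) (by linarith) ht1 ha' (by linarith)
      (by rw [sub_sub_cancel]; exact h3)
    rw [show σ - a' = b' by linarith] at this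
    linarith

namespace ConvexStrip

variable {Q : ℝ → ℝ → Prop}

/-- A point of given intermediate height on the side of `Q` spanned by two points. -/
theorem exists_side_point (hQ : ConvexStrip Q) {γ₁ γ₂ t₁ t₂ t : ℝ} (hγ₁ : Q γ₁ t₁)
    (hγ₂ : Q γ₂ t₂) (h2t : t₂ ≤ t) (ht1 : t ≤ t₁) :
    ∃ a, 0 ≤ a ∧ a ≤ |γ₂ - γ₁| ∧
      t * Real.sin |γ₂ - γ₁| = t₁ * Real.sin (|γ₂ - γ₁| - a) + t₂ * Real.sin a ∧
      Q (if γ₁ ≤ γ₂ then γ₁ + a else γ₁ - a) t := by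
  have l1 := abs_lt.1 (hQ.lt hγ₁)
  have l2 := abs_lt.1 (hQ.lt hγ₂)
  obtain ⟨a, ⟨ha0, ha⟩, e⟩ := exists_chord_eq (abs_nonneg (γ₂ - γ₁))
    (abs_lt.2 ⟨by linarith, by linarith⟩) h2t ht1
  refine ⟨a, ha0, ha, e, ?_⟩
  rcases lt_trichotomy γ₁ γ₂ with h | h | h
  · rw [if_pos h.le]
    rw [abs_of_pos (by linarith)] at ha e
    refine hQ.chord hγ₁ hγ₂ h (by linarith) (by linarith) ?_
    rw [e]; congr 3 <;> ring
  · subst h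
    have : a = 0 := by simp at ha; linarith
    subst this
    simpa using hQ.vert hγ₂ hγ₁ h2t ht1
  · rw [if_neg (not_le.2 h)]
    rw [abs_of_neg (by linarith), neg_sub] at ha e
    refine hQ.chord hγ₂ hγ₁ h (by linarith) (by linarith) ?_
    rw [e, add_comm]; congr 3 <;> ring

/-- If `β` is the right end of the upper slice, no chord starting there rises. -/
theorem le_mul_cos_of_extreme (hQ : ConvexStrip Q) {β₁ β₂ t₁ t₂ : ℝ} (hβ₁ : Q β₁ t₁)
    (hβ₂ : Q β₂ t₂) (hext : ∀ ψ, Q ψ t₁ → ψ ≤ β₁) (hlt : β₁ < β₂) (h2 : 0 ≤ t₂) (h21 : t₂ < t₁) :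
    t₂ ≤ t₁ * Real.cos (β₂ - β₁) := by
  by_contra hcon
  rw [not_le] at hcon
  have l1 := abs_lt.1 (hQ.lt hβ₁)
  have l2 := abs_lt.1 (hQ.lt hβ₂)
  obtain ⟨s, hs⟩ : ∃ s, s = β₂ - β₁ := ⟨_, rfl⟩
  rw [← hs] at hcon
  have ht1 : 0 < t₁ := by linarith
  have hss : 0 < Real.sin s := Real.sin_pos_of_pos_of_lt_pi (by linarith) (by linarith)
  have hch : 0 < Real.cos (s / 2) := Real.cos_pos_of_mem_Ioo ⟨by linarith, by linarith⟩
  have hsh : 0 < Real.sin (s / 2) := Real.sin_pos_of_pos_of_lt_pi (by linarith) (by linarith)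
  -- At offset `x` the chord has height `t₁ cos x + B sin x`. If it rises, so that `B > 0`, it
  -- returns to height `t₁` at `x = 2u` with `tan u = B / t₁`, which contradicts the extremality of
  -- `β₁`.
  obtain ⟨B, hB⟩ : ∃ B, B = (t₂ - t₁ * Real.cos s) / Real.sin s := ⟨_, rfl⟩
  have hB0 : 0 < B := by rw [hB]; exact div_pos (by linarith) hss
  have hBs : B * Real.sin s = t₂ - t₁ * Real.cos s := by rw [hB]; field_simp
  obtain ⟨u, hu⟩ : ∃ u, u = Real.arctan (B / t₁) := ⟨_, rfl⟩
  have hu0 : 0 < u := by rw [hu]; exact Real.arctan_pos.2 (div_pos hB0 ht1)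
  have hus : u < s / 2 := by
    rw [hu, ← Real.arctan_tan (x := s / 2) (by linarith) (by linarith)]
    refine Real.arctan_strictMono ?_
    rw [Real.tan_eq_sin_div_cos, div_lt_div_iff₀ ht1 hch]
    have e1 : Real.sin s = 2 * Real.sin (s / 2) * Real.cos (s / 2) := by
      rw [← Real.sin_two_mul]; congr 1; ring
    have e2 : Real.cos s = 1 - 2 * Real.sin (s / 2) ^ 2 := by
      have := Real.cos_two_mul' (s / 2)
      rw [show 2 * (s / 2) = s by ring] at this
      rw [this, Real.cos_sq']; ring
    rw [e1, e2] at hBs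
    have : 2 * Real.sin (s / 2) * (B * Real.cos (s / 2)) <
        2 * Real.sin (s / 2) * (Real.sin (s / 2) * t₁) := by nlinarith
    exact lt_of_mul_lt_mul_left this (by positivity)
  have hcu : 0 < Real.cos u := Real.cos_pos_of_mem_Ioo ⟨by linarith, by linarith⟩
  have htan : B * Real.cos u = t₁ * Real.sin u := by
    have : Real.tan u = B / t₁ := by rw [hu, Real.tan_arctan]
    rw [Real.tan_eq_sin_div_cos] at this
    field_simp at this
    linarith
  have hmem : Q (β₁ + 2 * u) t₁ := by
    refine hQ.chord hβ₁ hβ₂ hlt (by linarith) (by linarith) ?_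
    rw [← hs, show β₂ - (β₁ + 2 * u) = s - 2 * u by linarith, show β₁ + 2 * u - β₁ = 2 * u by ring,
      Real.sin_sub, Real.cos_two_mul', Real.sin_two_mul]
    have h1 := Real.sin_sq_add_cos_sq u
    have e3 : t₂ = B * Real.sin s + t₁ * Real.cos s := by linarith
    rw [e3]
    linear_combination (-t₁ * Real.sin s) * h1 -
      2 * Real.sin u * Real.sin s * htan
  have := hext _ hmem
  linarith

end ConvexStrip

/-! ### Convexity of the symmetral -/

namespace StripSym

variable {Q : ℝ → ℝ → Prop}

/-- Convexity of the symmetral between the ends of two slices. -/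
theorem exists_between_extremes (hQ : ConvexStrip Q) {α₁ β₁ α₂ β₂ t₁ t₂ t s : ℝ}
    (hα₁ : Q α₁ t₁) (hβ₁ : Q β₁ t₁) (hext : ∀ ψ, Q ψ t₁ → ψ ≤ β₁)
    (hα₂ : Q α₂ t₂) (hβ₂ : Q β₂ t₂) (h2 : 0 ≤ t₂) (h2t : t₂ < t) (ht1 : t < t₁)
    (hs : 2 * s = (β₂ - β₁) + (α₁ - α₂)) (hs0 : 0 < s) (hside : α₁ - α₂ ≤ β₂ - β₁)
    (h1 : α₁ ≤ β₁) :
    ∃ u, 0 ≤ u ∧ u ≤ s ∧ StripSym Q ((β₁ - α₁) / 2 + u) t ∧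
      t₁ * Real.sin (s - u) + t₂ * Real.sin u ≤ t * Real.sin s := by
  have lα₁ := _root_.abs_lt.1 (hQ.lt hα₁)
  have lβ₁ := _root_.abs_lt.1 (hQ.lt hβ₁)
  have lα₂ := _root_.abs_lt.1 (hQ.lt hα₂)
  have lβ₂ := _root_.abs_lt.1 (hQ.lt hβ₂)
  have ht1' : 0 < t₁ := by linarith
  have hs1 : 0 < β₂ - β₁ := by linarith
  have hno := hQ.le_mul_cos_of_extreme hβ₁ hβ₂ hext (by linarith) h2 (by linarith)
  have hs1π : β₂ - β₁ ≤ π / 2 := by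
    by_contra hcon
    have := Real.cos_neg_of_pi_div_two_lt_of_lt (not_le.1 hcon) (by linarith)
    nlinarith
  obtain ⟨a, ha0, ha, ea, hQa⟩ := hQ.exists_side_point hβ₁ hβ₂ h2t.le ht1.le
  obtain ⟨a', ha0', ha', ea', hQa'⟩ := hQ.exists_side_point hα₁ hα₂ h2t.le ht1.le
  rw [abs_of_pos hs1] at ha ea
  rw [if_pos (by linarith)] at hQa
  have hσs : |α₂ - α₁| ≤ β₂ - β₁ := abs_le.2 ⟨by linarith, by linarith⟩
  -- The side with the larger longitude difference crosses height `t` later from either end; this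
  -- gives `x, y ≥ 0` below.
  obtain ⟨hm1, hm2⟩ := chord_crossing_mono (by linarith) (abs_nonneg _) hσs h2 h2t ht1 hno
    ha0 (sub_nonneg.2 ha) (by ring) ha0' (sub_nonneg.2 ha') (by ring) ea ea'
  -- signed version of the second point
  obtain ⟨c, d, hcd, hc1, hc2, hd1, hd2, ec, hQc⟩ : ∃ c d, c + d = α₁ - α₂ ∧ c ≤ a ∧ -c ≤ a ∧
      d ≤ β₂ - β₁ - a ∧ -d ≤ β₂ - β₁ - a ∧
      t * Real.sin (α₁ - α₂) = t₁ * Real.sin d + t₂ * Real.sin c ∧ Q (α₁ - c) t := by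
    by_cases h : α₁ ≤ α₂
    · rw [if_pos h] at hQa'
      rw [abs_of_nonneg (by linarith)] at ea' hm2 ha'
      refine ⟨-a', -(α₂ - α₁ - a'), by ring, by linarith, by linarith, by linarith, by linarith,
        ?_, by simpa using hQa'⟩
      rw [show α₁ - α₂ = -(α₂ - α₁) by ring, Real.sin_neg, Real.sin_neg, Real.sin_neg]
      linarith
    · rw [if_neg h] at hQa'
      rw [not_le] at h
      rw [abs_of_neg (by linarith), neg_sub] at ea' hm2 ha'
      exact ⟨a', α₁ - α₂ - a', by ring, hm1, by linarith, hm2, by linarith, ea', hQa'⟩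
  refine ⟨(a + c) / 2, by linarith, by linarith, ⟨α₁ - c, β₁ + a, hQc, hQa, ?_⟩, ?_⟩
  · rw [abs_of_nonneg (by linarith)]; linarith
  obtain ⟨b, hb⟩ : ∃ b, b = β₂ - β₁ - a := ⟨_, rfl⟩
  rw [← hb] at ea hd1 hd2
  obtain ⟨p, hp⟩ : ∃ p, p = (a + c) / 2 := ⟨_, rfl⟩
  obtain ⟨q, hq⟩ : ∃ q, q = (b + d) / 2 := ⟨_, rfl⟩
  obtain ⟨x, hx⟩ : ∃ x, x = (a - c) / 2 := ⟨_, rfl⟩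
  obtain ⟨y, hy⟩ : ∃ y, y = (b - d) / 2 := ⟨_, rfl⟩
  have hspq : s = p + q := by linarith
  rw [← hp, show s - p = q by linarith]
  have e1 : β₂ - β₁ = s + (x + y) := by linarith
  have e2 : α₁ - α₂ = s - (x + y) := by linarith
  -- Half the sum of the chord equations of the two sides. Since `x, y ≥ 0`, the factor `cos (x +
  -- y)` is at most `cos x` and at most `cos y`, so it can be cancelled at the cost of an
  -- inequality.
  have sum : t * (Real.sin s * Real.cos (x + y)) =
      t₁ * (Real.sin q * Real.cos y) + t₂ * (Real.sin p * Real.cos x) := by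
    rw [e1, show b = q + y by linarith, show a = p + x by linarith, Real.sin_add s,
      Real.sin_add q, Real.sin_add p] at ea
    rw [e2, show d = q - y by linarith, show c = p - x by linarith, Real.sin_sub, Real.sin_sub,
      Real.sin_sub] at ec
    linarith
  have hcpos : 0 < Real.cos (x + y) := Real.cos_pos_of_mem_Ioo ⟨by linarith, by linarith⟩
  have hcx : Real.cos (x + y) ≤ Real.cos x :=
    Real.cos_le_cos_of_nonneg_of_le_pi (by linarith) (by linarith) (by linarith)
  have hcy : Real.cos (x + y) ≤ Real.cos y :=
    Real.cos_le_cos_of_nonneg_of_le_pi (by linarith) (by linarith) (by linarith)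
  have hsp : 0 ≤ Real.sin p := Real.sin_nonneg_of_nonneg_of_le_pi (by linarith) (by linarith)
  have hsq : 0 ≤ Real.sin q := Real.sin_nonneg_of_nonneg_of_le_pi (by linarith) (by linarith)
  refine le_of_mul_le_mul_right ?_ hcpos
  have k1 := mul_le_mul_of_nonneg_left hcy (mul_nonneg ht1'.le hsq)
  have k2 := mul_le_mul_of_nonneg_left hcx (mul_nonneg h2 hsp)
  linarith

/-- `exists_between_extremes` without an assumption on which side is longer. -/
theorem exists_between_extremes' (hQ : ConvexStrip Q) {α₁ β₁ α₂ β₂ t₁ t₂ t s : ℝ}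
    (hα₁ : Q α₁ t₁) (hβ₁ : Q β₁ t₁) (hext : ∀ ψ, Q ψ t₁ → α₁ ≤ ψ ∧ ψ ≤ β₁)
    (hα₂ : Q α₂ t₂) (hβ₂ : Q β₂ t₂) (h2 : 0 ≤ t₂) (h2t : t₂ < t) (ht1 : t < t₁)
    (hs : 2 * s = (β₂ - β₁) + (α₁ - α₂)) (hs0 : 0 < s) :
    ∃ u, 0 ≤ u ∧ u ≤ s ∧ StripSym Q ((β₁ - α₁) / 2 + u) t ∧
      t₁ * Real.sin (s - u) + t₂ * Real.sin u ≤ t * Real.sin s := by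
  rcases le_total (α₁ - α₂) (β₂ - β₁) with h | h
  · exact exists_between_extremes hQ hα₁ hβ₁ (fun ψ hψ => (hext ψ hψ).2) hα₂ hβ₂ h2 h2t ht1 hs hs0 h
      (hext _ hα₁).2
  · obtain ⟨u, h1, h2, h3, h4⟩ := exists_between_extremes hQ.negPhi (α₁ := -β₁) (β₁ := -α₁)
      (α₂ := -β₂) (β₂ := -α₂) (s := s) (by simpa using hβ₁) (by simpa using hα₁)
      (fun ψ hψ => by linarith [(hext _ hψ).1]) (by simpa using hβ₂) (by simpa using hα₂) h2 h2t ht1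
      (by linarith) hs0 (by linarith) (by linarith [(hext _ hα₁).2])
    refine ⟨u, h1, h2, ?_, h4⟩
    rw [negPhi_iff] at h3
    convert h3 using 1
    ring

theorem vert (hM : StripMono Q) {φ t₁ t₂ t : ℝ} (h1 : StripSym Q φ t₁) (h2 : StripSym Q φ t₂)
    (h1t : t₁ ≤ t) (ht2 : t ≤ t₂) : StripSym Q φ t := by
  rcases le_total 0 t with h | h
  · exact hM h2 (Or.inl ⟨h, ht2⟩)
  · exact hM h1 (Or.inr ⟨h1t, h⟩)

/-- The half width of a slice. -/
theorem exists_max (hQ : ConvexStrip Q) {ξ t : ℝ} (h : StripSym Q ξ t) :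
    ∃ α β, Q α t ∧ Q β t ∧ (∀ ψ, Q ψ t → α ≤ ψ ∧ ψ ≤ β) ∧ ∀ ξ, StripSym Q ξ t → 2 * |ξ| ≤ β - α := by
  obtain ⟨a, b, ha, hb, hab⟩ := h
  obtain ⟨α, β, hα, hβ, hext⟩ := hQ.extreme ha
  refine ⟨α, β, hα, hβ, hext, fun ξ ⟨a, b, ha, hb, hab⟩ => ?_⟩
  linarith [(hext a ha).1, (hext b hb).2]

/-- Points of a descending chord are in the symmetral. -/
theorem chord_descending (hQ : ConvexStrip Q) (hM : StripMono Q) {ξ₁ t₁ ξ₂ t₂ ζ t : ℝ}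
    (hx : StripSym Q ξ₁ t₁) (hy : StripSym Q ξ₂ t₂) (hξ : ξ₁ < ξ₂) (h1 : 0 ≤ ξ₁) (hζ1 : ξ₁ ≤ ζ)
    (hζ2 : ζ ≤ ξ₂) (h2 : 0 ≤ t₂) (ht2 : t₂ < t) (hc : t₂ * Real.cos ξ₁ < t₁ * Real.cos ξ₂)
    (e : t * Real.sin (ξ₂ - ξ₁) = t₁ * Real.sin (ξ₂ - ζ) + t₂ * Real.sin (ζ - ξ₁)) :
    StripSym Q ζ t := by
  have l2 := _root_.abs_lt.1 (hy.abs_lt hQ)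
  have hs : 0 < Real.sin (ξ₂ - ξ₁) := Real.sin_pos_of_pos_of_lt_pi (by linarith) (by linarith)
  have hcos2 : 0 < Real.cos ξ₂ := Real.cos_pos_of_mem_Ioo ⟨by linarith, by linarith⟩
  -- the chord as a function of the longitude
  obtain ⟨T, hT, hT1, hT2, hTζ⟩ : ∃ T : ℝ → ℝ, (∃ A B, ∀ x, T x = A * Real.cos x + B * Real.sin x) ∧
      T ξ₁ = t₁ ∧ T ξ₂ = t₂ ∧ T ζ = t := by
    refine ⟨fun x => (t₁ * Real.sin (ξ₂ - x) + t₂ * Real.sin (x - ξ₁)) / Real.sin (ξ₂ - ξ₁),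
      ⟨(t₁ * Real.sin ξ₂ - t₂ * Real.sin ξ₁) / Real.sin (ξ₂ - ξ₁),
        (t₂ * Real.cos ξ₁ - t₁ * Real.cos ξ₂) / Real.sin (ξ₂ - ξ₁), fun x => ?_⟩, ?_, ?_, ?_⟩
    · simp only [Real.sin_sub _ x, Real.sin_sub x]; ring
    · simp; field_simp
    · simp; field_simp
    · simp only []
      rw [div_eq_iff hs.ne', e]
  -- `T` is the level chord through the second endpoint, which does not increase on `[0, ξ₂]`, plus
  -- by `hc` a positive multiple of `sin (ξ₂ - z)`, which strictly decreases there.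
  have hanti : ∀ x y, 0 ≤ x → x < y → y ≤ ξ₂ → T y < T x := by
    intro x y hx0 hxy hy2
    have key : ∀ z, T z * (Real.cos ξ₂ * Real.sin (ξ₂ - ξ₁)) =
        t₂ * Real.sin (ξ₂ - ξ₁) * Real.cos z +
        (t₁ * Real.cos ξ₂ - t₂ * Real.cos ξ₁) * Real.sin (ξ₂ - z) := by
      intro z
      obtain ⟨A, B, hAB⟩ := hT
      rw [← hT1, ← hT2, hAB, hAB, hAB]
      simp only [Real.sin_sub]
      ring
    have h3 : Real.cos y ≤ Real.cos x :=
      Real.cos_le_cos_of_nonneg_of_le_pi hx0 (by linarith) hxy.le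
    have h4 : Real.sin (ξ₂ - y) < Real.sin (ξ₂ - x) :=
      Real.sin_lt_sin_of_lt_of_le_pi_div_two (by linarith) (by linarith) (by linarith)
    refine lt_of_mul_lt_mul_right ?_ (mul_pos hcos2 hs).le
    rw [key, key]
    have := mul_le_mul_of_nonneg_left h3 (mul_nonneg h2 hs.le)
    have := mul_lt_mul_of_pos_left h4 (sub_pos.2 hc)
    linarith
  rcases hζ1.eq_or_lt with rfl | hζ1
  · rw [hT1] at hTζ; rwa [← hTζ]
  have htt1 : t < t₁ := by rw [← hTζ, ← hT1]; exact hanti _ _ h1 hζ1 hζ2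
  obtain ⟨α₁, β₁, hα₁, hβ₁, hext₁, hmax₁⟩ := hx.exists_max hQ
  obtain ⟨α₂, β₂, hα₂, hβ₂, hext₂, hmax₂⟩ := hy.exists_max hQ
  obtain ⟨w₁, hw₁⟩ : ∃ w, w = (β₁ - α₁) / 2 := ⟨_, rfl⟩
  obtain ⟨w₂, hw₂⟩ : ∃ w, w = (β₂ - α₂) / 2 := ⟨_, rfl⟩
  have hαβ := (hext₁ _ hα₁).2
  have hξw₁ := hmax₁ _ hx
  have hξw₂ := hmax₂ _ hy
  rw [abs_of_nonneg h1] at hξw₁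
  rw [abs_of_nonneg (by linarith)] at hξw₂
  have hS1 : StripSym Q w₁ t₁ := ⟨α₁, β₁, hα₁, hβ₁, by rw [abs_of_nonneg (by linarith)]; linarith⟩
  have hS2 : StripSym Q w₂ t₂ := ⟨α₂, β₂, hα₂, hβ₂, by rw [abs_of_nonneg (by linarith)]; linarith⟩
  have lw2 := _root_.abs_lt.1 (hS2.abs_lt hQ)
  have hS1' : StripSym Q w₁ t := hM hS1 (Or.inl ⟨by linarith, htt1.le⟩)
  rcases le_or_gt ζ w₁ with h | h
  · exact hS1'.of_abs_le (by rw [abs_of_nonneg (by linarith), abs_of_nonneg (by linarith)]; exact h)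
  -- Beyond the upper slice, the comparison is with the chord from `(w₁, t₁)` to `(w₂, t₂)` between
  -- the ends of the centred slices: the slice at height `t` reaches at least to where this chord is
  -- no higher than `t`.
  obtain ⟨u, hu0, hus, hSu, hu⟩ := exists_between_extremes' hQ (s := w₂ - w₁) hα₁ hβ₁ hext₁ hα₂ hβ₂
    h2 ht2 htt1 (by linarith) (by linarith)
  rw [← hw₁] at hSu
  rcases le_or_gt ζ (w₁ + u) with h' | h'
  · exact hSu.of_abs_le (by rw [abs_of_nonneg (by linarith), abs_of_nonneg (by linarith)]; exact h')
  exfalso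
  -- the chord through the ends of the slices is higher than the given one
  obtain ⟨s, hs'⟩ : ∃ s, s = w₂ - w₁ := ⟨_, rfl⟩
  rw [← hs'] at hu hus
  have hss : 0 < Real.sin s := Real.sin_pos_of_pos_of_lt_pi (by linarith) (by linarith)
  -- The difference of the end chord and the given chord is itself a sinusoid. It is nonnegative at
  -- `w₁` and at `ξ₂`, hence at `ζ` between them.
  have hge : t * Real.sin s ≤ t₁ * Real.sin (s - (ζ - w₁)) + t₂ * Real.sin (ζ - w₁) := by
    obtain ⟨A, B, hAB⟩ := hT
    have i1 := sinusoid_interp (t₁ * Real.sin w₂ - t₂ * Real.sin w₁ - A * Real.sin s)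
      (t₂ * Real.cos w₁ - t₁ * Real.cos w₂ - B * Real.sin s) w₁ ζ ξ₂
    have e1 : ∀ y, (t₁ * Real.sin w₂ - t₂ * Real.sin w₁ - A * Real.sin s) * Real.cos y +
      (t₂ * Real.cos w₁ - t₁ * Real.cos w₂ - B * Real.sin s) * Real.sin y =
      t₁ * Real.sin (w₂ - y) + t₂ * Real.sin (y - w₁) - T y * Real.sin s := by
      intro y; rw [hAB, Real.sin_sub, Real.sin_sub]; ring
    rw [e1, e1, e1, hTζ, hT2, sub_self, Real.sin_zero, ← hs'] at i1
    have j1 : T w₁ ≤ t₁ := by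
      rw [← hT1]
      rcases (show ξ₁ ≤ w₁ by linarith).eq_or_lt with h | h
      · rw [h]
      · exact (hanti _ _ h1 h (by linarith)).le
    have j2 : t₂ * Real.sin s ≤ t₁ * Real.sin (w₂ - ξ₂) + t₂ * Real.sin (ξ₂ - w₁) := by
      have k := sin_add_le_sin_add_sin (x := w₂ - ξ₂) (y := ξ₂ - w₁) (by linarith) (by linarith)
        (by linarith)
      rw [show w₂ - ξ₂ + (ξ₂ - w₁) = s by linarith] at k
      have k1 := mul_le_mul_of_nonneg_left k h2
      have k2 : 0 ≤ Real.sin (w₂ - ξ₂) :=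
        Real.sin_nonneg_of_nonneg_of_le_pi (by linarith) (by linarith)
      have k3 : t₂ * Real.sin (w₂ - ξ₂) ≤ t₁ * Real.sin (w₂ - ξ₂) := by gcongr; linarith
      linarith
    have k4 : 0 < Real.sin (ξ₂ - w₁) := Real.sin_pos_of_pos_of_lt_pi (by linarith) (by linarith)
    have k5 : 0 ≤ Real.sin (ξ₂ - ζ) := Real.sin_nonneg_of_nonneg_of_le_pi (by linarith) (by linarith)
    have k6 : 0 ≤ Real.sin (ζ - w₁) := Real.sin_nonneg_of_nonneg_of_le_pi (by linarith) (by linarith)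
    have k7 := mul_nonneg (mul_nonneg (sub_nonneg.2 j1) hss.le) k5
    have k8 := mul_nonneg (sub_nonneg.2 j2) k6
    have k9 : 0 ≤ t₁ * Real.sin (w₂ - ζ) + t₂ * Real.sin (ζ - w₁) - t * Real.sin s := by
      refine nonneg_of_mul_nonneg_left ?_ k4
      linarith
    rw [show s - (ζ - w₁) = w₂ - ζ by linarith]
    linarith
  have := chord_gt_of_lt (a := ζ - w₁) (x := u) (by linarith) (by linarith) (by linarith)
    (by linarith) htt1 hu0 (by linarith) hge
  linarith

/-- Either the point is covered by monotonicity or by the level chord through an endpoint, or the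
chord descends to the second endpoint and `chord_descending` applies. If the first endpoint has
negative longitude and `ζ > -ξ₁`, replacing it by its mirror image raises the chord over `ζ`, and
monotonicity leads back down. -/
theorem chord_nonneg (hQ : ConvexStrip Q) (hM : StripMono Q) {ξ₁ t₁ ξ₂ t₂ ζ t : ℝ}
    (hx : StripSym Q ξ₁ t₁) (hy : StripSym Q ξ₂ t₂) (hξ : ξ₁ < ξ₂) (hζ1 : ξ₁ ≤ ζ)
    (hζ2 : ζ ≤ ξ₂) (h1 : 0 ≤ t₁) (h2 : 0 ≤ t₂) (hζ : 0 ≤ ζ)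
    (e : t * Real.sin (ξ₂ - ξ₁) = t₁ * Real.sin (ξ₂ - ζ) + t₂ * Real.sin (ζ - ξ₁)) :
    StripSym Q ζ t := by
  have l1 := _root_.abs_lt.1 (hx.abs_lt hQ)
  have l2 := _root_.abs_lt.1 (hy.abs_lt hQ)
  have hs : 0 < Real.sin (ξ₂ - ξ₁) := Real.sin_pos_of_pos_of_lt_pi (by linarith) (by linarith)
  have hcos1 : 0 < Real.cos ξ₁ := Real.cos_pos_of_mem_Ioo ⟨by linarith, by linarith⟩
  have hcos2 : 0 < Real.cos ξ₂ := Real.cos_pos_of_mem_Ioo ⟨by linarith, by linarith⟩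
  have s1 : 0 ≤ Real.sin (ξ₂ - ζ) := Real.sin_nonneg_of_nonneg_of_le_pi (by linarith) (by linarith)
  have s2 : 0 ≤ Real.sin (ζ - ξ₁) := Real.sin_nonneg_of_nonneg_of_le_pi (by linarith) (by linarith)
  have ht : 0 ≤ t := by
    refine nonneg_of_mul_nonneg_left ?_ hs
    rw [e]; positivity
  rcases le_or_gt t t₂ with h | htt2
  · exact (hM hy (Or.inl ⟨ht, h⟩)).of_abs_le
      (by rw [abs_of_nonneg hζ, abs_of_nonneg (by linarith)]; exact hζ2)
  rcases le_or_gt (t * Real.cos ξ₂) (t₂ * Real.cos ζ) with h | hT0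
  · exact of_level_chord hQ hM hy (by rw [abs_of_nonneg hζ, abs_of_nonneg (by linarith)]; exact hζ2)
      ht h
  have hcosζ : Real.cos ζ * Real.sin (ξ₂ - ξ₁) =
      Real.cos ξ₁ * Real.sin (ξ₂ - ζ) + Real.cos ξ₂ * Real.sin (ζ - ξ₁) := by
    simpa using sinusoid_interp 1 0 ξ₁ ζ ξ₂
  have hc : t₂ * Real.cos ξ₁ < t₁ * Real.cos ξ₂ := by
    have := mul_lt_mul_of_pos_right hT0 hs
    have h3 : t₂ * Real.cos ξ₁ * Real.sin (ξ₂ - ζ) < t₁ * Real.cos ξ₂ * Real.sin (ξ₂ - ζ) := by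
      linear_combination this - t₂ * hcosζ + Real.cos ξ₂ * e
    exact lt_of_mul_lt_mul_right h3 s1
  rcases le_or_gt 0 ξ₁ with h0 | h0
  · exact chord_descending hQ hM hx hy hξ h0 hζ1 hζ2 h2 htt2 hc e
  rcases le_or_gt ζ (-ξ₁) with h3 | h3
  · refine of_level_chord hQ hM hx (by rw [abs_of_nonneg hζ, abs_of_neg h0]; exact h3) ht ?_
    refine le_of_mul_le_mul_right ?_ hs
    have := mul_nonneg (sub_nonneg.2 hc.le) s2
    linear_combination this + t₁ * hcosζ * (-1) + Real.cos ξ₁ * e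
  · have hsa : 0 < Real.sin (ξ₂ - -ξ₁) := Real.sin_pos_of_pos_of_lt_pi (by linarith) (by linarith)
    obtain ⟨t', ht'⟩ : ∃ t', t' * Real.sin (ξ₂ - -ξ₁) =
        t₁ * Real.sin (ξ₂ - ζ) + t₂ * Real.sin (ζ - -ξ₁) :=
      ⟨(t₁ * Real.sin (ξ₂ - ζ) + t₂ * Real.sin (ζ - -ξ₁)) / Real.sin (ξ₂ - -ξ₁), by field_simp⟩
    have htt' : t ≤ t' := by
      have i1 : t' * Real.cos ξ₂ * Real.sin (ξ₂ - -ξ₁) = t₂ * Real.cos ζ * Real.sin (ξ₂ - -ξ₁) +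
          (t₁ * Real.cos ξ₂ - t₂ * Real.cos ξ₁) * Real.sin (ξ₂ - ζ) := by
        have := sinusoid_interp 1 0 (-ξ₁) ζ ξ₂
        simp only [Real.cos_neg, one_mul, zero_mul, add_zero] at this
        linear_combination Real.cos ξ₂ * ht' - t₂ * this
      have i2 : t * Real.cos ξ₂ * Real.sin (ξ₂ - ξ₁) = t₂ * Real.cos ζ * Real.sin (ξ₂ - ξ₁) +
          (t₁ * Real.cos ξ₂ - t₂ * Real.cos ξ₁) * Real.sin (ξ₂ - ζ) := by
        linear_combination Real.cos ξ₂ * e - t₂ * hcosζ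
      have i3 : Real.sin (ξ₂ - -ξ₁) ≤ Real.sin (ξ₂ - ξ₁) := by
        rw [sub_neg_eq_add, Real.sin_sub, Real.sin_add]
        have := Real.sin_nonpos_of_nonpos_of_neg_pi_le h0.le (by linarith)
        nlinarith
      have i4 : (t' * Real.cos ξ₂ - t₂ * Real.cos ζ) * Real.sin (ξ₂ - -ξ₁) =
          (t * Real.cos ξ₂ - t₂ * Real.cos ζ) * Real.sin (ξ₂ - ξ₁) := by linarith
      have i5 : (t * Real.cos ξ₂ - t₂ * Real.cos ζ) * Real.sin (ξ₂ - -ξ₁) ≤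
          (t * Real.cos ξ₂ - t₂ * Real.cos ζ) * Real.sin (ξ₂ - ξ₁) :=
        mul_le_mul_of_nonneg_left i3 (by linarith)
      rw [← i4] at i5
      have i6 := le_of_mul_le_mul_right i5 hsa
      exact le_of_mul_le_mul_right (by linarith) hcos2
    refine hM (t' := t') ?_ (Or.inl ⟨ht, htt'⟩)
    refine chord_descending hQ hM hx.neg hy (by linarith) (by linarith) h3.le hζ2 h2
      (by linarith) (by rwa [Real.cos_neg]) ht'

/-- The symmetral of a convex set with the angular monotonicity property is convex. -/
theorem chord (hQ : ConvexStrip Q) (hM : StripMono Q) {ξ₁ t₁ ξ₂ t₂ ζ t : ℝ}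
    (hx : StripSym Q ξ₁ t₁) (hy : StripSym Q ξ₂ t₂) (hξ : ξ₁ < ξ₂) (hζ1 : ξ₁ ≤ ζ)
    (hζ2 : ζ ≤ ξ₂)
    (e : t * Real.sin (ξ₂ - ξ₁) = t₁ * Real.sin (ξ₂ - ζ) + t₂ * Real.sin (ζ - ξ₁)) :
    StripSym Q ζ t := by
  wlog ht : 0 ≤ t generalizing Q t₁ t₂ t
  · have := this (Q := fun φ t => Q φ (-t)) (t₁ := -t₁) (t₂ := -t₂) (t := -t) hQ.negT
      (fun φ t t' h1 h2 => hM (φ := φ) (t := -t) (t' := -t') h1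
        (h2.symm.imp (fun h => ⟨by linarith, by linarith⟩) (fun h => ⟨by linarith, by linarith⟩)))
      (by simpa [StripSym] using hx) (by simpa [StripSym] using hy)
      (by linear_combination -e) (by linarith)
    simpa [StripSym] using this
  wlog hζ : 0 ≤ ζ generalizing ξ₁ t₁ ξ₂ t₂ ζ
  · have := this (ξ₁ := -ξ₂) (t₁ := t₂) (ξ₂ := -ξ₁) (t₂ := t₁) (ζ := -ζ)
      (by linarith) (by linarith) (by linarith) hy.neg hx.neg (by
        rw [show -ξ₁ - -ξ₂ = ξ₂ - ξ₁ by ring, show -ξ₁ - -ζ = ζ - ξ₁ by ring,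
          show -ζ - -ξ₂ = ξ₂ - ζ by ring]
        linarith) (by linarith)
    simpa using this.neg
  have l1 := _root_.abs_lt.1 (hx.abs_lt hQ)
  have l2 := _root_.abs_lt.1 (hy.abs_lt hQ)
  have hs : 0 < Real.sin (ξ₂ - ξ₁) := Real.sin_pos_of_pos_of_lt_pi (by linarith) (by linarith)
  have s1 : 0 ≤ Real.sin (ξ₂ - ζ) := Real.sin_nonneg_of_nonneg_of_le_pi (by linarith) (by linarith)
  have s2 : 0 ≤ Real.sin (ζ - ξ₁) := Real.sin_nonneg_of_nonneg_of_le_pi (by linarith) (by linarith)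
  -- The axis slice is the longest, so endpoints of negative height may be moved up to the axis.
  -- This only raises the chord, and monotonicity returns to the original point.
  have raise : ∀ {ξ τ}, StripSym Q ξ τ → StripSym Q ξ (max τ 0) := by
    intro ξ τ h
    rcases le_total τ 0 with h0 | h0
    · rw [max_eq_right h0]; exact hM h (Or.inr ⟨h0, le_rfl⟩)
    · rwa [max_eq_left h0]
  obtain ⟨t', ht'⟩ : ∃ t', t' * Real.sin (ξ₂ - ξ₁) =
      max t₁ 0 * Real.sin (ξ₂ - ζ) + max t₂ 0 * Real.sin (ζ - ξ₁) :=
    ⟨(max t₁ 0 * Real.sin (ξ₂ - ζ) + max t₂ 0 * Real.sin (ζ - ξ₁)) / Real.sin (ξ₂ - ξ₁),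
      by field_simp⟩
  have h := chord_nonneg hQ hM (raise hx) (raise hy) hξ hζ1 hζ2 (le_max_right _ _)
    (le_max_right _ _) hζ ht'
  refine hM h (Or.inl ⟨ht, le_of_mul_le_mul_right ?_ hs⟩)
  rw [e, ht']
  gcongr <;> exact le_max_left _ _

end StripSym

/-! ### Two criteria for connected and monotone slices -/

/-- The slices are intervals. -/
def StripConn (Q : ℝ → ℝ → Prop) : Prop :=
  ∀ ⦃α β φ t⦄, Q α t → Q β t → α ≤ φ → φ ≤ β → Q φ t

namespace ConvexStrip

variable {Q : ℝ → ℝ → Prop}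

/-- A point between two points of equal nonnegative height lies below the chord. -/
theorem exists_above (hQ : ConvexStrip Q) {α β φ t : ℝ} (hα : Q α t) (hβ : Q β t) (hαφ : α ≤ φ)
    (hφβ : φ ≤ β) (ht : 0 ≤ t) : ∃ t', t ≤ t' ∧ Q φ t' := by
  rcases (hαφ.trans hφβ).eq_or_lt with h | h
  · exact ⟨t, le_rfl, by rwa [show φ = α by linarith]⟩
  have l1 := abs_lt.1 (hQ.lt hα)
  have l2 := abs_lt.1 (hQ.lt hβ)
  have hs : 0 < Real.sin (β - α) := Real.sin_pos_of_pos_of_lt_pi (by linarith) (by linarith)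
  refine ⟨(t * Real.sin (β - φ) + t * Real.sin (φ - α)) / Real.sin (β - α), ?_,
    hQ.chord hα hβ h hαφ hφβ (by field_simp)⟩
  rw [le_div_iff₀ hs, ← mul_add]
  have := sin_add_le_sin_add_sin (x := β - φ) (y := φ - α) (by linarith) (by linarith) (by linarith)
  rw [show β - φ + (φ - α) = β - α by ring] at this
  gcongr

theorem conn_zero (hQ : ConvexStrip Q) {α β φ : ℝ} (hα : Q α 0) (hβ : Q β 0) (hαφ : α ≤ φ)
    (hφβ : φ ≤ β) : Q φ 0 := by
  rcases (hαφ.trans hφβ).eq_or_lt with h | h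
  · rwa [show φ = α by linarith]
  · exact hQ.chord hα hβ h hαφ hφβ (by simp)

/-- Each point brings its meridian segment down to the axis, so the slices are nested. -/
theorem mono_of_proj (hQ : ConvexStrip Q) (hp : ∀ φ t, Q φ t → Q φ 0) : StripMono Q := by
  rintro φ t t' ⟨a, b, ha, hb, hab⟩ ht
  have key : ∀ a, Q a t' → Q a t := by
    intro a ha
    rcases ht with ht | ht
    · exact hQ.vert (hp _ _ ha) ha ht.1 ht.2
    · exact hQ.vert ha (hp _ _ ha) ht.1 ht.2
  exact ⟨a, b, key a ha, key b hb, hab⟩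

theorem conn_of_nonneg {Q : ℝ → ℝ → Prop}
    (h : ∀ ⦃α β φ t⦄, 0 ≤ t → Q α t → Q β t → α ≤ φ → φ ≤ β → Q φ t)
    (h' : ∀ ⦃α β φ t⦄, 0 ≤ t → Q α (-t) → Q β (-t) → α ≤ φ → φ ≤ β → Q φ (-t)) :
    StripConn Q := by
  intro α β φ t hα hβ h1 h2
  rcases le_total 0 t with ht | ht
  · exact h ht hα hβ h1 h2
  · rw [← neg_neg t] at hα hβ ⊢
    exact h' (by linarith) hα hβ h1 h2

/-- A point between two points of its slice lies between the chord joining them and the axis, on a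
meridian segment contained in `Q`. -/
theorem conn_of_proj (hQ : ConvexStrip Q) (hp : ∀ φ t, Q φ t → Q φ 0) : StripConn Q := by
  have key : ∀ {Q : ℝ → ℝ → Prop}, ConvexStrip Q → (∀ φ t, Q φ t → Q φ 0) →
      ∀ ⦃α β φ t⦄, 0 ≤ t → Q α t → Q β t → α ≤ φ → φ ≤ β → Q φ t := by
    intro Q hQ hp α β φ t ht hα hβ h1 h2
    obtain ⟨t', htt', h'⟩ := hQ.exists_above hα hβ h1 h2 ht
    exact hQ.vert (hp _ _ h') h' ht htt'
  refine conn_of_nonneg (key hQ hp) (key hQ.negT fun φ t h => ?_)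
  simpa using hp _ _ h

theorem center_of_central (hQ : ConvexStrip Q) (hc : ∀ φ t, Q φ t → Q (-φ) (-t)) {φ t : ℝ}
    (h : Q φ t) : Q 0 0 := by
  wlog hφ : 0 ≤ φ generalizing φ t
  · exact this (hc _ _ h) (by linarith)
  rcases hφ.eq_or_lt with rfl | hφ
  · have h' := hc _ _ h
    rw [neg_zero] at h'
    rcases le_total 0 t with ht | ht
    · exact hQ.vert h' h (by linarith) ht
    · exact hQ.vert h h' ht (by linarith)
  · refine hQ.chord (hc _ _ h) h (by linarith) (by linarith) hφ.le ?_
    simp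

/-- The set contains the centre. For `t ≥ 0` and `φ ≥ 0`, a point between two points of its slice
lies below the chord joining them and above the arc from the centre to the right one, since `sin φ ≤
sin β`. -/
theorem conn_of_central (hQ : ConvexStrip Q) (hc : ∀ φ t, Q φ t → Q (-φ) (-t)) : StripConn Q := by
  have key : ∀ {Q : ℝ → ℝ → Prop}, ConvexStrip Q → (∀ φ t, Q φ t → Q (-φ) (-t)) →
      ∀ ⦃α β φ t⦄, 0 ≤ t → 0 ≤ φ → Q α t → Q β t → α ≤ φ → φ ≤ β → Q φ t := by
    intro Q hQ hc α β φ t ht hφ hα hβ h1 h2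
    obtain ⟨t', htt', h'⟩ := hQ.exists_above hα hβ h1 h2 ht
    have h0 := hQ.center_of_central hc hα
    have l1 := abs_lt.1 (hQ.lt hβ)
    rcases (hφ.trans h2).eq_or_lt with hβ0 | hβ0
    · have : φ = 0 := by linarith
      subst this
      exact hQ.vert h0 h' ht htt'
    have hs : 0 < Real.sin β := Real.sin_pos_of_pos_of_lt_pi (by linarith) (by linarith)
    have hlow : Q φ (t * Real.sin φ / Real.sin β) :=
      hQ.chord h0 hβ hβ0 hφ h2 (by simp; field_simp)
    refine hQ.vert hlow h' ?_ htt'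
    rw [div_le_iff₀ hs]
    exact mul_le_mul_of_nonneg_left
      (Real.sin_le_sin_of_le_of_le_pi_div_two (by linarith) (by linarith) h2) ht
  have key2 : ∀ {Q : ℝ → ℝ → Prop}, ConvexStrip Q → (∀ φ t, Q φ t → Q (-φ) (-t)) →
      ∀ ⦃α β φ t⦄, 0 ≤ t → Q α t → Q β t → α ≤ φ → φ ≤ β → Q φ t := by
    intro Q hQ hc α β φ t ht hα hβ h1 h2
    rcases le_total 0 φ with hφ | hφ
    · exact key hQ hc ht hφ hα hβ h1 h2
    · have := key hQ.negPhi (fun φ t h => hc _ _ h) (α := -β) (β := -α) (φ := -φ) ht (by linarith)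
        (by simpa using hβ) (by simpa using hα) (by linarith) (by linarith)
      simpa using this
  exact conn_of_nonneg (key2 hQ hc) (key2 hQ.negT fun φ t h => hc _ _ h)

/-- The chord between two points whose heights are opposite. -/
theorem chord_opposite (hQ : ConvexStrip Q) {c η x t t' : ℝ} (h1 : Q (c - η) (-t'))
    (h2 : Q (c + η) t') (hx : |x| ≤ |η|) (ht : t * Real.sin η = t' * Real.sin x) (htt : |t| ≤ t') :
    Q (c + x) t := by
  rcases lt_trichotomy η 0 with h | rfl | h
  · have hx' := abs_le.1 hx
    rw [abs_of_neg h] at hx'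
    refine hQ.chord h2 h1 (by linarith) (by linarith) (by linarith) ?_
    rw [show c - η - (c + η) = -(2 * η) by ring, show c - η - (c + x) = -(η + x) by ring,
      show c + x - (c + η) = x - η by ring, Real.sin_neg, Real.sin_neg, Real.sin_two_mul,
      Real.sin_add, Real.sin_sub]
    linear_combination -2 * Real.cos η * ht
  · have : x = 0 := by simpa using hx
    subst this
    have hx' := abs_le.1 htt
    exact hQ.vert (by simpa using h1) (by simpa using h2) hx'.1 hx'.2
  · have hx' := abs_le.1 hx
    rw [abs_of_pos h] at hx'
    refine hQ.chord h1 h2 (by linarith) (by linarith) (by linarith) ?_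
    rw [show c + η - (c - η) = 2 * η by ring, show c + η - (c + x) = η - x by ring,
      show c + x - (c - η) = η + x by ring, Real.sin_two_mul,
      Real.sin_add, Real.sin_sub]
    linear_combination 2 * Real.cos η * ht

/-- For a pair `a, b` at height `t'`, the set also contains `-b, -a` at height `-t'`. The chords
from `-b` to `a` and from `-a` to `b` are translates of each other by `b - a` in longitude, so they
cut every intermediate height in points `b - a` apart. -/
theorem mono_of_central (hQ : ConvexStrip Q) (hc : ∀ φ t, Q φ t → Q (-φ) (-t)) : StripMono Q := by
  have key : ∀ {Q : ℝ → ℝ → Prop}, ConvexStrip Q → (∀ φ t, Q φ t → Q (-φ) (-t)) →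
      ∀ ⦃φ t t'⦄, StripSym Q φ t' → 0 ≤ t → t ≤ t' → StripSym Q φ t := by
    rintro Q hQ hc φ t t' ⟨a, b, ha, hb, hab⟩ ht htt'
    have l1 := abs_lt.1 (hQ.lt ha)
    have l2 := abs_lt.1 (hQ.lt hb)
    obtain ⟨η, hη⟩ : ∃ η, η = (a + b) / 2 := ⟨_, rfl⟩
    obtain ⟨x, hx, hxt⟩ : ∃ x, |x| ≤ |η| ∧ t * Real.sin η = t' * Real.sin x := by
      rcases (ht.trans htt').eq_or_lt with h0 | h0
      · exact ⟨η, le_rfl, by rw [show t = t' by linarith]⟩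
      have hr0 : 0 ≤ t / t' := div_nonneg ht h0.le
      have hr1 : t / t' ≤ 1 := div_le_one_of_le₀ htt' h0.le
      refine ⟨Real.arcsin (t / t' * Real.sin η), ?_, ?_⟩
      · rcases le_total 0 η with h | h
        · have hsη := Real.sin_nonneg_of_nonneg_of_le_pi h (by linarith)
          rw [abs_of_nonneg h, abs_of_nonneg (Real.arcsin_nonneg.2 (by positivity))]
          rw [← Real.arcsin_sin (x := η) (by linarith) (by linarith)]
          apply Real.monotone_arcsin
          rw [Real.arcsin_sin (by linarith) (by linarith)]
          nlinarith
        · have hsη := Real.sin_nonpos_of_nonpos_of_neg_pi_le h (by linarith)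
          rw [abs_of_nonpos h, abs_of_nonpos (Real.arcsin_nonpos.2
            (mul_nonpos_of_nonneg_of_nonpos hr0 hsη)), neg_le_neg_iff]
          rw [← Real.arcsin_sin (x := η) (by linarith) (by linarith)]
          apply Real.monotone_arcsin
          rw [Real.arcsin_sin (by linarith) (by linarith)]
          nlinarith
      · have h1 := Real.neg_one_le_sin η
        have h2 := Real.sin_le_one η
        rw [Real.sin_arcsin (by nlinarith) (by nlinarith)]
        field_simp
    have habs : |t| ≤ t' := by rwa [abs_of_nonneg ht]
    have p1 := hQ.chord_opposite (c := -((b - a) / 2)) (η := η) (x := x) (t := t) (t' := t')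
      (by convert hc _ _ hb using 1; linarith) (by convert ha using 1; linarith) hx hxt habs
    have p2 := hQ.chord_opposite (c := (b - a) / 2) (η := η) (x := x) (t := t) (t' := t')
      (by convert hc _ _ ha using 1; linarith) (by convert hb using 1; linarith) hx hxt habs
    exact ⟨_, _, p1, p2, by linarith⟩
  rintro φ t t' h (ht | ht)
  · exact key hQ hc h ht.1 ht.2
  · have := key (Q := fun φ t => Q φ (-t)) hQ.negT (fun φ t h => hc _ _ h) (φ := φ) (t := -t)
      (t' := -t') (by simpa [StripSym] using h) (by linarith) (by linarith)
    simpa [StripSym] using this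

end ConvexStrip

/-! ### The spherical metric and its topology -/

namespace S2

theorem dot_comm (x y : S2) : dot x y = dot y x := real_inner_comm _ _

theorem dot_self (x : S2) : dot x x = 1 := by simp [dot, norm_vec]

theorem dist_le_pi (x y : S2) : dist x y ≤ π := Real.arccos_le_pi _

theorem abs_dot_le_one (x y : S2) : |dot x y| ≤ 1 := by
  have := abs_real_inner_le_norm x.vec y.vec
  simpa [norm_vec, dot] using this

theorem cos_dist (x y : S2) : Real.cos (dist x y) = dot x y :=
  Real.cos_arccos (abs_le.1 (abs_dot_le_one x y)).1 (abs_le.1 (abs_dot_le_one x y)).2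

theorem dist_le_iff {x y : S2} {r : ℝ} (h0 : 0 ≤ r) (hr : r ≤ π) :
    dist x y ≤ r ↔ Real.cos r ≤ dot x y := by
  rw [← cos_dist]
  exact (Real.strictAntiOn_cos.le_iff_ge ⟨h0, hr⟩ ⟨dist_nonneg, dist_le_pi x y⟩).symm

theorem dist_lt_iff {x y : S2} {r : ℝ} (h0 : 0 ≤ r) (hr : r ≤ π) :
    dist x y < r ↔ Real.cos r < dot x y := by
  rw [← cos_dist]
  exact (Real.strictAntiOn_cos.lt_iff_gt ⟨h0, hr⟩ ⟨dist_nonneg, dist_le_pi x y⟩).symm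

theorem continuous_vec : Continuous vec := by
  rw [Metric.continuous_iff]
  intro b ε hε
  refine ⟨ε, hε, fun a ha => ?_⟩
  have h1 : dist a.vec b.vec ^ 2 = 2 - 2 * Real.cos (dist a b) := by
    rw [dist_eq_norm, norm_sub_sq_real, norm_vec, norm_vec, cos_dist, dot]; ring
  have h2 : dist a.vec b.vec ^ 2 ≤ dist a b ^ 2 := by
    rw [h1]
    linarith [Real.one_sub_sq_div_two_le_cos (x := dist a b)]
  exact (abs_le_of_sq_le_sq' h2 dist_nonneg).2.trans_lt ha

theorem continuous_dot_left (y : S2) : Continuous fun x => dot x y :=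
  continuous_vec.inner continuous_const

theorem continuous_of_continuous_vec {X : Type*} [TopologicalSpace X] {f : X → S2}
    (hf : Continuous fun x => (f x).vec) : Continuous f := by
  rw [continuous_iff_continuousAt]
  intro x
  rw [ContinuousAt, tendsto_iff_dist_tendsto_zero]
  have : Continuous fun y => Real.arccos (inner ℝ (f y).vec (f x).vec) :=
    Real.continuous_arccos.comp (hf.inner continuous_const)
  have h := this.tendsto x
  have h0 : Real.arccos (inner ℝ (f x).vec (f x).vec) = 0 := by simp [norm_vec]
  rw [h0] at h
  exact h

instance : CompactSpace S2 := by
  let f : Metric.sphere (0 : EuclideanSpace ℝ (Fin 3)) 1 → S2 := fun x => ⟨x.1, by simp⟩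
  have hf : Continuous f := continuous_of_continuous_vec continuous_subtype_val
  have hs : Function.Surjective f := fun x => ⟨⟨x.1, by simpa using x.2⟩, rfl⟩
  exact hs.compactSpace hf

end S2

theorem mem_openHemisphere_iff {c p : S2} : p ∈ openHemisphere c ↔ 0 < S2.dot p c := by
  rw [openHemisphere, Metric.mem_ball, S2.dist_lt_iff (by positivity) (by linarith [Real.pi_pos])]
  simp

/-! ### Coordinates with respect to a frame -/

namespace SteinerFrame

variable (F : SteinerFrame)

theorem orthonormal : Orthonormal ℝ ![F.center.vec, F.axisDir.vec, F.pole.vec] := by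
  have h1 : inner ℝ F.center.vec F.axisDir.vec = 0 := F.center_axisDir
  have h2 : inner ℝ F.center.vec F.pole.vec = 0 := F.center_pole
  have h3 : inner ℝ F.axisDir.vec F.pole.vec = 0 := F.axisDir_pole
  have h1' := h1; have h2' := h2; have h3' := h3
  rw [real_inner_comm] at h1' h2' h3'
  constructor
  · intro i
    fin_cases i <;> simp [S2.norm_vec]
  · intro i j hij
    fin_cases i <;> fin_cases j <;> simp_all

/-- The orthonormal basis given by a frame. -/
noncomputable def basis : OrthonormalBasis (Fin 3) ℝ (EuclideanSpace ℝ (Fin 3)) :=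
  (basisOfOrthonormalOfCardEqFinrank F.orthonormal (by simp)).toOrthonormalBasis
    (by simpa using F.orthonormal)

theorem coe_basis : ⇑F.basis = ![F.center.vec, F.axisDir.vec, F.pole.vec] := by
  simp [basis]

theorem vec_eq (p : S2) : p.vec = S2.dot p F.center • F.center.vec +
    S2.dot p F.axisDir • F.axisDir.vec + S2.dot p F.pole • F.pole.vec := by
  have h := (F.basis.sum_repr' p.vec).symm
  simp only [coe_basis, Fin.sum_univ_three] at h
  simpa [S2.dot, real_inner_comm] using h

theorem dot_eq (p q : S2) : S2.dot p q = S2.dot p F.center * S2.dot q F.center +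
    S2.dot p F.axisDir * S2.dot q F.axisDir + S2.dot p F.pole * S2.dot q F.pole := by
  have h := (F.basis.sum_inner_mul_inner p.vec q.vec).symm
  simp only [coe_basis, Fin.sum_univ_three] at h
  simpa [S2.dot, real_inner_comm] using h

theorem sq_add_sq_add_sq (p : S2) :
    S2.dot p F.center ^ 2 + S2.dot p F.axisDir ^ 2 + S2.dot p F.pole ^ 2 = 1 := by
  rw [← S2.dot_self p, F.dot_eq p p]; ring

theorem ext_dot {p q : S2} (h1 : S2.dot p F.center = S2.dot q F.center)
    (h2 : S2.dot p F.axisDir = S2.dot q F.axisDir) (h3 : S2.dot p F.pole = S2.dot q F.pole) :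
    p = q := by
  apply S2.vec_injective
  rw [F.vec_eq p, F.vec_eq q, h1, h2, h3]

theorem inner_comb (a b c a' b' c' : ℝ) :
    inner ℝ (a • F.center.vec + b • F.axisDir.vec + c • F.pole.vec)
      (a' • F.center.vec + b' • F.axisDir.vec + c' • F.pole.vec) = a * a' + b * b' + c * c' := by
  have h1 : inner ℝ F.center.vec F.axisDir.vec = 0 := F.center_axisDir
  have h2 : inner ℝ F.center.vec F.pole.vec = 0 := F.center_pole
  have h3 : inner ℝ F.axisDir.vec F.pole.vec = 0 := F.axisDir_pole
  have h1' := h1; have h2' := h2; have h3' := h3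
  rw [real_inner_comm] at h1' h2' h3'
  simp only [inner_add_left, inner_add_right, inner_smul_left, inner_smul_right, h1, h2, h3, h1',
    h2', h3', real_inner_self_eq_norm_sq, S2.norm_vec]
  simp [mul_comm]

/-- The point with given coordinates. -/
noncomputable def ofCoord (a b c : ℝ) (h : a ^ 2 + b ^ 2 + c ^ 2 = 1) : S2 :=
  ⟨a • F.center.vec + b • F.axisDir.vec + c • F.pole.vec, by
    rw [← sq_eq_sq₀ (norm_nonneg _) zero_le_one, ← real_inner_self_eq_norm_sq, inner_comb, one_pow,
      ← h]
    ring⟩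

variable {F} in
@[simp] theorem dot_ofCoord_center {a b c : ℝ} (h : a ^ 2 + b ^ 2 + c ^ 2 = 1) :
    S2.dot (F.ofCoord a b c h) F.center = a := by
  have := F.inner_comb a b c 1 0 0
  simpa [S2.dot, ofCoord, S2.vec] using this

variable {F} in
@[simp] theorem dot_ofCoord_axisDir {a b c : ℝ} (h : a ^ 2 + b ^ 2 + c ^ 2 = 1) :
    S2.dot (F.ofCoord a b c h) F.axisDir = b := by
  have := F.inner_comb a b c 0 1 0
  simpa [S2.dot, ofCoord, S2.vec] using this

variable {F} in
@[simp] theorem dot_ofCoord_pole {a b c : ℝ} (h : a ^ 2 + b ^ 2 + c ^ 2 = 1) :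
    S2.dot (F.ofCoord a b c h) F.pole = c := by
  have := F.inner_comb a b c 0 0 1
  simpa [S2.dot, ofCoord, S2.vec] using this

/-- The point with longitude `φ` and latitude `θ`. -/
noncomputable def pt (φ θ : ℝ) : S2 :=
  F.ofCoord (Real.cos θ * Real.cos φ) (Real.cos θ * Real.sin φ) (Real.sin θ) (by
    rw [mul_pow, mul_pow, ← mul_add, Real.cos_sq_add_sin_sq, mul_one, Real.cos_sq_add_sin_sq])

variable {F} in
@[simp] theorem dot_pt_center (φ θ : ℝ) :
    S2.dot (F.pt φ θ) F.center = Real.cos θ * Real.cos φ := dot_ofCoord_center _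

variable {F} in
@[simp] theorem dot_pt_axisDir (φ θ : ℝ) :
    S2.dot (F.pt φ θ) F.axisDir = Real.cos θ * Real.sin φ := dot_ofCoord_axisDir _

variable {F} in
@[simp] theorem dot_pt_pole (φ θ : ℝ) : S2.dot (F.pt φ θ) F.pole = Real.sin θ := dot_ofCoord_pole _

theorem continuous_pt : Continuous fun x : ℝ × ℝ => F.pt x.1 x.2 := by
  apply S2.continuous_of_continuous_vec
  change Continuous fun x : ℝ × ℝ => (Real.cos x.2 * Real.cos x.1) • F.center.vec +
    (Real.cos x.2 * Real.sin x.1) • F.axisDir.vec + Real.sin x.2 • F.pole.vec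
  fun_prop

variable {F}

theorem mem_S_iff {p : S2} : p ∈ F.S ↔ 0 < S2.dot p F.center := mem_openHemisphere_iff

theorem theta_mem {p : S2} (hp : p ∈ F.S) : |F.theta p| < π / 2 := by
  have h := F.sq_add_sq_add_sq p
  have h0 := mem_S_iff.1 hp
  have h1 : |S2.dot p F.pole| < 1 := by
    rw [← sq_lt_one_iff_abs_lt_one]
    nlinarith [sq_nonneg (S2.dot p F.axisDir)]
  have h2 := abs_lt.1 h1
  exact abs_lt.2 ⟨Real.neg_pi_div_two_lt_arcsin.2 h2.1, Real.arcsin_lt_pi_div_two.2 h2.2⟩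

theorem phi_mem (p : S2) : |F.phi p| < π / 2 :=
  abs_lt.2 ⟨Real.neg_pi_div_two_lt_arctan _, Real.arctan_lt_pi_div_two _⟩

theorem cos_pos_of_abs_lt {x : ℝ} (h : |x| < π / 2) : 0 < Real.cos x :=
  Real.cos_pos_of_mem_Ioo (abs_lt.1 h)

theorem sin_theta (p : S2) : Real.sin (F.theta p) = S2.dot p F.pole := by
  have := abs_le.1 (S2.abs_dot_le_one p F.pole)
  exact Real.sin_arcsin this.1 this.2

theorem pt_phi_theta {p : S2} (hp : p ∈ F.S) : F.pt (F.phi p) (F.theta p) = p := by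
  have h := F.sq_add_sq_add_sq p
  have h0 := mem_S_iff.1 hp
  have hct := cos_pos_of_abs_lt (theta_mem hp)
  have hcp := cos_pos_of_abs_lt (phi_mem (F := F) p)
  have htan : Real.tan (F.phi p) = S2.dot p F.axisDir / S2.dot p F.center := Real.tan_arctan _
  rw [Real.tan_eq_sin_div_cos, div_eq_div_iff hcp.ne' h0.ne'] at htan
  have hs := sin_theta (F := F) p
  have e1 : Real.cos (F.theta p) * Real.cos (F.phi p) = S2.dot p F.center := by
    have k1 := Real.sin_sq_add_cos_sq (F.theta p)
    have k2 := Real.sin_sq_add_cos_sq (F.phi p)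
    rw [hs] at k1
    have k3 : (Real.cos (F.theta p) * Real.cos (F.phi p)) ^ 2 = S2.dot p F.center ^ 2 := by
      have : Real.cos (F.theta p) ^ 2 = S2.dot p F.center ^ 2 + S2.dot p F.axisDir ^ 2 := by
        linarith
      rw [mul_pow, this]
      have k4 : (Real.sin (F.phi p) * S2.dot p F.center) ^ 2 =
        (S2.dot p F.axisDir * Real.cos (F.phi p)) ^ 2 := by rw [htan]
      linear_combination (S2.dot p F.center ^ 2) * k2 - k4
    exact (sq_eq_sq₀ (by positivity) h0.le).1 k3
  apply F.ext_dot
  · rw [dot_pt_center, e1]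
  · rw [dot_pt_axisDir]
    have : Real.cos (F.theta p) * Real.sin (F.phi p) * S2.dot p F.center =
        S2.dot p F.axisDir * S2.dot p F.center := by
      rw [mul_assoc, htan, ← e1]; ring
    exact mul_right_cancel₀ h0.ne' this
  · rw [dot_pt_pole, hs]

theorem pt_mem_S {φ θ : ℝ} (hφ : |φ| < π / 2) (hθ : |θ| < π / 2) : F.pt φ θ ∈ F.S := by
  rw [mem_S_iff, dot_pt_center]
  exact mul_pos (cos_pos_of_abs_lt hθ) (cos_pos_of_abs_lt hφ)

theorem theta_pt {φ θ : ℝ} (hθ : |θ| < π / 2) : F.theta (F.pt φ θ) = θ := by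
  have := abs_lt.1 hθ
  rw [theta, dot_pt_pole, Real.arcsin_sin this.1.le this.2.le]

theorem phi_pt {φ θ : ℝ} (hφ : |φ| < π / 2) (hθ : |θ| < π / 2) : F.phi (F.pt φ θ) = φ := by
  have := abs_lt.1 hφ
  rw [phi, dot_pt_axisDir, dot_pt_center, mul_div_mul_left _ _ (cos_pos_of_abs_lt hθ).ne',
    ← Real.tan_eq_sin_div_cos, Real.arctan_tan this.1 this.2]

theorem continuous_theta : Continuous F.theta :=
  Real.continuous_arcsin.comp (S2.continuous_dot_left _)

theorem continuousOn_phi : ContinuousOn F.phi F.S := by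
  refine Real.continuous_arctan.comp_continuousOn (ContinuousOn.div
    (S2.continuous_dot_left _).continuousOn (S2.continuous_dot_left _).continuousOn ?_)
  intro p hp
  exact (mem_S_iff.1 hp).ne'

theorem isOpen_S : IsOpen F.S := Metric.isOpen_ball

/-- A set in the coordinates longitude and tangent of the latitude. -/
def strip (F : SteinerFrame) (K : Set S2) (φ t : ℝ) : Prop :=
  |φ| < π / 2 ∧ F.pt φ (Real.arctan t) ∈ K

theorem abs_arctan_lt (t : ℝ) : |Real.arctan t| < π / 2 :=
  abs_lt.2 ⟨Real.neg_pi_div_two_lt_arctan _, Real.arctan_lt_pi_div_two _⟩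

theorem strip_phi_tan {K : Set S2} {p : S2} (hp : p ∈ F.S) :
    F.strip K (F.phi p) (Real.tan (F.theta p)) ↔ p ∈ K := by
  have := abs_lt.1 (theta_mem hp)
  rw [strip, Real.arctan_tan this.1 this.2, pt_phi_theta hp]
  exact ⟨fun h => h.2, fun h => ⟨phi_mem p, h⟩⟩

/-- Points on a chord. -/
theorem pt_mem_sphSegment {φ₁ t₁ φ₂ t₂ φ t a b : ℝ} (ha : 0 ≤ a) (hb : 0 ≤ b)
    (hc : Real.cos φ = a * Real.cos φ₁ + b * Real.cos φ₂)
    (hs : Real.sin φ = a * Real.sin φ₁ + b * Real.sin φ₂) (ht : t = a * t₁ + b * t₂) :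
    F.pt φ (Real.arctan t) ∈
      sphSegment (F.pt φ₁ (Real.arctan t₁)) (F.pt φ₂ (Real.arctan t₂)) := by
  have h0 : ∀ x, 0 < Real.cos (Real.arctan x) := Real.cos_arctan_pos
  have hsin : ∀ x, Real.sin (Real.arctan x) = Real.cos (Real.arctan x) * x := by
    intro x
    have := Real.tan_mul_cos (h0 x).ne'
    rw [Real.tan_arctan] at this
    linarith
  -- In the frame the position vector is `cos (arctan t)` times `(cos φ, sin φ, t)`, so the
  -- coefficients only have to be rescaled.
  refine ⟨Real.cos (Real.arctan t) * a / Real.cos (Real.arctan t₁),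
    Real.cos (Real.arctan t) * b / Real.cos (Real.arctan t₂), ?_, ?_, ?_⟩
  · have := h0 t; have := h0 t₁; positivity
  · have := h0 t; have := h0 t₂; positivity
  · change (_ • _ + _ • _ + _ • _ : EuclideanSpace ℝ (Fin 3)) =
      _ • (_ • _ + _ • _ + _ • _) + _ • (_ • _ + _ • _ + _ • _)
    have n1 := (h0 t₁).ne'
    have n2 := (h0 t₂).ne'
    rw [hsin t, hsin t₁, hsin t₂, hc, hs]
    match_scalars
    · field_simp
    · field_simp
    · rw [ht]; field_simp

end SteinerFrame

/-! ### From strips back to sets on the sphere -/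

namespace SteinerFrame

variable {F : SteinerFrame}

theorem cos_theta_pos {p : S2} (hp : p ∈ F.S) : 0 < Real.cos (F.theta p) :=
  cos_pos_of_abs_lt (theta_mem hp)

theorem dot_center_eq {p : S2} (hp : p ∈ F.S) :
    S2.dot p F.center = Real.cos (F.theta p) * Real.cos (F.phi p) := by
  conv_lhs => rw [← pt_phi_theta hp]
  exact dot_pt_center _ _

theorem dot_axisDir_eq {p : S2} (hp : p ∈ F.S) :
    S2.dot p F.axisDir = Real.cos (F.theta p) * Real.sin (F.phi p) := by
  conv_lhs => rw [← pt_phi_theta hp]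
  exact dot_pt_axisDir _ _

theorem dot_pole_eq {p : S2} (hp : p ∈ F.S) :
    S2.dot p F.pole = Real.cos (F.theta p) * Real.tan (F.theta p) := by
  rw [mul_comm, Real.tan_mul_cos (cos_theta_pos hp).ne', sin_theta]

theorem dot_of_vec_eq {x y z w : S2} {a b : ℝ} (h : z.vec = a • x.vec + b • y.vec) :
    S2.dot z w = a * S2.dot x w + b * S2.dot y w := by
  simp [S2.dot, h, inner_add_left, inner_smul_left]

theorem mem_S_of_mem_sphSegment {x y z : S2} (hx : x ∈ F.S) (hy : y ∈ F.S)
    (hz : z ∈ sphSegment x y) : z ∈ F.S := by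
  obtain ⟨a, b, ha, hb, h⟩ := hz
  rw [mem_S_iff] at hx hy ⊢
  rw [dot_of_vec_eq h]
  rcases ha.eq_or_lt with rfl | ha
  · rcases hb.eq_or_lt with rfl | hb
    · exfalso
      have := z.norm_vec
      simp [h] at this
    · positivity
  · positivity

/-- A set is closed under spherical segments if its strip is closed under chords. -/
theorem sphSegment_subset_of_strip {X : Set S2} (hX : X ⊆ F.S)
    (hchord : ∀ {φ₁ t₁ φ₂ t₂ φ t}, F.strip X φ₁ t₁ → F.strip X φ₂ t₂ → φ₁ < φ₂ → φ₁ ≤ φ → φ ≤ φ₂ →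
      t * Real.sin (φ₂ - φ₁) = t₁ * Real.sin (φ₂ - φ) + t₂ * Real.sin (φ - φ₁) → F.strip X φ t)
    (hvert : ∀ {φ t₁ t₂ t}, F.strip X φ t₁ → F.strip X φ t₂ → t₁ ≤ t → t ≤ t₂ → F.strip X φ t)
    {x y : S2} (hx : x ∈ X) (hy : y ∈ X) : sphSegment x y ⊆ X := by
  intro z hz
  wlog hle : F.phi x ≤ F.phi y generalizing x y
  · refine this hy hx ?_ (by linarith)
    obtain ⟨a, b, ha, hb, h⟩ := hz
    exact ⟨b, a, hb, ha, by rw [h, add_comm]⟩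
  have hxS := hX hx
  have hyS := hX hy
  have hzS := mem_S_of_mem_sphSegment hxS hyS hz
  obtain ⟨a, b, ha, hb, h⟩ := hz
  have c1 := cos_theta_pos hxS
  have c2 := cos_theta_pos hyS
  have c3 := cos_theta_pos hzS
  have e1 := dot_of_vec_eq (w := F.center) h
  have e2 := dot_of_vec_eq (w := F.axisDir) h
  have e3 := dot_of_vec_eq (w := F.pole) h
  rw [dot_center_eq hzS, dot_center_eq hxS, dot_center_eq hyS] at e1
  rw [dot_axisDir_eq hzS, dot_axisDir_eq hxS, dot_axisDir_eq hyS] at e2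
  rw [dot_pole_eq hzS, dot_pole_eq hxS, dot_pole_eq hyS] at e3
  rw [← strip_phi_tan hxS] at hx
  rw [← strip_phi_tan hyS] at hy
  rw [← strip_phi_tan hzS]
  have l1 := abs_lt.1 (phi_mem (F := F) x)
  have l2 := abs_lt.1 (phi_mem (F := F) y)
  have l3 := abs_lt.1 (phi_mem (F := F) z)
  generalize F.phi x = φ₁ at *
  generalize F.phi y = φ₂ at *
  generalize F.phi z = φ at *
  generalize Real.tan (F.theta x) = t₁ at *
  generalize Real.tan (F.theta y) = t₂ at *
  generalize Real.tan (F.theta z) = t at *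
  -- The rescaled coefficients relate the triples `(cos φ, sin φ, t)` instead of the unit vectors;
  -- eliminating one coefficient at a time gives `g1` and `g2`.
  obtain ⟨a', ha'⟩ : ∃ a', a' = a * Real.cos (F.theta x) / Real.cos (F.theta z) := ⟨_, rfl⟩
  obtain ⟨b', hb'⟩ : ∃ b', b' = b * Real.cos (F.theta y) / Real.cos (F.theta z) := ⟨_, rfl⟩
  have ha0 : 0 ≤ a' := by rw [ha']; positivity
  have hb0 : 0 ≤ b' := by rw [hb']; positivity
  have f1 : Real.cos φ = a' * Real.cos φ₁ + b' * Real.cos φ₂ := by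
    rw [ha', hb']; field_simp; linarith
  have f2 : Real.sin φ = a' * Real.sin φ₁ + b' * Real.sin φ₂ := by
    rw [ha', hb']; field_simp; linarith
  have f3 : t = a' * t₁ + b' * t₂ := by
    rw [ha', hb']; field_simp; linarith
  have g1 : Real.sin (φ₂ - φ) = a' * Real.sin (φ₂ - φ₁) := by
    rw [Real.sin_sub, Real.sin_sub, f1, f2]; ring
  have g2 : Real.sin (φ - φ₁) = b' * Real.sin (φ₂ - φ₁) := by
    rw [Real.sin_sub, Real.sin_sub, f1, f2]; ring
  rcases hle.eq_or_lt with rfl | hlt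
  · have hφ : φ = φ₁ := by
      rw [sub_self, Real.sin_zero, mul_zero] at g2
      have := (Real.sin_eq_zero_iff_of_lt_of_lt (by linarith) (by linarith)).1 g2
      linarith
    subst hφ
    have hcos : 0 < Real.cos φ := Real.cos_pos_of_mem_Ioo l1
    have hab : a' + b' = 1 := by
      rw [← add_mul] at f1
      exact mul_right_cancel₀ hcos.ne' (by linarith)
    obtain rfl : a' = 1 - b' := by linarith
    rcases le_total t₁ t₂ with h12 | h12
    · have k1 := mul_nonneg hb0 (sub_nonneg.2 h12)
      have k2 := mul_nonneg ha0 (sub_nonneg.2 h12)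
      refine hvert hx hy ?_ ?_ <;> linarith
    · have k1 := mul_nonneg hb0 (sub_nonneg.2 h12)
      have k2 := mul_nonneg ha0 (sub_nonneg.2 h12)
      refine hvert hy hx ?_ ?_ <;> linarith
  · have hs : 0 < Real.sin (φ₂ - φ₁) := Real.sin_pos_of_pos_of_lt_pi (by linarith) (by linarith)
    refine hchord hx hy hlt ?_ ?_ ?_
    · by_contra hcon
      have := Real.sin_neg_of_neg_of_neg_pi_lt (x := φ - φ₁) (by linarith) (by linarith)
      have : 0 ≤ b' * Real.sin (φ₂ - φ₁) := by positivity
      linarith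
    · by_contra hcon
      have := Real.sin_neg_of_neg_of_neg_pi_lt (x := φ₂ - φ) (by linarith) (by linarith)
      have : 0 ≤ a' * Real.sin (φ₂ - φ₁) := by positivity
      linarith
    · rw [g1, g2, f3]; ring

theorem isCompact_slice {X : Set S2} (hX : IsCompact X) (θ : ℝ) :
    IsCompact (X ∩ {p | F.theta p = θ}) :=
  hX.inter_right (isClosed_singleton.preimage continuous_theta)

theorem exists_extreme_phi {X : Set S2} (hX : IsCompact X) (hXS : X ⊆ F.S) {p : S2} (hp : p ∈ X) :
    ∃ a ∈ X, ∃ b ∈ X, F.theta a = F.theta p ∧ F.theta b = F.theta p ∧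
      ∀ q ∈ X, F.theta q = F.theta p → F.phi a ≤ F.phi q ∧ F.phi q ≤ F.phi b := by
  have hc := isCompact_slice (F := F) hX (F.theta p)
  have hcont : ContinuousOn F.phi (X ∩ {q | F.theta q = F.theta p}) :=
    continuousOn_phi.mono (inter_subset_left.trans hXS)
  obtain ⟨a, ha, ha'⟩ := hc.exists_isMinOn ⟨p, hp, rfl⟩ hcont
  obtain ⟨b, hb, hb'⟩ := hc.exists_isMaxOn ⟨p, hp, rfl⟩ hcont
  exact ⟨a, ha.1, b, hb.1, ha.2, hb.2, fun q hq h => ⟨ha' ⟨hq, h⟩, hb' ⟨hq, h⟩⟩⟩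

/-- Closure under segments gives `chord` and `vert`; compactness enters only through the extreme
points of the slices. -/
theorem convexStrip {K : Set S2} (hK : IsCompact K)
    (hseg : ∀ x ∈ K, ∀ y ∈ K, sphSegment x y ⊆ K) (hKS : K ⊆ F.S) : ConvexStrip (F.strip K) where
  lt h := h.1
  chord {φ₁ t₁ φ₂ t₂ φ t} h1 h2 hlt hφ₁ hφ₂ e := by
    have l1 := abs_lt.1 h1.1
    have l2 := abs_lt.1 h2.1
    have hs : 0 < Real.sin (φ₂ - φ₁) := Real.sin_pos_of_pos_of_lt_pi (by linarith) (by linarith)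
    refine ⟨abs_lt.2 ⟨by linarith, by linarith⟩, hseg _ h1.2 _ h2.2 ?_⟩
    refine pt_mem_sphSegment (a := Real.sin (φ₂ - φ) / Real.sin (φ₂ - φ₁))
      (b := Real.sin (φ - φ₁) / Real.sin (φ₂ - φ₁)) ?_ ?_ ?_ ?_ ?_
    · exact div_nonneg (Real.sin_nonneg_of_nonneg_of_le_pi (by linarith) (by linarith)) hs.le
    · exact div_nonneg (Real.sin_nonneg_of_nonneg_of_le_pi (by linarith) (by linarith)) hs.le
    · have := sinusoid_interp 1 0 φ₁ φ φ₂
      field_simp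
      linarith
    · have := sinusoid_interp 0 1 φ₁ φ φ₂
      field_simp
      linarith
    · field_simp
      linarith
  vert {φ t₁ t₂ t} h1 h2 ht1 ht2 := by
    rcases (ht1.trans ht2).eq_or_lt with h | h
    · rwa [show t = t₁ by linarith]
    refine ⟨h1.1, hseg _ h1.2 _ h2.2 ?_⟩
    have h0 : 0 < t₂ - t₁ := by linarith
    refine pt_mem_sphSegment (a := (t₂ - t) / (t₂ - t₁)) (b := (t - t₁) / (t₂ - t₁))
      (div_nonneg (by linarith) h0.le) (div_nonneg (by linarith) h0.le) ?_ ?_ ?_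
    · field_simp; ring
    · field_simp; ring
    · field_simp; ring
  extreme {φ t} h := by
    obtain ⟨a, ha, b, hb, hta, htb, hext⟩ := exists_extreme_phi (F := F) hK hKS h.2
    have ht : F.theta (F.pt φ (Real.arctan t)) = Real.arctan t := theta_pt (abs_arctan_lt t)
    rw [ht] at hta htb hext
    refine ⟨F.phi a, F.phi b, ⟨phi_mem a, ?_⟩, ⟨phi_mem b, ?_⟩, fun ψ hψ => ?_⟩
    · rw [← hta, pt_phi_theta (hKS ha)]; exact ha
    · rw [← htb, pt_phi_theta (hKS hb)]; exact hb
    · have := hext _ hψ.2 (theta_pt (abs_arctan_lt t))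
      rwa [phi_pt hψ.1 (abs_arctan_lt t)] at this

theorem isBounded_phi_image (X : Set S2) : Bornology.IsBounded (F.phi '' X) := by
  refine (Metric.isBounded_Icc (-(π / 2)) (π / 2)).subset ?_
  rintro _ ⟨p, -, rfl⟩
  have := abs_lt.1 (phi_mem (F := F) p)
  exact ⟨this.1.le, this.2.le⟩

theorem sub_le_angularLength {X : Set S2} (hX : X ⊆ F.S) {a b : S2} (ha : a ∈ X) (hb : b ∈ X) {θ : ℝ}
    (hta : F.theta a = θ) (htb : F.theta b = θ) : F.phi b - F.phi a ≤ F.angularLength X θ := by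
  refine (le_abs_self _).trans ?_
  rw [← Real.dist_eq]
  exact Metric.dist_le_diam_of_mem (isBounded_phi_image _)
    (mem_image_of_mem _ ⟨hb, hX hb, htb⟩) (mem_image_of_mem _ ⟨ha, hX ha, hta⟩)

/-- The symmetral in terms of pairs of points. -/
theorem mem_symmetral_iff {X : Set S2} (hX : IsCompact X) (hXS : X ⊆ F.S) {p : S2} :
    p ∈ F.symmetral X ↔ p ∈ F.S ∧ ∃ a ∈ X, ∃ b ∈ X, F.theta a = F.theta p ∧
      F.theta b = F.theta p ∧ 2 * |F.phi p| ≤ F.phi b - F.phi a := by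
  constructor
  · rintro ⟨hp, ⟨q, hq, -, hqp⟩, h⟩
    obtain ⟨a, ha, b, hb, hta, htb, hext⟩ := exists_extreme_phi (F := F) hX hXS hq
    rw [hqp] at hta htb hext
    refine ⟨hp, a, ha, b, hb, hta, htb, ?_⟩
    have : F.angularLength X (F.theta p) ≤ F.phi b - F.phi a := by
      refine Metric.diam_le_of_forall_dist_le (by linarith [hext a ha hta, (hext a ha hta).2]) ?_
      rintro _ ⟨x, hx, rfl⟩ _ ⟨y, hy, rfl⟩
      have h1 := hext x hx.1 hx.2.2
      have h2 := hext y hy.1 hy.2.2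
      rw [Real.dist_eq, abs_le]
      constructor <;> linarith
    linarith
  · rintro ⟨hp, a, ha, b, hb, hta, htb, h⟩
    refine ⟨hp, ⟨a, ha, hXS ha, hta⟩, ?_⟩
    have := sub_le_angularLength hXS ha hb hta htb
    linarith

theorem symmetral_subset_S (X : Set S2) : F.symmetral X ⊆ F.S := fun _ h => h.1

theorem symmetral_mono {X Y : Set S2} (hX : IsCompact X) (hXY : X ⊆ Y) (hY : IsCompact Y)
    (hYS : Y ⊆ F.S) : F.symmetral X ⊆ F.symmetral Y := by
  intro p hp
  rw [mem_symmetral_iff hX (hXY.trans hYS)] at hp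
  rw [mem_symmetral_iff hY hYS]
  obtain ⟨hp, a, ha, b, hb, h⟩ := hp
  exact ⟨hp, a, hXY ha, b, hXY hb, h⟩

theorem strip_symmetral {X : Set S2} (hX : IsCompact X) (hXS : X ⊆ F.S) {φ t : ℝ} :
    F.strip (F.symmetral X) φ t ↔ StripSym (F.strip X) φ t := by
  have hat := abs_arctan_lt t
  constructor
  · rintro ⟨hφ, h⟩
    rw [mem_symmetral_iff hX hXS, theta_pt hat, phi_pt hφ hat] at h
    obtain ⟨-, a, ha, b, hb, hta, htb, h⟩ := h
    refine ⟨F.phi a, F.phi b, ⟨phi_mem a, ?_⟩, ⟨phi_mem b, ?_⟩, h⟩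
    · rw [← hta, pt_phi_theta (hXS ha)]; exact ha
    · rw [← htb, pt_phi_theta (hXS hb)]; exact hb
  · rintro ⟨φ₁, φ₂, h1, h2, h⟩
    have l1 := abs_lt.1 h1.1
    have l2 := abs_lt.1 h2.1
    have hφ : |φ| < π / 2 := by linarith
    refine ⟨hφ, ?_⟩
    rw [mem_symmetral_iff hX hXS, theta_pt hat, phi_pt hφ hat]
    refine ⟨pt_mem_S hφ hat, _, h1.2, _, h2.2, theta_pt hat, theta_pt hat, ?_⟩
    rwa [phi_pt h1.1 hat, phi_pt h2.1 hat]

/-- The symmetral is a continuous image of the compact set of triples `(a, b, l)`, where `a` and `b`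
in `X` have equal latitude and `l ∈ [-1, 1]` scales half their difference of longitude. -/
theorem isCompact_symmetral {X : Set S2} (hX : IsCompact X) (hXS : X ⊆ F.S) :
    IsCompact (F.symmetral X) := by
  let f : (S2 × S2) × ℝ → S2 := fun x => F.pt (x.2 * ((F.phi x.1.2 - F.phi x.1.1) / 2)) (F.theta x.1.1)
  let C : Set ((S2 × S2) × ℝ) :=
    ((X ×ˢ X) ×ˢ Icc (-1) 1) ∩ {x | F.theta x.1.1 = F.theta x.1.2}
  have hC : IsCompact C := by
    refine ((hX.prod hX).prod isCompact_Icc).inter_right (isClosed_eq ?_ ?_)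
    · exact continuous_theta.comp (continuous_fst.comp continuous_fst)
    · exact continuous_theta.comp (continuous_snd.comp continuous_fst)
  have hf : ContinuousOn f C := by
    have h1 : ContinuousOn (fun x : (S2 × S2) × ℝ => F.phi x.1.1) C :=
      ContinuousOn.comp (g := F.phi) (t := F.S) continuousOn_phi
        (continuous_fst.comp continuous_fst).continuousOn fun x hx => hXS hx.1.1.1
    have h2 : ContinuousOn (fun x : (S2 × S2) × ℝ => F.phi x.1.2) C :=
      ContinuousOn.comp (g := F.phi) (t := F.S) continuousOn_phi
        (continuous_snd.comp continuous_fst).continuousOn fun x hx => hXS hx.1.1.2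
    have h3 : ContinuousOn (fun x : (S2 × S2) × ℝ => F.theta x.1.1) C :=
      (continuous_theta.comp (continuous_fst.comp continuous_fst)).continuousOn
    have h4 : ContinuousOn (fun x : (S2 × S2) × ℝ => x.2 * ((F.phi x.1.2 - F.phi x.1.1) / 2)) C :=
      continuousOn_snd.mul ((h2.sub h1).div_const 2)
    have h5 := h4.prodMk h3
    have h6 := ContinuousOn.comp (g := fun x : ℝ × ℝ => F.pt x.1 x.2) (t := univ)
      F.continuous_pt.continuousOn h5 (mapsTo_univ _ _)
    exact h6
  suffices h : F.symmetral X = f '' C by rw [h]; exact hC.image_of_continuousOn hf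
  ext p
  rw [mem_symmetral_iff hX hXS]
  constructor
  · rintro ⟨hp, a, ha, b, hb, hta, htb, h⟩
    have hnn : 0 ≤ F.phi b - F.phi a := by linarith [abs_nonneg (F.phi p)]
    -- If `a` and `b` have equal longitude, the quotient takes the value `0`, which is right because
    -- then `φ p = 0`.
    refine ⟨((a, b), 2 * F.phi p / (F.phi b - F.phi a)), ⟨⟨⟨ha, hb⟩, ?_⟩, hta.trans htb.symm⟩, ?_⟩
    · have : |2 * F.phi p / (F.phi b - F.phi a)| ≤ 1 := by
        rw [abs_div, abs_mul, abs_two, abs_of_nonneg hnn]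
        exact div_le_one_of_le₀ h hnn
      exact abs_le.1 this
    · change F.pt (2 * F.phi p / (F.phi b - F.phi a) * ((F.phi b - F.phi a) / 2)) (F.theta a) = p
      rcases hnn.eq_or_lt with h0 | h0
      · have : F.phi p = 0 := abs_eq_zero.1 (by linarith [abs_nonneg (F.phi p)])
        conv_rhs => rw [← pt_phi_theta hp, this]
        rw [hta, this]; simp
      · conv_rhs => rw [← pt_phi_theta hp]
        rw [hta]; congr 1; field_simp
  · rintro ⟨⟨⟨a, b⟩, l⟩, ⟨⟨⟨ha, hb⟩, hl⟩, hab⟩, rfl⟩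
    replace hab : F.theta a = F.theta b := hab
    change F.pt (l * ((F.phi b - F.phi a) / 2)) (F.theta a) ∈ F.S ∧ _
    have l1 := abs_lt.1 (phi_mem (F := F) a)
    have l2 := abs_lt.1 (phi_mem (F := F) b)
    have hle : |l * ((F.phi b - F.phi a) / 2)| ≤ |F.phi b - F.phi a| / 2 := by
      rw [abs_mul, abs_div, abs_two]
      have := abs_le.2 hl
      exact mul_le_of_le_one_left (by positivity) this
    have hlt : |l * ((F.phi b - F.phi a) / 2)| < π / 2 := by
      have : |F.phi b - F.phi a| < π := abs_lt.2 ⟨by linarith, by linarith⟩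
      linarith
    have ht := theta_mem (hXS ha)
    refine ⟨pt_mem_S hlt ht, ?_⟩
    change ∃ a' ∈ X, ∃ b' ∈ X, F.theta a' = F.theta (F.pt (l * ((F.phi b - F.phi a) / 2)) (F.theta a)) ∧
      F.theta b' = F.theta (F.pt (l * ((F.phi b - F.phi a) / 2)) (F.theta a)) ∧
      2 * |F.phi (F.pt (l * ((F.phi b - F.phi a) / 2)) (F.theta a))| ≤ F.phi b' - F.phi a'
    rw [theta_pt ht, phi_pt hlt ht]
    rcases le_total (F.phi a) (F.phi b) with h | h
    · exact ⟨a, ha, b, hb, rfl, hab.symm, by rw [abs_of_nonneg (sub_nonneg.2 h)] at hle; linarith⟩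
    · exact ⟨b, hb, a, ha, hab.symm, rfl, by rw [abs_of_nonpos (sub_nonpos.2 h)] at hle; linarith⟩

/-- A coordinate rectangle in the symmetral of a set with interior points. -/
theorem exists_rectangle {X : Set S2} (hX : IsCompact X) (hXS : X ⊆ F.S)
    (hi : (interior X).Nonempty) : ∃ θ₀ ε, |θ₀| < π / 2 ∧ 0 < ε ∧
      ∀ p ∈ F.S, |F.phi p| < ε → |F.theta p - θ₀| < ε → p ∈ F.symmetral X := by
  obtain ⟨q, hq⟩ := hi
  have hqS := hXS (interior_subset hq)
  have hcont := F.continuous_pt.continuousAt (x := (F.phi q, F.theta q))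
  have hnhds : interior X ∈ 𝓝 (F.pt (F.phi q) (F.theta q)) := by
    rw [pt_phi_theta hqS]; exact isOpen_interior.mem_nhds hq
  obtain ⟨ε, hε, hball⟩ := Metric.mem_nhds_iff.1 (hcont.preimage_mem_nhds hnhds)
  -- The first bound keeps the shifted points in `X`, the second keeps their longitudes in `(-π/2,
  -- π/2)`.
  refine ⟨F.theta q, min (ε / 2) (π / 2 - |F.phi q|), theta_mem hqS, ?_, ?_⟩
  · exact lt_min (by linarith) (by linarith [phi_mem (F := F) q])
  intro p hp hφ hθ
  have h1 := hφ.trans_le (min_le_left _ _)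
  have h2 := hφ.trans_le (min_le_right _ _)
  have h3 := hθ.trans_le (min_le_left _ _)
  have hmem : ∀ x, |x| = |F.phi p| → F.pt (F.phi q + x) (F.theta p) ∈ X := by
    intro x hx
    refine interior_subset (hball (a := (F.phi q + x, F.theta p)) ?_)
    rw [Metric.mem_ball, Prod.dist_eq, max_lt_iff, Real.dist_eq, Real.dist_eq, add_sub_cancel_left, hx]
    constructor <;> linarith
  have hlt : ∀ x, |x| = |F.phi p| → |F.phi q + x| < π / 2 := by
    intro x hx
    have := abs_add_le (F.phi q) x
    linarith
  have ht := theta_mem hp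
  rw [mem_symmetral_iff hX hXS]
  refine ⟨hp, _, hmem (-|F.phi p|) (by simp), _, hmem |F.phi p| (by simp), theta_pt ht, theta_pt ht, ?_⟩
  rw [phi_pt (hlt _ (by simp)) ht, phi_pt (hlt _ (by simp)) ht]
  linarith

theorem isOpen_rectangle (θ₀ ε : ℝ) :
    IsOpen {p | p ∈ F.S ∧ |F.phi p| < ε ∧ |F.theta p - θ₀| < ε} := by
  have h1 : IsOpen (F.S ∩ (fun p => |F.phi p|) ⁻¹' Iio ε) :=
    (continuousOn_phi.abs).isOpen_inter_preimage isOpen_S isOpen_Iio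
  have h2 : IsOpen {p | |F.theta p - θ₀| < ε} :=
    isOpen_lt ((continuous_theta.sub continuous_const).abs) continuous_const
  convert h1.inter h2 using 1
  ext p
  simp only [mem_ofPred_eq, mem_inter_iff, mem_preimage, mem_Iio, and_assoc]

theorem interior_symmetral_nonempty {X : Set S2} (hX : IsCompact X) (hXS : X ⊆ F.S)
    (hi : (interior X).Nonempty) : (interior (F.symmetral X)).Nonempty := by
  obtain ⟨θ₀, ε, hθ₀, hε, h⟩ := exists_rectangle (F := F) hX hXS hi
  have h0 : |(0 : ℝ)| < π / 2 := by simp [Real.pi_pos]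
  refine ⟨F.pt 0 θ₀, mem_interior.2 ⟨_, fun p hp => h p hp.1 hp.2.1 hp.2.2,
    isOpen_rectangle θ₀ ε, pt_mem_S h0 hθ₀, ?_, ?_⟩⟩
  · rwa [phi_pt h0 hθ₀, abs_zero]
  · rwa [theta_pt hθ₀, sub_self, abs_zero]

/-! ### Admissible symmetrizations -/

/-- A convex disk to which the symmetrization can be applied. -/
structure Good (F : SteinerFrame) (K : Set S2) : Prop where
  isConvexDisk : IsConvexDisk K
  subset_S : K ⊆ F.S
  conn : StripConn (F.strip K)
  mono : StripMono (F.strip K)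

theorem Good.convexStrip {K : Set S2} (h : F.Good K) : ConvexStrip (F.strip K) :=
  SteinerFrame.convexStrip h.isConvexDisk.isCompact h.isConvexDisk.sphConvex.2 h.subset_S

/-- Convexity is `StripSym.chord` and `StripSym.vert` carried back to the sphere. -/
theorem Good.isConvexDisk_symmetral {K : Set S2} (h : F.Good K) : IsConvexDisk (F.symmetral K) where
  isCompact := isCompact_symmetral h.isConvexDisk.isCompact h.subset_S
  sphConvex := by
    refine ⟨⟨F.center, symmetral_subset_S K⟩, fun x hx y hy => ?_⟩
    have hs := fun {φ t} => strip_symmetral (φ := φ) (t := t) h.isConvexDisk.isCompact h.subset_S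
    refine sphSegment_subset_of_strip (F := F) (symmetral_subset_S K) ?_ ?_ hx hy
    · intro φ₁ t₁ φ₂ t₂ φ t
      simp only [hs]
      exact StripSym.chord h.convexStrip h.mono
    · intro φ t₁ t₂ t
      simp only [hs]
      exact StripSym.vert h.mono
  nonempty_interior :=
    interior_symmetral_nonempty h.isConvexDisk.isCompact h.subset_S h.isConvexDisk.nonempty_interior

theorem Good.angularLength_le {K : Set S2} (h : F.Good K) {θ θ' : ℝ} (hθ : |θ| < π / 2)
    (hθ' : |θ'| < π / 2) (hm : 0 ≤ θ ∧ θ ≤ θ' ∨ θ' ≤ θ ∧ θ ≤ 0) :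
    F.angularLength K θ' ≤ F.angularLength K θ := by
  have l := abs_lt.1 hθ
  have l' := abs_lt.1 hθ'
  refine Metric.diam_le_of_forall_dist_le Metric.diam_nonneg ?_
  have key : ∀ x ∈ K ∩ F.distanceCurve θ', ∀ y ∈ K ∩ F.distanceCurve θ',
      F.phi y - F.phi x ≤ F.angularLength K θ := by
    intro x hx y hy
    rcases le_total (F.phi y - F.phi x) 0 with h0 | h0
    · exact h0.trans Metric.diam_nonneg
    have hx' := (strip_phi_tan hx.2.1).2 hx.1
    have hy' := (strip_phi_tan hy.2.1).2 hy.1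
    rw [hx.2.2] at hx'
    rw [hy.2.2] at hy'
    have hsym : StripSym (F.strip K) ((F.phi y - F.phi x) / 2) (Real.tan θ') :=
      ⟨_, _, hx', hy', by rw [abs_of_nonneg (by linarith)]; linarith⟩
    have hmem : ∀ z, |z| < π / 2 → z ∈ Ioo (-(π / 2)) (π / 2) := fun z hz => abs_lt.1 hz
    have htan := Real.strictMonoOn_tan.monotoneOn
    have h00 : (0 : ℝ) ∈ Ioo (-(π / 2)) (π / 2) := by
      constructor <;> linarith [Real.pi_pos]
    obtain ⟨a, b, ha, hb, hab⟩ := h.mono (t := Real.tan θ) hsym (by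
      rcases hm with hm | hm
      · left
        have h1 := htan h00 (hmem _ hθ) hm.1
        rw [Real.tan_zero] at h1
        exact ⟨h1, htan (hmem _ hθ) (hmem _ hθ') hm.2⟩
      · right
        have h1 := htan (hmem _ hθ) h00 hm.2
        rw [Real.tan_zero] at h1
        exact ⟨htan (hmem _ hθ') (hmem _ hθ) hm.1, h1⟩)
    have e : Real.arctan (Real.tan θ) = θ := Real.arctan_tan l.1 l.2
    rw [strip, e] at ha hb
    have := sub_le_angularLength h.subset_S ha.2 hb.2 (theta_pt hθ) (theta_pt hθ)
    rw [phi_pt ha.1 hθ, phi_pt hb.1 hθ] at this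
    rw [abs_of_nonneg (by linarith)] at hab
    linarith
  rintro _ ⟨x, hx, rfl⟩ _ ⟨y, hy, rfl⟩
  rw [Real.dist_eq, abs_sub_le_iff]
  exact ⟨key y hy x hx, key x hx y hy⟩

theorem Good.angularMonotonicity {K : Set S2} (h : F.Good K) : F.AngularMonotonicity K where
  isConvexDisk := h.isConvexDisk
  subset_S := h.subset_S
  connectednessProperty := by
    intro θ
    rcases (K ∩ F.distanceCurve θ).eq_empty_or_nonempty with he | ⟨p, hp, hpS, hpθ⟩
    · rw [he]; exact isPreconnected_empty
    have hθ : |θ| < π / 2 := hpθ ▸ theta_mem hpS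
    have l := abs_lt.1 hθ
    have e : Real.arctan (Real.tan θ) = θ := Real.arctan_tan l.1 l.2
    have hoc : ({φ | F.strip K φ (Real.tan θ)}).OrdConnected :=
      ⟨fun a ha b hb c hc => h.conn ha hb hc.1 hc.2⟩
    have hpre := hoc.isPreconnected.image (fun φ => F.pt φ θ)
      (F.continuous_pt.comp (continuous_id.prodMk continuous_const)).continuousOn
    convert hpre using 1
    ext q
    constructor
    · rintro ⟨hq, hqS, hqθ⟩
      refine ⟨F.phi q, ?_, ?_⟩
      · have := (strip_phi_tan hqS).2 hq
        rwa [hqθ] at this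
      · change F.pt (F.phi q) θ = q
        rw [← hqθ, pt_phi_theta hqS]
    · rintro ⟨φ, hφ, rfl⟩
      have h1 := hφ.2
      rw [e] at h1
      exact ⟨h1, h.subset_S h1, theta_pt hθ⟩
  antitoneOn := by
    intro θ hθ θ' hθ' hle
    exact h.angularLength_le (abs_lt.2 ⟨by linarith [hθ.1, Real.pi_pos], hθ.2⟩)
      (abs_lt.2 ⟨by linarith [hθ'.1, Real.pi_pos], hθ'.2⟩) (Or.inl ⟨hθ.1, hle⟩)
  monotoneOn := by
    intro θ hθ θ' hθ' hle
    exact h.angularLength_le (abs_lt.2 ⟨hθ'.1, by linarith [hθ'.2, Real.pi_pos]⟩)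
      (abs_lt.2 ⟨hθ.1, by linarith [hθ.2, Real.pi_pos]⟩) (Or.inr ⟨hle, hθ'.2⟩)

end SteinerFrame

/-! ### Invariance of the area -/

namespace SteinerFrame

variable (F : SteinerFrame)

theorem exists_pt_eq (p : S2) : ∃ ψ ∈ Ioc (-π) π, F.pt ψ (F.theta p) = p := by
  obtain ⟨z, hz⟩ : ∃ z : ℂ, z = ⟨S2.dot p F.center, S2.dot p F.axisDir⟩ := ⟨_, rfl⟩
  have hcos : Real.cos (F.theta p) = ‖z‖ := by
    rw [theta, Real.cos_arcsin, Complex.norm_eq_sqrt_sq_add_sq, hz]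
    congr 1
    linarith [F.sq_add_sq_add_sq p]
  refine ⟨z.arg, Complex.arg_mem_Ioc z, F.ext_dot ?_ ?_ ?_⟩
  · rw [dot_pt_center, hcos, Complex.norm_mul_cos_arg, hz]
  · rw [dot_pt_axisDir, hcos, Complex.norm_mul_sin_arg, hz]
  · rw [dot_pt_pole, sin_theta]

theorem dist_le_abs_of_cos_le {x y : S2} {a : ℝ} (h : Real.cos a ≤ S2.dot x y) :
    dist x y ≤ |a| := by
  rcases le_total |a| π with h1 | h1
  · rwa [S2.dist_le_iff (abs_nonneg a) h1, Real.cos_abs]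
  · exact (S2.dist_le_pi x y).trans h1

theorem dot_pt_pt (φ θ φ' θ' : ℝ) : S2.dot (F.pt φ θ) (F.pt φ' θ') =
    Real.cos θ * Real.cos θ' * Real.cos (φ - φ') + Real.sin θ * Real.sin θ' := by
  rw [F.dot_eq, dot_pt_center, dot_pt_center, dot_pt_axisDir, dot_pt_axisDir, dot_pt_pole,
    dot_pt_pole, Real.cos_sub]
  ring

theorem dist_pt_le (φ θ φ' θ' : ℝ) : dist (F.pt φ θ) (F.pt φ' θ') ≤ |φ - φ'| + |θ - θ'| := by
  refine (dist_triangle _ (F.pt φ' θ) _).trans (add_le_add ?_ ?_)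
  · apply dist_le_abs_of_cos_le
    rw [dot_pt_pt]
    nlinarith [Real.cos_le_one (φ - φ'), Real.sin_sq_add_cos_sq θ, sq_nonneg (Real.sin θ)]
  · apply dist_le_abs_of_cos_le
    rw [dot_pt_pt, sub_self, Real.cos_zero, Real.cos_sub]
    linarith

theorem lipschitzWith_pt : LipschitzWith 2 fun x : ℝ × ℝ => F.pt x.1 x.2 := by
  refine LipschitzWith.of_dist_le_mul fun x y => (F.dist_pt_le _ _ _ _).trans ?_
  rw [Prod.dist_eq, Real.dist_eq, Real.dist_eq]
  have h1 := le_max_left |x.1 - y.1| |x.2 - y.2|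
  have h2 := le_max_right |x.1 - y.1| |x.2 - y.2|
  push_cast
  linarith

/-- The coordinates map a compact rectangle onto the sphere by a Lipschitz map. Finiteness is what
makes Tonelli's theorem and continuity from above available. -/
theorem sphArea_univ_lt_top (F : SteinerFrame) : sphArea univ < ∞ := by
  have h : (univ : Set S2) ⊆ (fun x : ℝ × ℝ => F.pt x.1 x.2) ''
      (Icc (-π) π ×ˢ Icc (-(π / 2)) (π / 2)) := by
    intro p _
    obtain ⟨ψ, hψ, h⟩ := F.exists_pt_eq p
    exact ⟨(ψ, F.theta p), ⟨⟨hψ.1.le, hψ.2⟩, Real.neg_pi_div_two_le_arcsin _,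
      Real.arcsin_le_pi_div_two _⟩, h⟩
  refine (measure_mono h).trans_lt ((F.lipschitzWith_pt.hausdorffMeasure_image_le zero_le_two _).trans_lt ?_)
  rw [MeasureTheory.hausdorffMeasure_prod_real]
  refine ENNReal.mul_lt_top (by simp) ?_
  exact (isCompact_Icc.prod isCompact_Icc).measure_lt_top

theorem isFiniteMeasure_hausdorffMeasure (F : SteinerFrame) : IsFiniteMeasure (μH[2] : Measure S2) :=
  ⟨F.sphArea_univ_lt_top⟩

/-- A latitude circle is a Lipschitz image of a line, so its dimension is at most one. -/
theorem sphArea_latitude (z : ℝ) : sphArea {p | S2.dot p F.pole = z} = 0 := by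
  have hL : LipschitzWith 1 fun ψ : ℝ => F.pt ψ (Real.arcsin z) := by
    refine LipschitzWith.of_dist_le_mul fun x y => (F.dist_pt_le _ _ _ _).trans ?_
    simp [Real.dist_eq]
  have hsub : {p | S2.dot p F.pole = z} ⊆ range fun ψ : ℝ => F.pt ψ (Real.arcsin z) := by
    rintro p rfl
    obtain ⟨ψ, -, h⟩ := F.exists_pt_eq p
    exact ⟨ψ, h⟩
  have hd : dimH {p | S2.dot p F.pole = z} < ((2 : NNReal) : ℝ≥0∞) := by
    refine ((dimH_mono hsub).trans hL.dimH_range_le).trans_lt ?_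
    rw [Real.dimH_univ]
    norm_num
  have h := hausdorffMeasure_of_dimH_lt hd
  rwa [NNReal.coe_ofNat] at h

/-- The rotation about the pole. -/
noncomputable def rotFun (τ : ℝ) (p : S2) : S2 :=
  F.ofCoord (S2.dot p F.center * Real.cos τ - S2.dot p F.axisDir * Real.sin τ)
    (S2.dot p F.center * Real.sin τ + S2.dot p F.axisDir * Real.cos τ) (S2.dot p F.pole) (by
      have h1 := F.sq_add_sq_add_sq p
      have h2 := Real.sin_sq_add_cos_sq τ
      linear_combination h1 + (S2.dot p F.center ^ 2 + S2.dot p F.axisDir ^ 2) * h2)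

theorem rotFun_pt (τ ψ θ : ℝ) : F.rotFun τ (F.pt ψ θ) = F.pt (ψ + τ) θ := by
  apply F.ext_dot <;> simp [rotFun, Real.cos_add, Real.sin_add] <;> ring

theorem rotFun_rotFun (σ τ : ℝ) (p : S2) : F.rotFun σ (F.rotFun τ p) = F.rotFun (τ + σ) p := by
  obtain ⟨ψ, -, h⟩ := F.exists_pt_eq p
  rw [← h, rotFun_pt, rotFun_pt, rotFun_pt, add_assoc]

theorem rotFun_zero (p : S2) : F.rotFun 0 p = p := by
  obtain ⟨ψ, -, h⟩ := F.exists_pt_eq p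
  rw [← h, rotFun_pt, add_zero]

theorem isometry_rotFun (τ : ℝ) : Isometry (F.rotFun τ) := by
  refine Isometry.of_dist_eq fun p q => ?_
  obtain ⟨ψ, -, h⟩ := F.exists_pt_eq p
  obtain ⟨ψ', -, h'⟩ := F.exists_pt_eq q
  rw [← h, ← h', rotFun_pt, rotFun_pt, S2.dist_eq, S2.dist_eq, dot_pt_pt, dot_pt_pt,
    add_sub_add_right_eq_sub]

/-- The rotation about the pole, as an isometry. -/
noncomputable def rot (τ : ℝ) : S2 ≃ᵢ S2 where
  toFun := F.rotFun τ
  invFun := F.rotFun (-τ)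
  left_inv p := by rw [rotFun_rotFun, add_neg_cancel, rotFun_zero]
  right_inv p := by rw [rotFun_rotFun, neg_add_cancel, rotFun_zero]
  isometry_toFun := F.isometry_rotFun τ

theorem continuous_rotFun : Continuous fun x : ℝ × S2 => F.rotFun x.1 x.2 := by
  apply S2.continuous_of_continuous_vec
  have h1 : Continuous fun x : ℝ × S2 => S2.dot x.2 F.center :=
    (S2.continuous_dot_left _).comp continuous_snd
  have h2 : Continuous fun x : ℝ × S2 => S2.dot x.2 F.axisDir :=
    (S2.continuous_dot_left _).comp continuous_snd
  have h3 : Continuous fun x : ℝ × S2 => S2.dot x.2 F.pole :=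
    (S2.continuous_dot_left _).comp continuous_snd
  change Continuous fun x : ℝ × S2 =>
    (S2.dot x.2 F.center * Real.cos x.1 - S2.dot x.2 F.axisDir * Real.sin x.1) • F.center.vec +
    (S2.dot x.2 F.center * Real.sin x.1 + S2.dot x.2 F.axisDir * Real.cos x.1) • F.axisDir.vec +
    S2.dot x.2 F.pole • F.pole.vec
  fun_prop

/-- The area of a closed set is determined by the lengths of its latitude slices. -/
theorem sphArea_mul_two_pi {A : Set S2} (hA : IsClosed A) :
    sphArea A * ENNReal.ofReal (2 * π) =
      ∫⁻ p, volume ({τ | F.rotFun τ p ∈ A} ∩ Ioc (-π) π) ∂(μH[2] : Measure S2) := by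
  have := F.isFiniteMeasure_hausdorffMeasure
  have hB : MeasurableSet {x : ℝ × S2 | F.rotFun x.1 x.2 ∈ A} :=
    (hA.preimage F.continuous_rotFun).measurableSet
  -- Rotations preserve the Hausdorff measure, so this integral does not depend on `τ`; Tonelli's
  -- theorem then exchanges the integrals over `τ` and `p`.
  have h1 : ∀ τ, ∫⁻ p, A.indicator 1 (F.rotFun τ p) ∂(μH[2] : Measure S2) = sphArea A := by
    intro τ
    have : (fun p => A.indicator (1 : S2 → ℝ≥0∞) (F.rotFun τ p)) =
        (F.rot τ ⁻¹' A).indicator 1 := by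
      ext p; rfl
    rw [this, lintegral_indicator_one (hA.preimage (F.rot τ).continuous).measurableSet]
    exact ((F.rot τ).measurePreserving_hausdorffMeasure 2).measure_preimage
      hA.measurableSet.nullMeasurableSet
  have h2 := lintegral_lintegral_swap (μ := (volume : Measure ℝ).restrict (Ioc (-π) π))
    (ν := (μH[2] : Measure S2)) (f := fun τ p => A.indicator 1 (F.rotFun τ p))
    (by
      refine Measurable.aemeasurable ?_
      change Measurable ({x : ℝ × S2 | F.rotFun x.1 x.2 ∈ A}.indicator (1 : ℝ × S2 → ℝ≥0∞))
      exact measurable_one.indicator hB)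
  simp only [h1] at h2
  rw [setLIntegral_const, Real.volume_Ioc, show π - -π = 2 * π by ring] at h2
  rw [h2]
  congr 1
  ext p
  have hm : MeasurableSet {τ | F.rotFun τ p ∈ A} :=
    (hA.preimage (F.continuous_rotFun.comp (continuous_id.prodMk continuous_const))).measurableSet
  change ∫⁻ τ in Ioc (-π) π, {τ | F.rotFun τ p ∈ A}.indicator 1 τ = _
  rw [lintegral_indicator_one hm, Measure.restrict_apply hm]

/-- Starting the rotation at `p` only shifts the longitude, and a `2π`-periodic set has the same
measure in every interval of length `2π`. So the integrand above depends on `p` only through its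
latitude. -/
theorem volume_rot_slice {A : Set S2} (hA : IsClosed A) (p : S2) :
    volume ({τ | F.rotFun τ p ∈ A} ∩ Ioc (-π) π) =
      volume ({ψ | F.pt ψ (F.theta p) ∈ A} ∩ Ioc (-π) π) := by
  obtain ⟨ψ, -, h⟩ := F.exists_pt_eq p
  generalize F.theta p = θ at *
  subst h
  simp only [rotFun_pt]
  have hm : MeasurableSet {ψ | F.pt ψ θ ∈ A} :=
    (hA.preimage (F.continuous_pt.comp (continuous_id.prodMk continuous_const))).measurableSet
  have e1 : {τ | F.pt (ψ + τ) θ ∈ A} ∩ Ioc (-π) π =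
      (fun τ => ψ + τ) ⁻¹' ({ψ | F.pt ψ θ ∈ A} ∩ Ioc (ψ - π) (ψ - π + 2 * π)) := by
    ext τ
    simp only [mem_inter_iff, mem_ofPred_eq, mem_Ioc, mem_preimage]
    refine and_congr_right fun _ => ⟨fun h => ⟨by linarith, by linarith⟩, fun h => ⟨by linarith, by linarith⟩⟩
  rw [e1, measure_preimage_add]
  have hT : (0 : ℝ) < 2 * π := by positivity
  have e2 := (isAddFundamentalDomain_Ioc hT (ψ - π)).measure_set_eq
    (isAddFundamentalDomain_Ioc hT (-π)) (A := {ψ | F.pt ψ θ ∈ A}) hm (by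
      rintro ⟨g, hg⟩
      obtain ⟨n, rfl⟩ := AddSubgroup.mem_zmultiples_iff.1 hg
      ext x
      have : F.pt (n • (2 * π) + x) θ = F.pt x θ := by
        have e : n • (2 * π) + x = x + n * (2 * π) := by rw [zsmul_eq_mul]; ring
        rw [e]
        apply F.ext_dot <;> simp [Real.cos_add_int_mul_two_pi, Real.sin_add_int_mul_two_pi]
      change F.pt (n • (2 * π) + x) θ ∈ A ↔ F.pt x θ ∈ A
      rw [this])
  rw [e2]
  congr 3
  ring

theorem slice_eq_strip {A : Set S2} (hA : A ⊆ F.S) {θ : ℝ} (hθ : |θ| < π / 2) :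
    {ψ | F.pt ψ θ ∈ A} ∩ Ioc (-π) π = {ψ | F.strip A ψ (Real.tan θ)} := by
  have l := abs_lt.1 hθ
  ext ψ
  simp only [mem_inter_iff, mem_ofPred_eq, strip, Real.arctan_tan l.1 l.2]
  constructor
  · rintro ⟨h, h1, h2⟩
    refine ⟨?_, h⟩
    have h3 := mem_S_iff.1 (hA h)
    rw [dot_pt_center] at h3
    have h4 : 0 < Real.cos ψ := (mul_pos_iff_of_pos_left (cos_pos_of_abs_lt hθ)).1 h3
    by_contra hcon
    have : Real.cos ψ ≤ 0 := by
      rw [← Real.cos_abs]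
      exact Real.cos_nonpos_of_pi_div_two_le_of_le (not_lt.1 hcon)
        (by linarith [abs_le.2 ⟨h1.le, h2⟩, Real.pi_pos])
    linarith
  · rintro ⟨h, h1⟩
    have := abs_lt.1 h
    exact ⟨h1, by linarith [Real.pi_pos], by linarith [Real.pi_pos]⟩

variable {F} in
/-- Steiner symmetrization preserves the area. -/
theorem Good.sphArea_symmetral {K : Set S2} (h : F.Good K) :
    sphArea (F.symmetral K) = sphArea K := by
  have hK := h.isConvexDisk.isCompact
  have hσ := isCompact_symmetral hK h.subset_S
  have h0 : ENNReal.ofReal (2 * π) ≠ 0 := by simp [Real.pi_pos]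
  refine (ENNReal.mul_left_inj h0 ENNReal.ofReal_ne_top).1 ?_
  rw [F.sphArea_mul_two_pi hσ.isClosed, F.sphArea_mul_two_pi hK.isClosed]
  congr 1
  ext p
  rw [F.volume_rot_slice hσ.isClosed, F.volume_rot_slice hK.isClosed]
  by_cases hθ : |F.theta p| < π / 2
  · rw [F.slice_eq_strip (symmetral_subset_S K) hθ, F.slice_eq_strip h.subset_S hθ]
    generalize Real.tan (F.theta p) = t
    simp only [strip_symmetral hK h.subset_S]
    by_cases hne : ∃ φ, F.strip K φ t
    · obtain ⟨φ, hφ⟩ := hne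
      obtain ⟨α, β, hα, hβ, hext⟩ := h.convexStrip.extreme hφ
      have e1 : {ψ | F.strip K ψ t} = Icc α β := by
        ext ψ
        exact ⟨fun hψ => hext ψ hψ, fun hψ => h.conn hα hβ hψ.1 hψ.2⟩
      have e2 : {ψ | StripSym (F.strip K) ψ t} = Icc (-((β - α) / 2)) ((β - α) / 2) := by
        ext ψ
        rw [mem_ofPred_eq, mem_Icc, ← abs_le]
        constructor
        · rintro ⟨a, b, ha, hb, hab⟩
          linarith [(hext a ha).1, (hext b hb).2]
        · intro hψ
          exact ⟨α, β, hα, hβ, by linarith⟩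
      rw [e1, e2, Real.volume_Icc, Real.volume_Icc]
      congr 1
      ring
    · have e1 : {ψ | F.strip K ψ t} = ∅ := by
        ext ψ; exact ⟨fun hψ => hne ⟨ψ, hψ⟩, fun h => h.elim⟩
      have e2 : {ψ | StripSym (F.strip K) ψ t} = ∅ := by
        ext ψ; exact ⟨fun ⟨a, _, ha, _⟩ => hne ⟨a, ha⟩, fun h => h.elim⟩
      rw [e1, e2]
  -- At the poles both slices are empty, because `S` contains neither pole.
  · have key : ∀ A ⊆ F.S, {ψ | F.pt ψ (F.theta p) ∈ A} = ∅ := by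
      intro A hA
      ext ψ
      refine ⟨fun hψ => ?_, fun h => h.elim⟩
      have := mem_S_iff.1 (hA hψ)
      rw [dot_pt_center] at this
      refine absurd this (not_lt.2 (le_of_eq ?_))
      have h1 : |F.theta p| = π / 2 := le_antisymm (abs_le.2 ⟨Real.neg_pi_div_two_le_arcsin _,
        Real.arcsin_le_pi_div_two _⟩) (not_lt.1 hθ)
      rw [← Real.cos_abs (F.theta p), h1, Real.cos_pi_div_two, zero_mul]
    rw [key _ (symmetral_subset_S K), key _ h.subset_S]

end SteinerFrame

/-! ### The first two symmetrizations -/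

theorem S2.exists_dot_eq_zero (x y : S2) : ∃ n : S2, S2.dot x n = 0 ∧ S2.dot y n = 0 := by
  obtain ⟨W, hW⟩ : ∃ W : Submodule ℝ (EuclideanSpace ℝ (Fin 3)), W = Submodule.span ℝ {x.vec, y.vec} :=
    ⟨_, rfl⟩
  have h1 : Module.finrank ℝ W ≤ 2 := by
    rw [hW]
    refine (finrank_span_le_card _).trans ?_
    rw [Set.toFinset_insert, Set.toFinset_singleton]
    exact Finset.card_le_two
  have h2 := W.finrank_add_finrank_orthogonal
  rw [finrank_euclideanSpace_fin] at h2
  have h3 : Wᗮ ≠ ⊥ := by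
    intro h
    rw [h, finrank_bot] at h2
    omega
  obtain ⟨v, hv, hv0⟩ := Submodule.exists_mem_ne_zero_of_ne_bot h3
  rw [Submodule.mem_orthogonal] at hv
  refine ⟨⟨‖v‖⁻¹ • v, by rw [norm_smul, norm_inv, norm_norm, inv_mul_cancel₀ (norm_ne_zero_iff.2 hv0)]⟩, ?_, ?_⟩
  · have := hv x.vec (by rw [hW]; exact Submodule.subset_span (by simp))
    change inner ℝ x.vec (‖v‖⁻¹ • v) = 0
    rw [inner_smul_right, this, mul_zero]
  · have := hv y.vec (by rw [hW]; exact Submodule.subset_span (by simp))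
    change inner ℝ y.vec (‖v‖⁻¹ • v) = 0
    rw [inner_smul_right, this, mul_zero]

namespace SteinerFrame

theorem exists_frame {c a : S2} (h : S2.dot c a = 0) :
    ∃ F : SteinerFrame, F.center = c ∧ F.axisDir = a := by
  obtain ⟨n, hc, ha⟩ := S2.exists_dot_eq_zero c a
  exact ⟨⟨c, a, n, h, hc, ha⟩, rfl, rfl⟩

theorem exists_frame_center (c : S2) : ∃ F : SteinerFrame, F.center = c := by
  obtain ⟨a, h, -⟩ := S2.exists_dot_eq_zero c c
  obtain ⟨F, hF, -⟩ := exists_frame h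
  exact ⟨F, hF⟩

theorem exists_dist_pos {K : Set S2} (hi : (interior K).Nonempty) :
    ∃ x ∈ K, ∃ y ∈ K, 0 < dist x y := by
  obtain ⟨c, hc⟩ := hi
  obtain ⟨F, rfl⟩ := exists_frame_center c
  have h00 : |(0 : ℝ)| < π / 2 := by simp [Real.pi_pos]
  have h0 : F.pt 0 0 = F.center := by
    apply F.ext_dot
    · simp [S2.dot_self]
    · simp [F.center_axisDir]
    · simp [F.center_pole]
  have hcont : Continuous fun φ : ℝ => F.pt φ 0 := by
    have := F.continuous_pt
    fun_prop
  have hn : interior K ∈ 𝓝 (F.pt 0 0) := by rw [h0]; exact isOpen_interior.mem_nhds hc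
  obtain ⟨ε, hε, hball⟩ := Metric.mem_nhds_iff.1 (hcont.continuousAt.preimage_mem_nhds hn)
  obtain ⟨δ, hδ⟩ : ∃ δ, δ = min (ε / 2) 1 := ⟨_, rfl⟩
  have hδ0 : 0 < δ := by rw [hδ]; exact lt_min (by linarith) one_pos
  have hδε : δ < ε := by rw [hδ]; exact (min_le_left _ _).trans_lt (by linarith)
  have hδ1 : δ < π / 2 := by
    rw [hδ]; exact (min_le_right _ _).trans_lt (by linarith [Real.pi_gt_three])
  refine ⟨_, interior_subset hc, F.pt δ 0, interior_subset (hball (a := δ) ?_), dist_pos.2 fun e => ?_⟩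
  · rw [Metric.mem_ball, Real.dist_eq, sub_zero, abs_of_pos hδ0]; exact hδε
  · rw [← h0] at e
    have := congrArg F.phi e
    rw [phi_pt h00 h00, phi_pt (by rwa [abs_of_pos hδ0]) h00] at this
    linarith

/-- The frame whose axis contains a given segment, centred at the midpoint. -/
theorem exists_frame_of_dist {p q : S2} (h0 : 0 < dist p q) (h1 : dist p q < π) :
    ∃ F : SteinerFrame, F.pt (-(dist p q / 2)) 0 = p ∧ F.pt (dist p q / 2) 0 = q := by
  obtain ⟨d, hd⟩ : ∃ d, d = dist p q / 2 := ⟨_, rfl⟩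
  rw [← hd]
  have hc : 0 < Real.cos d := Real.cos_pos_of_mem_Ioo ⟨by linarith, by linarith⟩
  have hs : 0 < Real.sin d := Real.sin_pos_of_pos_of_lt_pi (by linarith) (by linarith)
  have hcs := Real.sin_sq_add_cos_sq d
  have hpq : inner ℝ p.vec q.vec = Real.cos d ^ 2 - Real.sin d ^ 2 := by
    rw [← Real.cos_two_mul', hd, show 2 * (dist p q / 2) = dist p q by ring, S2.cos_dist, S2.dot]
  have hqp : inner ℝ q.vec p.vec = Real.cos d ^ 2 - Real.sin d ^ 2 := by rw [real_inner_comm, hpq]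
  have hpp : inner ℝ p.vec p.vec = (1 : ℝ) := by simp [S2.norm_vec]
  have hqq : inner ℝ q.vec q.vec = (1 : ℝ) := by simp [S2.norm_vec]
  have hcn : ‖(1 / (2 * Real.cos d)) • (p.vec + q.vec)‖ = 1 := by
    rw [← sq_eq_sq₀ (norm_nonneg _) zero_le_one, ← real_inner_self_eq_norm_sq, inner_smul_left,
      inner_smul_right, inner_add_left, inner_add_right, inner_add_right, hpq, hqp, hpp, hqq]
    simp only [RCLike.conj_to_real]
    field_simp
    linear_combination (-2) * hcs
  have han : ‖(1 / (2 * Real.sin d)) • (q.vec - p.vec)‖ = 1 := by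
    rw [← sq_eq_sq₀ (norm_nonneg _) zero_le_one, ← real_inner_self_eq_norm_sq, inner_smul_left,
      inner_smul_right, inner_sub_left, inner_sub_right, inner_sub_right, hpq, hqp, hpp, hqq]
    simp only [RCLike.conj_to_real]
    field_simp
    linear_combination (-2) * hcs
  obtain ⟨F, hFc, hFa⟩ := exists_frame (c := ⟨_, hcn⟩) (a := ⟨_, han⟩) (by
    change inner ℝ ((1 / (2 * Real.cos d)) • (p.vec + q.vec))
      ((1 / (2 * Real.sin d)) • (q.vec - p.vec)) = 0
    rw [inner_smul_left, inner_smul_right, inner_add_left, inner_sub_right, inner_sub_right, hpq,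
      hqp, hpp, hqq]
    ring)
  have hc' : F.center.vec = (1 / (2 * Real.cos d)) • (p.vec + q.vec) := by rw [hFc]; rfl
  have ha' : F.axisDir.vec = (1 / (2 * Real.sin d)) • (q.vec - p.vec) := by rw [hFa]; rfl
  refine ⟨F, S2.vec_injective ?_, S2.vec_injective ?_⟩
  · change (Real.cos 0 * Real.cos (-d)) • F.center.vec + (Real.cos 0 * Real.sin (-d)) • F.axisDir.vec +
      Real.sin 0 • F.pole.vec = p.vec
    rw [hc', ha', Real.cos_zero, Real.sin_zero, Real.cos_neg, Real.sin_neg, zero_smul]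
    match_scalars <;> field_simp <;> ring
  · change (Real.cos 0 * Real.cos d) • F.center.vec + (Real.cos 0 * Real.sin d) • F.axisDir.vec +
      Real.sin 0 • F.pole.vec = q.vec
    rw [hc', ha', Real.cos_zero, Real.sin_zero, zero_smul]
    match_scalars <;> field_simp <;> ring

/-- A convex disk of small diameter can be symmetrized with a diametral chord as axis. -/
theorem exists_good {K : Set S2} (hK : IsConvexDisk K) (hd : Metric.diam K < π / 2) :
    ∃ F : SteinerFrame, F.Good K := by
  have hcomp := hK.isCompact
  obtain ⟨x, hx, y, hy, hxy⟩ := exists_dist_pos hK.nonempty_interior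
  obtain ⟨⟨p, q⟩, ⟨hp, hq⟩, hmax⟩ := (hcomp.prod hcomp).exists_isMaxOn ⟨(x, y), hx, hy⟩
    continuous_dist.continuousOn
  have hmax' : ∀ z ∈ K ×ˢ K, dist z.1 z.2 ≤ dist p q := fun z hz => hmax hz
  replace hmax : ∀ x ∈ K, ∀ y ∈ K, dist x y ≤ dist p q := fun x hx y hy => hmax' (x, y) ⟨hx, hy⟩
  have hpq0 : 0 < dist p q := hxy.trans_le (hmax _ hx _ hy)
  have hpq1 : dist p q < π / 2 := (Metric.dist_le_diam_of_mem hcomp.isBounded hp hq).trans_lt hd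
  obtain ⟨F, hFp, hFq⟩ := exists_frame_of_dist hpq0 (by linarith)
  obtain ⟨d, hdef⟩ : ∃ d, d = dist p q := ⟨_, rfl⟩
  rw [← hdef] at hmax hpq0 hpq1 hFp hFq
  have hcd : 0 < Real.cos d := Real.cos_pos_of_mem_Ioo ⟨by linarith, by linarith⟩
  have hcd2 : 0 < Real.cos (d / 2) := Real.cos_pos_of_mem_Ioo ⟨by linarith, by linarith⟩
  have hdp : ∀ x ∈ K, Real.cos d ≤ S2.dot x p := fun x hx =>
    (S2.dist_le_iff hpq0.le (by linarith)).1 (hmax x hx p hp)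
  have hdq : ∀ x ∈ K, Real.cos d ≤ S2.dot x q := fun x hx =>
    (S2.dist_le_iff hpq0.le (by linarith)).1 (hmax x hx q hq)
  -- Adding the two distance bounds gives `cos (d / 2) * ⟨x, c⟩ ≥ cos d > 0`.
  have hKS : K ⊆ F.S := by
    intro x hx
    have h1 := hdp x hx
    have h2 := hdq x hx
    rw [← hFp, F.dot_eq] at h1
    rw [← hFq, F.dot_eq] at h2
    simp only [dot_pt_center, dot_pt_axisDir, dot_pt_pole, Real.cos_zero, Real.sin_zero,
      Real.cos_neg, Real.sin_neg] at h1 h2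
    rw [mem_S_iff]
    refine (mul_pos_iff_of_pos_right hcd2).1 ?_
    linarith
  have hstrip := convexStrip (F := F) hcomp hK.sphConvex.2 hKS
  -- The distance from a point of longitude `φ` to the axis point of longitude `a` has cosine `cos θ
  -- cos (φ - a)`. As `cos d > 0`, a distance at most `d` forces `|φ - a| ≤ d`; applied to both ends
  -- `a = ±d/2`, this confines `φ` to the chord.
  have hbound : ∀ φ t, F.strip K φ t → |φ| ≤ d / 2 := by
    rintro φ t ⟨hφ, h⟩
    have hct := Real.cos_arctan_pos t
    have l := abs_lt.1 hφ
    have key : ∀ a, |a| ≤ d / 2 → Real.cos d ≤ Real.cos (Real.arctan t) * Real.cos (φ - a) →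
        |φ - a| ≤ d := by
      intro a ha hle
      have la := abs_le.1 ha
      by_contra hcon
      have h1 : |φ - a| ≤ π := abs_le.2 ⟨by linarith, by linarith⟩
      have h2 := Real.cos_lt_cos_of_nonneg_of_le_pi hpq0.le h1 (not_le.1 hcon)
      rw [Real.cos_abs] at h2
      have h3 := Real.cos_le_one (Real.arctan t)
      rcases le_total (Real.cos (φ - a)) 0 with h4 | h4
      · nlinarith
      · nlinarith
    have h1 := hdp _ h
    have h2 := hdq _ h
    rw [← hFp, dot_pt_pt, Real.cos_zero, Real.sin_zero, mul_zero, add_zero, mul_one] at h1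
    rw [← hFq, dot_pt_pt, Real.cos_zero, Real.sin_zero, mul_zero, add_zero, mul_one] at h2
    have k1 := abs_le.1 (key _ (by rw [abs_neg, abs_of_pos (by linarith)]) h1)
    have k2 := abs_le.1 (key _ (by rw [abs_of_pos (by linarith)]) h2)
    exact abs_le.2 ⟨by linarith, by linarith⟩
  have hd2 : d / 2 < π / 2 := by linarith
  have hproj : ∀ φ t, F.strip K φ t → F.strip K φ 0 := by
    intro φ t h
    have := abs_le.1 (hbound φ t h)
    refine hstrip.conn_zero (α := -(d / 2)) (β := d / 2) ⟨?_, ?_⟩ ⟨?_, ?_⟩ this.1 this.2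
    · rwa [abs_neg, abs_of_pos (by linarith)]
    · rwa [Real.arctan_zero, hFp]
    · rwa [abs_of_pos (by linarith)]
    · rwa [Real.arctan_zero, hFq]
  exact ⟨F, hK, hKS, hstrip.conn_of_proj hproj, hstrip.mono_of_proj hproj⟩

/-- The frame with the roles of the two great circles exchanged. -/
def swap (F : SteinerFrame) : SteinerFrame where
  center := F.center
  axisDir := F.pole
  pole := F.axisDir
  center_axisDir := F.center_pole
  center_pole := F.center_axisDir
  axisDir_pole := by rw [S2.dot_comm]; exact F.axisDir_pole

variable (F : SteinerFrame)

/-- The reflection in the great circle perpendicular to the axis at the centre. -/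
noncomputable def mirror (p : S2) : S2 :=
  F.ofCoord (S2.dot p F.center) (-S2.dot p F.axisDir) (S2.dot p F.pole) (by
    rw [neg_sq]; exact F.sq_add_sq_add_sq p)

variable {F}

theorem mirror_pt (φ θ : ℝ) : F.mirror (F.pt φ θ) = F.pt (-φ) θ := by
  apply F.ext_dot <;> simp [mirror]

theorem mirror_swap_pt (φ θ : ℝ) : F.mirror (F.swap.pt φ θ) = F.swap.pt φ (-θ) := by
  have h1 := dot_pt_center (F := F.swap)
  have h2 := dot_pt_axisDir (F := F.swap)
  have h3 := dot_pt_pole (F := F.swap)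
  simp only [swap] at h1 h2 h3
  apply F.ext_dot <;> simp [mirror, swap, h1, h2, h3]

theorem mirror_mem_symmetral {X : Set S2} (hX : IsCompact X) (hXS : X ⊆ F.S) {p : S2}
    (hp : p ∈ F.symmetral X) : F.mirror p ∈ F.symmetral X := by
  have hpS := symmetral_subset_S X hp
  have h := (strip_phi_tan hpS).2 hp
  rw [strip_symmetral hX hXS] at h
  have h' := ((strip_symmetral hX hXS).2 h.neg).2
  have l := abs_lt.1 (theta_mem hpS)
  rw [Real.arctan_tan l.1 l.2] at h'
  rwa [← pt_phi_theta hpS, mirror_pt]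

/-- The symmetral is mirror symmetric in `H`, which is the axis of the swapped frame. With each
point it contains the segment to its mirror image, hence its projection onto that axis. -/
theorem Good.swap {K : Set S2} (h : F.Good K) : F.swap.Good (F.symmetral K) := by
  have hd := h.isConvexDisk_symmetral
  have hS : F.symmetral K ⊆ F.swap.S := symmetral_subset_S (F := F) K
  have hstrip := SteinerFrame.convexStrip (F := F.swap) hd.isCompact hd.sphConvex.2 hS
  have hproj : ∀ φ t, F.swap.strip (F.symmetral K) φ t → F.swap.strip (F.symmetral K) φ 0 := by
    intro φ t hφ
    have h' : F.swap.strip (F.symmetral K) φ (-t) := by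
      refine ⟨hφ.1, ?_⟩
      rw [Real.arctan_neg, ← mirror_swap_pt]
      exact mirror_mem_symmetral h.isConvexDisk.isCompact h.subset_S hφ.2
    rcases le_total 0 t with ht | ht
    · exact hstrip.vert h' hφ (by linarith) ht
    · exact hstrip.vert hφ h' ht (by linarith)
  exact ⟨hd, hS, hstrip.conn_of_proj hproj, hstrip.mono_of_proj hproj⟩

end SteinerFrame

/-! ### Central symmetry -/

/-- The rotation by `π` about `c`. -/
noncomputable def S2.halfTurn (c p : S2) : S2 :=
  ⟨(2 * S2.dot p c) • c.vec - p.vec, by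
    rw [← sq_eq_sq₀ (norm_nonneg _) zero_le_one, norm_sub_sq_real, norm_smul, S2.norm_vec, S2.norm_vec,
      inner_smul_left, real_inner_comm, mul_one, Real.norm_eq_abs, sq_abs]
    simp only [S2.dot, RCLike.conj_to_real]
    ring⟩

theorem S2.dot_halfTurn (c p w : S2) :
    S2.dot (S2.halfTurn c p) w = 2 * S2.dot p c * S2.dot c w - S2.dot p w := by
  change inner ℝ ((2 * S2.dot p c) • c.vec - p.vec) w.vec = _
  rw [inner_sub_left, inner_smul_left]
  rfl

/-- Symmetry with respect to a point. -/
def CentSym (c : S2) (X : Set S2) : Prop := ∀ p ∈ X, S2.halfTurn c p ∈ X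

namespace SteinerFrame

variable {F : SteinerFrame}

theorem halfTurn_pt (φ θ : ℝ) : S2.halfTurn F.center (F.pt φ θ) = F.pt (-φ) (-θ) := by
  have h1 := F.center_axisDir
  have h2 := F.center_pole
  apply F.ext_dot <;> simp [S2.dot_halfTurn, S2.dot_self, h1, h2]
  ring

theorem centSym_iff {X : Set S2} (hX : X ⊆ F.S) :
    CentSym F.center X ↔ ∀ φ t, F.strip X φ t → F.strip X (-φ) (-t) := by
  constructor
  · intro h φ t hφ
    refine ⟨by rw [abs_neg]; exact hφ.1, ?_⟩
    rw [Real.arctan_neg, ← halfTurn_pt]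
    exact h _ hφ.2
  · intro h p hp
    have h' := (h _ _ ((strip_phi_tan (hX hp)).2 hp)).2
    have l := abs_lt.1 (theta_mem (hX hp))
    rw [Real.arctan_neg, Real.arctan_tan l.1 l.2, ← halfTurn_pt, pt_phi_theta (hX hp)] at h'
    exact h'

/-- This gives free choice of the direction of all later symmetrizations, as long as the centre is
kept. -/
theorem good_of_centSym {K : Set S2} (hK : IsConvexDisk K) (hKS : K ⊆ F.S)
    (hc : CentSym F.center K) : F.Good K := by
  have hstrip := convexStrip (F := F) hK.isCompact hK.sphConvex.2 hKS
  rw [centSym_iff hKS] at hc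
  exact ⟨hK, hKS, hstrip.conn_of_central hc, hstrip.mono_of_central hc⟩

/-- The half turn about the centre exchanges the slices at `t` and `-t`, which therefore have equal
lengths. -/
theorem centSym_symmetral {X : Set S2} (hX : IsCompact X) (hXS : X ⊆ F.S)
    (hc : CentSym F.center X) : CentSym F.center (F.symmetral X) := by
  rw [centSym_iff hXS] at hc
  rw [centSym_iff (symmetral_subset_S X)]
  intro φ t
  rw [strip_symmetral hX hXS, strip_symmetral hX hXS]
  rintro ⟨a, b, ha, hb, h⟩
  exact ⟨-b, -a, hc _ _ hb, hc _ _ ha, by rw [abs_neg]; linarith⟩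

/-- The second symmetrization adds a mirror symmetry and keeps the one produced by the first; the
composition of the two reflections is the half turn. -/
theorem Good.centSym_swap {K : Set S2} (h : F.Good K) :
    CentSym F.center (F.swap.symmetral (F.symmetral K)) := by
  have h2 := h.swap
  change CentSym F.swap.center _
  rw [centSym_iff (symmetral_subset_S _)]
  intro φ t
  rw [strip_symmetral h2.isConvexDisk.isCompact h2.subset_S,
    strip_symmetral h2.isConvexDisk.isCompact h2.subset_S]
  intro hs
  refine StripSym.neg ?_
  obtain ⟨a, b, ha, hb, hab⟩ := hs
  have key : ∀ φ, F.swap.strip (F.symmetral K) φ t → F.swap.strip (F.symmetral K) φ (-t) := by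
    intro φ hφ
    refine ⟨hφ.1, ?_⟩
    rw [Real.arctan_neg, ← mirror_swap_pt]
    exact mirror_mem_symmetral h.isConvexDisk.isCompact h.subset_S hφ.2
  exact ⟨a, b, key a ha, key b hb, hab⟩

end SteinerFrame

/-- The centre of a centrally symmetric convex disk is an interior point. -/
theorem exists_closedBall_subset {K : Set S2} {c : S2} (hK : IsConvexDisk K)
    (hKS : K ⊆ openHemisphere c) (hc : CentSym c K) : ∃ ρ, 0 < ρ ∧ ρ < π / 2 ∧
      Metric.closedBall c ρ ⊆ K := by
  obtain ⟨x, hx⟩ := hK.nonempty_interior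
  have hxK := interior_subset hx
  have hd : 0 < S2.dot x c := mem_openHemisphere_iff.1 (hKS hxK)
  obtain ⟨δ, hδ, hball⟩ := Metric.mem_nhds_iff.1 (mem_interior_iff_mem_nhds.1 hx)
  -- Up to normalization, `v y` is the point whose segment to the half turn of `x` passes through
  -- `y`. Since `v c = x`, it stays in the interior ball around `x` for `y` close to `c`.
  let v : S2 → EuclideanSpace ℝ (Fin 3) := fun y => (2 * S2.dot x c) • y.vec - (S2.halfTurn c x).vec
  have hv : Continuous v := by
    have := S2.continuous_vec
    fun_prop
  have hvc : v c = x.vec := by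
    change (2 * S2.dot x c) • c.vec - ((2 * S2.dot x c) • c.vec - x.vec) = x.vec
    abel
  have hv0 : v c ≠ 0 := by rw [hvc, ← norm_ne_zero_iff, S2.norm_vec]; exact one_ne_zero
  have hg : ContinuousAt (fun y => Real.arccos (inner ℝ (‖v y‖⁻¹ • v y) x.vec)) c := by
    refine Real.continuous_arccos.continuousAt.comp ?_
    refine ContinuousAt.inner ?_ continuousAt_const
    exact (hv.norm.continuousAt.inv₀ (norm_ne_zero_iff.2 hv0)).smul hv.continuousAt
  have hgc : Real.arccos (inner ℝ (‖v c‖⁻¹ • v c) x.vec) = 0 := by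
    rw [hvc, S2.norm_vec]; simp [S2.norm_vec]
  have hev1 : ∀ᶠ y in 𝓝 c, Real.arccos (inner ℝ (‖v y‖⁻¹ • v y) x.vec) < δ :=
    hg.eventually_lt continuousAt_const (by rwa [hgc])
  have hev2 : ∀ᶠ y in 𝓝 c, v y ≠ 0 := hv.continuousAt.eventually_ne hv0
  obtain ⟨ρ, hρ, hsub⟩ := Metric.nhds_basis_closedBall.eventually_iff.1 (hev1.and hev2)
  refine ⟨min ρ 1, lt_min hρ one_pos, (min_le_right _ _).trans_lt (by linarith [Real.pi_gt_three]), ?_⟩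
  intro y hy
  obtain ⟨h1, h2⟩ := hsub (Metric.closedBall_subset_closedBall (min_le_left _ _) hy)
  have hn : ‖v y‖ ≠ 0 := norm_ne_zero_iff.2 h2
  obtain ⟨x', hx'⟩ : ∃ x' : S2, x'.vec = ‖v y‖⁻¹ • v y :=
    ⟨⟨‖v y‖⁻¹ • v y, by rw [norm_smul, norm_inv, norm_norm, inv_mul_cancel₀ hn]⟩, rfl⟩
  have hx'K : x' ∈ K := by
    refine hball ?_
    rw [Metric.mem_ball, S2.dist_eq, S2.dot, hx']
    exact h1
  refine hK.sphConvex.2 x' hx'K _ (hc x hxK) ⟨‖v y‖ / (2 * S2.dot x c), 1 / (2 * S2.dot x c),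
    by positivity, by positivity, ?_⟩
  rw [hx', smul_smul, div_mul_eq_mul_div, mul_inv_cancel₀ hn, ← smul_add]
  change y.vec = (1 / (2 * S2.dot x c)) • ((2 * S2.dot x c) • y.vec - (S2.halfTurn c x).vec + (S2.halfTurn c x).vec)
  rw [sub_add_cancel, smul_smul, one_div_mul_cancel (by positivity), one_smul]

/-! ### Symmetrizations with a common centre -/

namespace SteinerFrame

variable {F : SteinerFrame}

theorem mem_closedBall_center_iff {p : S2} {r : ℝ} (h0 : 0 ≤ r) (hr : r ≤ π) :
    p ∈ Metric.closedBall F.center r ↔ Real.cos r ≤ S2.dot p F.center := by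
  rw [Metric.mem_closedBall, S2.dist_le_iff h0 hr]

theorem closedBall_subset_S {r : ℝ} (hr : r < π / 2) : Metric.closedBall F.center r ⊆ F.S :=
  Metric.closedBall_subset_ball hr

theorem cos_le_cos_of_abs_le {a b : ℝ} (hb : |b| < π / 2) (h : |a| ≤ |b|) :
    Real.cos b ≤ Real.cos a := by
  rw [← Real.cos_abs a, ← Real.cos_abs b]
  exact Real.cos_le_cos_of_nonneg_of_le_pi (abs_nonneg a) (by linarith [Real.pi_pos]) h

theorem closedBall_subset_symmetral {X : Set S2} (hX : IsCompact X) (hXS : X ⊆ F.S) {r : ℝ}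
    (h0 : 0 ≤ r) (hr : r < π / 2) (hb : Metric.closedBall F.center r ⊆ X) :
    Metric.closedBall F.center r ⊆ F.symmetral X := by
  intro p hp
  have hpS := closedBall_subset_S hr hp
  rw [mem_symmetral_iff hX hXS]
  have hφ := phi_mem (F := F) p
  have hθ := theta_mem hpS
  rw [mem_closedBall_center_iff h0 (by linarith [Real.pi_pos]), dot_center_eq hpS] at hp
  have key : ∀ x, |x| = |F.phi p| → F.pt x (F.theta p) ∈ X := by
    intro x hx
    refine hb ?_
    rwa [mem_closedBall_center_iff h0 (by linarith [Real.pi_pos]), dot_pt_center, ← Real.cos_abs x, hx,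
      Real.cos_abs]
  refine ⟨hpS, _, key (-|F.phi p|) (by simp), _, key |F.phi p| (by simp), theta_pt hθ, theta_pt hθ, ?_⟩
  rw [phi_pt (by simpa using hφ) hθ, phi_pt (by simpa using hφ) hθ]
  linarith

/-- On a distance curve the distance from the centre increases with `|φ|`, and one of the two points
that witness `p` has `|φ|` at least as large as `p`. -/
theorem cos_le_dot_of_mem_symmetral {X : Set S2} (hX : IsCompact X) (hXS : X ⊆ F.S) {k : ℝ}
    (hk : ∀ x ∈ X, k ≤ S2.dot x F.center) {p : S2} (hp : p ∈ F.symmetral X) :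
    k ≤ S2.dot p F.center := by
  obtain ⟨hpS, a, ha, b, hb, hta, htb, h⟩ := (mem_symmetral_iff hX hXS).1 hp
  have hcos := cos_theta_pos hpS
  rw [dot_center_eq hpS]
  have key : ∀ x ∈ X, F.theta x = F.theta p → |F.phi p| ≤ |F.phi x| →
      k ≤ Real.cos (F.theta p) * Real.cos (F.phi p) := by
    intro x hx htx hle
    refine (hk x hx).trans ?_
    rw [dot_center_eq (hXS hx), htx]
    exact mul_le_mul_of_nonneg_left (cos_le_cos_of_abs_le (phi_mem x) hle) hcos.le
  rcases le_total |F.phi p| |F.phi a| with h1 | h1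
  · exact key a ha hta h1
  · refine key b hb htb ?_
    have := neg_abs_le (F.phi a)
    have := le_abs_self (F.phi b)
    linarith

theorem symmetral_subset_closedBall {X : Set S2} (hX : IsCompact X) {r : ℝ}
    (h0 : 0 ≤ r) (hr : r < π / 2) (hb : X ⊆ Metric.closedBall F.center r) :
    F.symmetral X ⊆ Metric.closedBall F.center r := by
  intro p hp
  have hrπ : r ≤ π := by linarith [Real.pi_pos]
  rw [mem_closedBall_center_iff h0 hrπ]
  exact cos_le_dot_of_mem_symmetral hX (hb.trans (closedBall_subset_S hr))
    (fun x hx => (mem_closedBall_center_iff h0 hrπ).1 (hb hx)) hp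

/-- Extreme points of the symmetral come from pairs of extreme points. -/
theorem mem_of_mem_symmetral {X : Set S2} (hX : IsCompact X) {r : ℝ}
    (h0 : 0 ≤ r) (hr : r < π / 2) (hb : X ⊆ Metric.closedBall F.center r) {p : S2}
    (hp : p ∈ F.symmetral X) (hpr : dist p F.center = r) : p ∈ X ∧ F.mirror p ∈ X := by
  have hrπ : r ≤ π := by linarith [Real.pi_pos]
  have hXS := hb.trans (closedBall_subset_S (F := F) hr)
  obtain ⟨hpS, a, ha, b, hbX, hta, htb, h⟩ := (mem_symmetral_iff hX hXS).1 hp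
  have hcos := cos_theta_pos hpS
  have e : Real.cos r = Real.cos (F.theta p) * Real.cos (F.phi p) := by
    rw [← dot_center_eq hpS, ← S2.cos_dist, hpr]
  -- The cap of radius `r` confines the slice of `X` to longitudes between `-|φ p|` and `|φ p|`, so
  -- the witnessing pair must consist of exactly these two ends.
  have key : ∀ x ∈ X, F.theta x = F.theta p → |F.phi x| ≤ |F.phi p| := by
    intro x hx htx
    have h1 := (mem_closedBall_center_iff h0 hrπ).1 (hb hx)
    rw [dot_center_eq (hXS hx), htx, e] at h1
    have h2 := le_of_mul_le_mul_left h1 hcos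
    by_contra hcon
    have h3 := Real.cos_lt_cos_of_nonneg_of_le_pi (abs_nonneg (F.phi p))
      (by linarith [phi_mem (F := F) x, Real.pi_pos]) (not_le.1 hcon)
    rw [Real.cos_abs, Real.cos_abs] at h3
    linarith
  have ka := abs_le.1 (key a ha hta)
  have kb := abs_le.1 (key b hbX htb)
  have ea : F.phi a = -|F.phi p| := by linarith
  have eb : F.phi b = |F.phi p| := by linarith
  have ha' : F.pt (-|F.phi p|) (F.theta p) ∈ X := by
    rw [← ea, ← hta, pt_phi_theta (hXS ha)]; exact ha
  have hb' : F.pt |F.phi p| (F.theta p) ∈ X := by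
    rw [← eb, ← htb, pt_phi_theta (hXS hbX)]; exact hbX
  have hm : F.mirror p = F.pt (-F.phi p) (F.theta p) := by
    conv_lhs => rw [← pt_phi_theta hpS, mirror_pt]
  rw [hm]
  rcases abs_choice (F.phi p) with h | h
  · rw [h] at ha' hb'
    rw [pt_phi_theta hpS] at hb'
    exact ⟨hb', ha'⟩
  · rw [h] at ha' hb'
    rw [neg_neg, pt_phi_theta hpS] at ha'
    exact ⟨ha', hb'⟩

theorem iterSymmetral_append (l l' : List SteinerFrame) (X : Set S2) :
    iterSymmetral (l ++ l') X = iterSymmetral l' (iterSymmetral l X) := by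
  induction l generalizing X with
  | nil => rfl
  | cons F l ih => exact ih _

theorem applicable_append {l l' : List SteinerFrame} {X : Set S2} (h : Applicable l X)
    (h' : Applicable l' (iterSymmetral l X)) : Applicable (l ++ l') X := by
  induction l generalizing X with
  | nil => exact h'
  | cons F l ih => exact ⟨h.1, ih h.2 h'⟩

/-- All frames of the list have centre `c`. -/
def CenteredAt (c : S2) (l : List SteinerFrame) : Prop := ∀ F ∈ l, F.center = c

theorem iter_induction {c : S2} {P : Set S2 → Prop}
    (hstep : ∀ F : SteinerFrame, F.center = c → ∀ X, P X → P (F.symmetral X))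
    {l : List SteinerFrame} (hl : CenteredAt c l) {X : Set S2} (hX : P X) : P (iterSymmetral l X) := by
  induction l generalizing X with
  | nil => exact hX
  | cons F l ih =>
    exact ih (fun G hG => hl G (List.mem_cons_of_mem _ hG)) (hstep F (hl F List.mem_cons_self) X hX)

theorem iter_compact {c : S2} {l : List SteinerFrame} (hl : CenteredAt c l) {X : Set S2} {r : ℝ}
    (h0 : 0 ≤ r) (hr : r < π / 2) (hX : IsCompact X) (hb : X ⊆ Metric.closedBall c r) :
    IsCompact (iterSymmetral l X) ∧ iterSymmetral l X ⊆ Metric.closedBall c r := by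
  refine iter_induction (P := fun X => IsCompact X ∧ X ⊆ Metric.closedBall c r) ?_ hl ⟨hX, hb⟩
  rintro F rfl X ⟨h1, h2⟩
  exact ⟨isCompact_symmetral h1 (h2.trans (closedBall_subset_S hr)),
    symmetral_subset_closedBall h1 h0 hr h2⟩

theorem iter_mono {c : S2} {l : List SteinerFrame} (hl : CenteredAt c l) {X Y : Set S2} {r : ℝ}
    (h0 : 0 ≤ r) (hr : r < π / 2) (hX : IsCompact X) (hXY : X ⊆ Y) (hY : IsCompact Y)
    (hb : Y ⊆ Metric.closedBall c r) : iterSymmetral l X ⊆ iterSymmetral l Y := by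
  induction l generalizing X Y with
  | nil => exact hXY
  | cons F l ih =>
    obtain rfl := hl F List.mem_cons_self
    have hYS := hb.trans (closedBall_subset_S (F := F) hr)
    exact ih (fun G hG => hl G (List.mem_cons_of_mem _ hG)) (isCompact_symmetral hX (hXY.trans hYS))
      (symmetral_mono hX hXY hY hYS) (isCompact_symmetral hY hYS)
      (symmetral_subset_closedBall hY h0 hr hb)

/-- Symmetrization creates no new points on the boundary circle of the cap: a point of this circle
survives only if its mirror image was present as well. Going back through the list, this reaches `X`
for every frame, as mirrors preserve the distance from `c`. -/
theorem mem_of_mem_iter {c : S2} {l : List SteinerFrame} (hl : CenteredAt c l) {X : Set S2} {r : ℝ}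
    (h0 : 0 ≤ r) (hr : r < π / 2) (hX : IsCompact X) (hb : X ⊆ Metric.closedBall c r) {p : S2}
    (hp : p ∈ iterSymmetral l X) (hpr : dist p c = r) : p ∈ X ∧ ∀ F ∈ l, F.mirror p ∈ X := by
  induction l generalizing X with
  | nil => exact ⟨hp, by simp⟩
  | cons F l ih =>
    obtain rfl := hl F List.mem_cons_self
    have hXS := hb.trans (closedBall_subset_S (F := F) hr)
    have hl' : CenteredAt F.center l := fun G hG => hl G (List.mem_cons_of_mem _ hG)
    obtain ⟨h1, h2⟩ := ih hl' (isCompact_symmetral hX hXS) (symmetral_subset_closedBall hX h0 hr hb) hp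
    obtain ⟨h3, h4⟩ := mem_of_mem_symmetral hX h0 hr hb h1 hpr
    refine ⟨h3, fun G hG => ?_⟩
    rcases List.mem_cons.1 hG with rfl | hG'
    · exact h4
    · refine (mem_of_mem_symmetral hX h0 hr hb (h2 G hG') ?_).1
      rw [← hpr, S2.dist_eq, S2.dist_eq, ← hl' G hG']
      simp [mirror]

/-- The symmetrals of a decreasing sequence of compact sets. -/
theorem iInter_symmetral_subset {Y : ℕ → Set S2} (hY : ∀ j, IsCompact (Y j)) (hanti : Antitone Y)
    (hYS : ∀ j, Y j ⊆ F.S) : ⋂ j, F.symmetral (Y j) ⊆ F.symmetral (⋂ j, Y j) := by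
  intro p hp
  rw [mem_iInter] at hp
  have hI : IsCompact (⋂ j, Y j) := (isClosed_iInter fun j => (hY j).isClosed).isCompact
  rw [mem_symmetral_iff hI ((iInter_subset _ 0).trans (hYS 0))]
  have hpS := symmetral_subset_S _ (hp 0)
  -- The pairs in `Y j` that witness `p` form decreasing nonempty compact sets, and a common pair
  -- witnesses `p` for the intersection.
  let T : ℕ → Set (S2 × S2) := fun j => (Y j ×ˢ Y j) ∩
    {x | F.theta x.1 = F.theta p ∧ F.theta x.2 = F.theta p ∧ 2 * |F.phi p| ≤ F.phi x.2 - F.phi x.1}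
  have hTc : ∀ j, IsCompact (T j) := by
    intro j
    have hc1 : IsCompact ((Y j ×ˢ Y j) ∩ {x | F.theta x.1 = F.theta p ∧ F.theta x.2 = F.theta p}) := by
      refine ((hY j).prod (hY j)).inter_right ?_
      exact (isClosed_eq (continuous_theta.comp continuous_fst) continuous_const).inter
        (isClosed_eq (continuous_theta.comp continuous_snd) continuous_const)
    have hco : ContinuousOn (fun x : S2 × S2 => F.phi x.2 - F.phi x.1) (Y j ×ˢ Y j) :=
      (ContinuousOn.comp (g := F.phi) (t := F.S) continuousOn_phi continuous_snd.continuousOn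
        fun x hx => hYS j hx.2).sub
      (ContinuousOn.comp (g := F.phi) (t := F.S) continuousOn_phi continuous_fst.continuousOn
        fun x hx => hYS j hx.1)
    have hc2 := (hco.mono inter_subset_left).preimage_isClosed_of_isClosed hc1.isClosed
      (isClosed_Ici (a := 2 * |F.phi p|))
    have hc3 := hc1.of_isClosed_subset hc2 inter_subset_left
    convert hc3 using 1
    ext x
    simp only [T, mem_inter_iff, mem_ofPred_eq, mem_preimage, mem_Ici, and_assoc]
  have hTn : ∀ j, (T j).Nonempty := by
    intro j
    obtain ⟨-, a, ha, b, hb, h⟩ := (mem_symmetral_iff (hY j) (hYS j)).1 (hp j)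
    exact ⟨(a, b), ⟨ha, hb⟩, h⟩
  have hTa : ∀ j, T (j + 1) ⊆ T j := fun j x hx =>
    ⟨⟨hanti j.le_succ hx.1.1, hanti j.le_succ hx.1.2⟩, hx.2⟩
  obtain ⟨⟨a, b⟩, hab⟩ := IsCompact.nonempty_iInter_of_sequence_nonempty_isCompact_isClosed T hTa hTn
    (hTc 0) fun j => (hTc j).isClosed
  rw [mem_iInter] at hab
  exact ⟨hpS, a, mem_iInter.2 fun j => (hab j).1.1, b, mem_iInter.2 fun j => (hab j).1.2, (hab 0).2⟩

/-- This semicontinuity transfers information about the limit cap to slightly larger caps. -/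
theorem iInter_iter_subset {c : S2} {l : List SteinerFrame} (hl : CenteredAt c l) {r : ℝ}
    (h0 : 0 ≤ r) (hr : r < π / 2) {Y : ℕ → Set S2} (hY : ∀ j, IsCompact (Y j)) (hanti : Antitone Y)
    (hb : ∀ j, Y j ⊆ Metric.closedBall c r) :
    ⋂ j, iterSymmetral l (Y j) ⊆ iterSymmetral l (⋂ j, Y j) := by
  induction l generalizing Y with
  | nil => exact subset_rfl
  | cons F l ih =>
    obtain rfl := hl F List.mem_cons_self
    have hl' : CenteredAt F.center l := fun G hG => hl G (List.mem_cons_of_mem _ hG)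
    have hYS : ∀ j, Y j ⊆ F.S := fun j => (hb j).trans (closedBall_subset_S hr)
    have hanti' : Antitone fun j => F.symmetral (Y j) := fun i j hij =>
      symmetral_mono (hY j) (hanti hij) (hY i) (hYS i)
    have hc : ∀ j, IsCompact (F.symmetral (Y j)) := fun j => isCompact_symmetral (hY j) (hYS j)
    have hI : IsCompact (⋂ j, Y j) := (isClosed_iInter fun j => (hY j).isClosed).isCompact
    have hbI : ⋂ j, Y j ⊆ Metric.closedBall F.center r := (iInter_subset _ 0).trans (hb 0)
    have h1 := ih hl' (Y := fun j => F.symmetral (Y j)) hc hanti' fun j =>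
      symmetral_subset_closedBall (hY j) h0 hr (hb j)
    refine h1.trans (iter_mono hl' h0 hr (isClosed_iInter fun j => (hc j).isClosed).isCompact
      (iInter_symmetral_subset hY hanti hYS)
      (isCompact_symmetral hI (hbI.trans (closedBall_subset_S hr)))
      (symmetral_subset_closedBall hI h0 hr hbI))

theorem dist_mirror (p q : S2) : dist (F.mirror p) (F.mirror q) = dist p q := by
  rw [S2.dist_eq, S2.dist_eq, F.dot_eq, F.dot_eq p q]
  simp [mirror]

theorem mirror_mirror (p : S2) : F.mirror (F.mirror p) = p := by
  apply F.ext_dot <;> simp [mirror]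

/-- Two points at the same distance from `c` are mirror images. -/
theorem exists_mirror_eq {c x y : S2} (h : dist x c = dist y c) :
    ∃ F : SteinerFrame, F.center = c ∧ F.mirror x = y := by
  have hdot : S2.dot x c = S2.dot y c := by rw [← S2.cos_dist, ← S2.cos_dist, h]
  rcases eq_or_ne x y with rfl | hne
  · obtain ⟨a, hca, hxa⟩ := S2.exists_dot_eq_zero c x
    obtain ⟨F, hF, rfl⟩ := exists_frame hca
    refine ⟨F, hF, F.ext_dot ?_ ?_ ?_⟩ <;> simp [mirror, hxa]
  · have hv : x.vec - y.vec ≠ 0 := sub_ne_zero.2 fun h => hne (S2.vec_injective h)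
    have hn : ‖x.vec - y.vec‖ ≠ 0 := norm_ne_zero_iff.2 hv
    obtain ⟨a, ha⟩ : ∃ a : S2, a.vec = ‖x.vec - y.vec‖⁻¹ • (x.vec - y.vec) :=
      ⟨⟨_, by rw [norm_smul, norm_inv, norm_norm, inv_mul_cancel₀ hn]⟩, rfl⟩
    have hda : ∀ w : S2, S2.dot w a = ‖x.vec - y.vec‖⁻¹ * (S2.dot w x - S2.dot w y) := by
      intro w
      rw [S2.dot, ha, inner_smul_right, inner_sub_right]
      rfl
    obtain ⟨F, rfl, rfl⟩ := exists_frame (c := c) (a := a) (by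
      rw [hda, S2.dot_comm c x, S2.dot_comm c y, hdot, sub_self, mul_zero])
    refine ⟨F, rfl, F.ext_dot ?_ ?_ ?_⟩
    · simpa [mirror] using hdot
    · rw [mirror, dot_ofCoord_axisDir, hda, hda, S2.dot_self, S2.dot_self, S2.dot_comm y x]
      ring
    · have h0 := F.axisDir_pole
      rw [S2.dot, ha, inner_smul_left, inner_sub_left] at h0
      have h1 := (mul_eq_zero.1 h0).resolve_left (by simpa using hn)
      rw [mirror, dot_ofCoord_pole]
      exact sub_eq_zero.1 h1

/-- Finitely many symmetrizations push a compact set that misses a part of the boundary circle of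
a cap away from this circle. -/
theorem exists_list_push {c x : S2} {r ε : ℝ} (h0 : 0 ≤ r) (hr : r < π / 2) (hε : 0 < ε)
    (hx : dist x c = r) : ∃ l, CenteredAt c l ∧ ∀ Y, IsCompact Y → Y ⊆ Metric.closedBall c r →
      (∀ y ∈ Y, ε ≤ dist y x) → ∀ p ∈ iterSymmetral l Y, dist p c < r := by
  have hΓ : IsCompact (Metric.sphere c r) := Metric.isClosed_sphere.isCompact
  -- For each centre `y` of a finite cover of the circle, a frame whose mirror takes `x` to `y` is
  -- used, so that the gap around `x` is copied onto every ball of the cover.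
  obtain ⟨t, htΓ, ht, hcov⟩ := hΓ.finite_cover_balls hε
  have hex : ∀ y ∈ t, ∃ F : SteinerFrame, F.center = c ∧ F.mirror x = y := fun y hy =>
    exists_mirror_eq (by rw [hx]; exact (htΓ hy).symm)
  have : Nonempty SteinerFrame := ⟨(exists_frame_center c).choose⟩
  choose! G hGc hGx using hex
  refine ⟨ht.toFinset.toList.map G, ?_, ?_⟩
  · intro F hF
    obtain ⟨y, hy, rfl⟩ := List.mem_map.1 hF
    exact hGc y (by simpa using hy)
  intro Y hY hb hYx p hp
  have hl : CenteredAt c (ht.toFinset.toList.map G) := by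
    intro F hF
    obtain ⟨y, hy, rfl⟩ := List.mem_map.1 hF
    exact hGc y (by simpa using hy)
  have hle := (iter_compact hl h0 hr hY hb).2 hp
  rcases (Metric.mem_closedBall.1 hle).lt_or_eq with h | h
  · exact h
  exfalso
  obtain ⟨-, hm⟩ := mem_of_mem_iter hl h0 hr hY hb hp h
  obtain ⟨y, hyt, hpy⟩ := mem_iUnion₂.1 (hcov (Metric.mem_sphere.2 h))
  -- The mirror image of `p` lies in `Y`, but it is as close to `x` as `p` is to `y`.
  have h1 := hYx _ (hm (G y) (List.mem_map_of_mem (by simpa using hyt)))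
  rw [← mirror_mirror (F := G y) x, dist_mirror, hGx y hyt] at h1
  exact absurd (Metric.mem_ball.1 hpy) (not_lt.2 h1)

end SteinerFrame

/-! ### Separation by great circles -/

/-- The cone over a spherically convex compact set. -/
noncomputable def sphCone (X : Set S2) (hX : IsCompact X) (hne : X.Nonempty)
    (hseg : ∀ x ∈ X, ∀ y ∈ X, sphSegment x y ⊆ X) : ProperCone ℝ (EuclideanSpace ℝ (Fin 3)) where
  carrier := {v | ∃ k ∈ X, v = ‖v‖ • k.vec}
  add_mem' := by
    rintro v w ⟨k, hk, hv⟩ ⟨k', hk', hw⟩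
    by_cases h : v + w = 0
    · obtain ⟨c, hc⟩ := hne
      exact ⟨c, hc, by rw [h, norm_zero, zero_smul]⟩
    have hn : ‖v + w‖ ≠ 0 := norm_ne_zero_iff.2 h
    let z : S2 := ⟨‖v + w‖⁻¹ • (v + w), by rw [norm_smul, norm_inv, norm_norm, inv_mul_cancel₀ hn]⟩
    have hz : z.vec = ‖v + w‖⁻¹ • (v + w) := rfl
    refine ⟨z, hseg k hk k' hk' ⟨‖v + w‖⁻¹ * ‖v‖, ‖v + w‖⁻¹ * ‖w‖, by positivity, by positivity, ?_⟩, ?_⟩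
    · rw [hz, mul_smul, mul_smul, ← hv, ← hw, smul_add]
    · rw [hz, smul_smul, mul_inv_cancel₀ hn, one_smul]
  zero_mem' := by
    obtain ⟨c, hc⟩ := hne
    exact ⟨c, hc, by rw [norm_zero, zero_smul]⟩
  smul_mem' := by
    rintro ⟨a, ha⟩ v ⟨k, hk, hv⟩
    refine ⟨k, hk, ?_⟩
    change a • v = ‖a • v‖ • k.vec
    rw [norm_smul, Real.norm_of_nonneg ha, mul_smul, ← hv]
  isClosed' := by
    -- The cone is the projection of a closed set along the compact sphere.
    have : IsClosed {x : EuclideanSpace ℝ (Fin 3) × S2 | x.2 ∈ X ∧ x.1 = ‖x.1‖ • x.2.vec} := by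
      have := S2.continuous_vec
      exact (hX.isClosed.preimage continuous_snd).inter (isClosed_eq (by fun_prop) (by fun_prop))
    convert isClosedMap_fst_of_compactSpace _ this using 1
    ext v
    simp

/-- Separation of a point from a compact spherically convex set by a great circle. -/
theorem exists_separating {X : Set S2} (hX : IsCompact X) (hne : X.Nonempty)
    (hseg : ∀ x ∈ X, ∀ y ∈ X, sphSegment x y ⊆ X) {y : S2} (hy : y ∉ X) :
    ∃ n : S2, (∀ k ∈ X, 0 ≤ S2.dot n k) ∧ S2.dot n y < 0 := by
  have hy' : y.vec ∉ sphCone X hX hne hseg := by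
    rintro ⟨k, hk, h⟩
    rw [S2.norm_vec, one_smul] at h
    exact hy (S2.vec_injective h ▸ hk)
  obtain ⟨m, hm, hmy⟩ := ProperCone.hyperplane_separation' _ hy'
  have hm0 : m ≠ 0 := by rintro rfl; simp at hmy
  have hn : 0 < ‖m‖ := norm_pos_iff.2 hm0
  let n : S2 := ⟨‖m‖⁻¹ • m, by rw [norm_smul, norm_inv, norm_norm, inv_mul_cancel₀ hn.ne']⟩
  have hd : ∀ k : S2, S2.dot n k = ‖m‖⁻¹ * inner ℝ k.vec m := by
    intro k
    change inner ℝ (‖m‖⁻¹ • m) k.vec = _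
    rw [real_inner_smul_left, real_inner_comm]
  refine ⟨n, fun k hk => ?_, ?_⟩
  · rw [hd]
    exact mul_nonneg (inv_nonneg.2 hn.le) (hm _ ⟨k, hk, by rw [S2.norm_vec, one_smul]⟩)
  · rw [hd]
    exact mul_neg_of_pos_of_neg (inv_pos.2 hn) hmy

namespace SteinerFrame

theorem dist_pt_zero (F : SteinerFrame) {a b : ℝ} (h : |a - b| ≤ π) :
    dist (F.pt a 0) (F.pt b 0) = |a - b| := by
  rw [S2.dist_eq, dot_pt_pt]
  simp only [Real.cos_zero, Real.sin_zero, mul_zero, add_zero, one_mul]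
  rw [← Real.cos_abs, Real.arccos_cos (abs_nonneg _) h]

end SteinerFrame

/-- The great circle from `p` through `q`, parametrized by arc length. -/
theorem exists_geodesic {p q : S2} (h0 : 0 < dist p q) (h1 : dist p q < π) :
    ∃ γ : ℝ → S2, γ 0 = p ∧ γ (dist p q) = q ∧ ∀ a b, |a - b| ≤ π → dist (γ a) (γ b) = |a - b| := by
  obtain ⟨F, hp, hq⟩ := SteinerFrame.exists_frame_of_dist h0 h1
  refine ⟨fun s => F.pt (s - dist p q / 2) 0, ?_, ?_, ?_⟩
  · simpa using hp
  · change F.pt (dist p q - dist p q / 2) 0 = q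
    rw [sub_half]; exact hq
  · intro a b h
    rw [F.dist_pt_zero (by simpa using h)]
    simp

/-- If a compact spherically convex set comes close to every point of a circle, then it contains a
slightly smaller concentric cap. -/
theorem closedBall_subset_of_forall_near {X : Set S2} {c : S2} (hX : IsCompact X) (hc : c ∈ X)
    (hseg : ∀ x ∈ X, ∀ y ∈ X, sphSegment x y ⊆ X) {r ε : ℝ} (hr0 : 0 < r) (hr : r < π / 2)
    (h : ∀ x, dist x c = r → ∃ k ∈ X, dist x k < ε) : Metric.closedBall c (r - ε) ⊆ X := by
  intro y hy
  rw [Metric.mem_closedBall] at hy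
  by_contra hyX
  obtain ⟨n, hn, hny⟩ := exists_separating hX ⟨c, hc⟩ hseg hyX
  have hle : ∀ k ∈ X, dist n k ≤ π / 2 := fun k hk => by
    rw [S2.dist_le_iff (by positivity) (by linarith [Real.pi_pos]), Real.cos_pi_div_two]
    exact hn k hk
  have hlt : π / 2 < dist n y := by
    by_contra hcon
    rw [not_lt, S2.dist_le_iff (by positivity) (by linarith [Real.pi_pos]), Real.cos_pi_div_two] at hcon
    linarith
  have hnc := hle c hc
  have htri := dist_triangle_right n y c
  -- If `n = c`, the triangle inequality forces `ε < 0`, contrary to the nearness hypothesis at any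
  -- point of the circle.
  rcases (dist_nonneg (x := n) (y := c)).eq_or_lt with h0 | h0
  · obtain ⟨F, rfl⟩ := SteinerFrame.exists_frame_center c
    have hx : dist (F.pt r 0) F.center = r := by
      rw [S2.dist_eq, F.dot_pt_center, Real.cos_zero, one_mul,
        Real.arccos_cos hr0.le (by linarith [Real.pi_pos])]
    obtain ⟨k, hk, hkε⟩ := h _ hx
    linarith [dist_nonneg (x := F.pt r 0) (y := k)]
  obtain ⟨γ, hγ0, hγc, hγ⟩ := exists_geodesic h0 (by linarith [Real.pi_pos])
  -- The point of the circle farthest from `n`, on the geodesic from `n` prolonged beyond `c`. A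
  -- point of `X` near it would have distance more than `π / 2` from `n`.
  have hx : dist (γ (dist n c + r)) c = r := by
    have e : |dist n c + r - dist n c| = r := by rw [add_sub_cancel_left, abs_of_pos hr0]
    calc dist (γ (dist n c + r)) c = dist (γ (dist n c + r)) (γ (dist n c)) := by rw [hγc]
      _ = r := by rw [hγ _ _ (by rw [e]; linarith), e]
  have hxn : dist n (γ (dist n c + r)) = dist n c + r := by
    have e : |0 - (dist n c + r)| = dist n c + r := by
      rw [zero_sub, abs_neg, abs_of_pos (by positivity)]
    calc dist n (γ (dist n c + r)) = dist (γ 0) (γ (dist n c + r)) := by rw [hγ0]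
      _ = dist n c + r := by rw [hγ _ _ (by rw [e]; linarith), e]
  obtain ⟨k, hk, hkε⟩ := h _ hx
  have h1 := hle k hk
  have h2 := dist_triangle_right n (γ (dist n c + r)) k
  linarith

/-! ### Convergence to a cap and the area of caps -/

theorem exists_dist_sub {c z : S2} {s : ℝ} (h0 : 0 ≤ s) (hs : s ≤ dist z c) (hz : dist z c < π) :
    ∃ w, dist w c = s ∧ dist z w = dist z c - s := by
  rcases (dist_nonneg (x := z) (y := c)).eq_or_lt with h | h
  · exact ⟨c, by rw [dist_self]; linarith, by linarith⟩
  obtain ⟨γ, hγ0, hγc, hγ⟩ := exists_geodesic h hz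
  refine ⟨γ (dist z c - s), ?_, ?_⟩
  · have e : |dist z c - s - dist z c| = s := by
      rw [show dist z c - s - dist z c = -s by ring, abs_neg, abs_of_nonneg h0]
    calc dist (γ (dist z c - s)) c = dist (γ (dist z c - s)) (γ (dist z c)) := by rw [hγc]
      _ = s := by rw [hγ _ _ (by rw [e]; linarith), e]
  · have e : |0 - (dist z c - s)| = dist z c - s := by
      rw [zero_sub, abs_neg, abs_of_nonneg (by linarith)]
    calc dist z (γ (dist z c - s)) = dist (γ 0) (γ (dist z c - s)) := by rw [hγ0]
      _ = dist z c - s := by rw [hγ _ _ (by rw [e]; linarith), e]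

theorem hausdorffEDist_closedBall_le {X : Set S2} {c : S2} {r ε : ℝ} (hε : 0 ≤ ε) (hεr : ε ≤ r)
    (hr : r + ε < π) (h1 : Metric.closedBall c (r - ε) ⊆ X) (h2 : X ⊆ Metric.closedBall c (r + ε)) :
    Metric.hausdorffEDist X (Metric.closedBall c r) ≤ ENNReal.ofReal ε := by
  refine Metric.hausdorffEDist_le_of_mem_edist ?_ ?_
  · intro x hx
    have hx' := Metric.mem_closedBall.1 (h2 hx)
    rcases le_total (dist x c) r with h | h
    · exact ⟨x, h, by simp⟩
    · obtain ⟨w, hw, hwx⟩ := exists_dist_sub (hε.trans hεr) h (by linarith)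
      refine ⟨w, hw.le, ?_⟩
      rw [edist_dist, hwx]
      exact ENNReal.ofReal_le_ofReal (by linarith)
  · intro x hx
    have hx' := Metric.mem_closedBall.1 hx
    rcases le_total (dist x c) (r - ε) with h | h
    · exact ⟨x, h1 h, by simp⟩
    · obtain ⟨w, hw, hwx⟩ := exists_dist_sub (sub_nonneg.2 hεr) h (by linarith)
      refine ⟨w, h1 hw.le, ?_⟩
      rw [edist_dist, hwx]
      exact ENNReal.ofReal_le_ofReal (by linarith)

theorem sphArea_sphere (c : S2) (r : ℝ) : sphArea (Metric.sphere c r) = 0 := by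
  obtain ⟨F, rfl⟩ := SteinerFrame.exists_frame_center c
  let G : SteinerFrame := ⟨F.axisDir, F.pole, F.center, F.axisDir_pole,
    by rw [S2.dot_comm]; exact F.center_axisDir, by rw [S2.dot_comm]; exact F.center_pole⟩
  refine measure_mono_null (fun p hp => ?_) (G.sphArea_latitude (Real.cos r))
  change S2.dot p F.center = Real.cos r
  rw [← S2.cos_dist, Metric.mem_sphere.1 hp]

/-- Continuity of the measure from below and from above. The smaller caps exhaust only the open cap,
so the boundary circle must have measure zero. -/
theorem sphArea_closedBall_eq {c : S2} {r r₀ : ℝ} (hr₀ : 0 < r₀) {A : ℝ≥0∞}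
    (h1 : ∀ ε, 0 < ε → ε < r₀ → sphArea (Metric.closedBall c (r - ε)) ≤ A)
    (h2 : ∀ ε, 0 < ε → ε < r₀ → A ≤ sphArea (Metric.closedBall c (r + ε))) :
    sphArea (Metric.closedBall c r) = A := by
  obtain ⟨F, -⟩ := SteinerFrame.exists_frame_center c
  have := F.isFiniteMeasure_hausdorffMeasure
  let u : ℕ → ℝ := fun n => min (1 / (n + 1)) (r₀ / 2)
  have hu0 : ∀ n, 0 < u n := fun n => lt_min (by positivity) (by positivity)
  have hur : ∀ n, u n < r₀ := fun n => (min_le_right _ _).trans_lt (by linarith)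
  have hu : Tendsto u atTop (𝓝 0) := by
    have := (tendsto_one_div_add_atTop_nhds_zero_nat (𝕜 := ℝ)).min
      (tendsto_const_nhds (x := r₀ / 2))
    rwa [min_eq_left (by positivity)] at this
  have hanti : Antitone u := fun m n h => min_le_min_right _ (Nat.one_div_le_one_div h)
  refine le_antisymm ?_ ?_
  · have hsub : Metric.closedBall c r ⊆ Metric.sphere c r ∪ ⋃ n, Metric.closedBall c (r - u n) := by
      intro p hp
      rcases (Metric.mem_closedBall.1 hp).eq_or_lt with h | h
      · exact Or.inl h
      · obtain ⟨n, hn⟩ := (hu.eventually_lt_const (sub_pos.2 h)).exists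
        exact Or.inr (mem_iUnion.2 ⟨n, Metric.mem_closedBall.2 (by linarith)⟩)
    calc sphArea (Metric.closedBall c r) ≤ _ := measure_mono hsub
      _ ≤ sphArea (Metric.sphere c r) + sphArea (⋃ n, Metric.closedBall c (r - u n)) :=
        measure_union_le _ _
      _ = sphArea (⋃ n, Metric.closedBall c (r - u n)) := by
        rw [sphArea_sphere c r, zero_add]
      _ ≤ A := by
        have hmono : Monotone fun n => Metric.closedBall c (r - u n) := fun m n h =>
          Metric.closedBall_subset_closedBall (by linarith [hanti h])
        exact le_of_tendsto' (tendsto_measure_iUnion_atTop hmono) fun n => h1 _ (hu0 n) (hur n)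
  · have heq : Metric.closedBall c r = ⋂ n, Metric.closedBall c (r + u n) := by
      ext p
      simp only [Metric.mem_closedBall, mem_iInter]
      refine ⟨fun h n => by linarith [hu0 n], fun h => ?_⟩
      have h3 : Tendsto (fun n => r + u n) atTop (𝓝 (r + 0)) := hu.const_add r
      rw [add_zero] at h3
      exact ge_of_tendsto' h3 h
    rw [heq]
    refine ge_of_tendsto' (tendsto_measure_iInter_atTop (μ := μH[2])
      (fun n => Metric.isClosed_closedBall.measurableSet.nullMeasurableSet)
      (fun m n h => Metric.closedBall_subset_closedBall (by linarith [hanti h]))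
      ⟨0, measure_ne_top _ _⟩) fun n => h2 _ (hu0 n) (hur n)

/-! ### Minimizing the circumradius -/

/-- Centrally symmetric convex disks that contain a given cap and have a given area. -/
structure CentralDisk (c : S2) (ρ : ℝ) (A : ℝ≥0∞) (X : Set S2) : Prop where
  isConvexDisk : IsConvexDisk X
  subset_hemisphere : X ⊆ openHemisphere c
  centSym : CentSym c X
  closedBall_subset : Metric.closedBall c ρ ⊆ X
  area_eq : sphArea X = A

namespace CentralDisk

variable {c : S2} {ρ : ℝ} {A : ℝ≥0∞} {X : Set S2}

theorem good {F : SteinerFrame} (h : CentralDisk F.center ρ A X) : F.Good X :=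
  SteinerFrame.good_of_centSym h.isConvexDisk h.subset_hemisphere h.centSym

theorem symmetral (h0 : 0 ≤ ρ) (hρ : ρ < π / 2) {F : SteinerFrame}
    (h : CentralDisk F.center ρ A X) : CentralDisk F.center ρ A (F.symmetral X) where
  isConvexDisk := h.good.isConvexDisk_symmetral
  subset_hemisphere := SteinerFrame.symmetral_subset_S X
  centSym := SteinerFrame.centSym_symmetral h.isConvexDisk.isCompact h.subset_hemisphere h.centSym
  closedBall_subset := SteinerFrame.closedBall_subset_symmetral h.isConvexDisk.isCompact
    h.subset_hemisphere h0 hρ h.closedBall_subset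
  area_eq := h.good.sphArea_symmetral.trans h.area_eq

theorem iter (h0 : 0 ≤ ρ) (hρ : ρ < π / 2) {l : List SteinerFrame}
    (hl : SteinerFrame.CenteredAt c l) (h : CentralDisk c ρ A X) :
    CentralDisk c ρ A (SteinerFrame.iterSymmetral l X) :=
  SteinerFrame.iter_induction (P := CentralDisk c ρ A)
    (fun F hF X hX => by subst hF; exact hX.symmetral h0 hρ) hl h

theorem applicable (h0 : 0 ≤ ρ) (hρ : ρ < π / 2) {l : List SteinerFrame}
    (hl : SteinerFrame.CenteredAt c l) (h : CentralDisk c ρ A X) : SteinerFrame.Applicable l X := by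
  induction l generalizing X with
  | nil => trivial
  | cons F l ih =>
    obtain rfl := hl F List.mem_cons_self
    exact ⟨⟨h.subset_hemisphere, h.good.angularMonotonicity⟩,
      ih (fun G hG => hl G (List.mem_cons_of_mem _ hG)) (h.symmetral h0 hρ)⟩

end CentralDisk

theorem IsCompact.exists_subset_closedBall_lt {Z : Set S2} (hZ : IsCompact Z) {c : S2} {r : ℝ}
    (hr : 0 < r) (h : ∀ p ∈ Z, dist p c < r) : ∃ s, 0 ≤ s ∧ s < r ∧ Z ⊆ Metric.closedBall c s := by
  rcases Z.eq_empty_or_nonempty with rfl | hne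
  · exact ⟨0, le_rfl, hr, empty_subset _⟩
  obtain ⟨p, hp, hmax⟩ := hZ.exists_isMaxOn hne (f := fun p => dist p c) (by fun_prop)
  exact ⟨dist p c, dist_nonneg, h p hp, fun q hq => hmax hq⟩

namespace SteinerFrame

/-- The circumradii about `c` that can be reached from `X` by symmetrizations centred at `c`. -/
def reachableRadii (c : S2) (X : Set S2) : Set ℝ :=
  {s | 0 ≤ s ∧ ∃ l, CenteredAt c l ∧ iterSymmetral l X ⊆ Metric.closedBall c s}

theorem CenteredAt.append {c : S2} {l l' : List SteinerFrame} (h : CenteredAt c l)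
    (h' : CenteredAt c l') : CenteredAt c (l ++ l') := fun F hF =>
  (List.mem_append.1 hF).elim (h F) (h' F)

theorem le_of_closedBall_subset {c : S2} {ρ s : ℝ} (h0 : 0 ≤ ρ) (hρ : ρ ≤ π)
    (h : Metric.closedBall c ρ ⊆ Metric.closedBall c s) : ρ ≤ s := by
  obtain ⟨F, rfl⟩ := exists_frame_center c
  have hx : dist (F.pt ρ 0) F.center = ρ := by
    rw [S2.dist_eq, F.dot_pt_center, Real.cos_zero, one_mul, Real.arccos_cos h0 hρ]
  have := h (Metric.mem_closedBall.2 hx.le)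
  rwa [Metric.mem_closedBall, hx] at this

/-- Symmetrizations centred at `c` which bring the circumradius near to its infimum also bring `X`
near to every point of the limit circle. -/
theorem exists_iter_near {c : S2} {X : Set S2} {r ε : ℝ} (hε : 0 < ε)
    (hcomp : ∀ l, CenteredAt c l → IsCompact (iterSymmetral l X))
    (hglb : IsGLB (reachableRadii c X) r) (hr0 : 0 < r) (hr : r < π / 2) :
    ∃ l, CenteredAt c l ∧ iterSymmetral l X ⊆ Metric.closedBall c (r + ε) ∧
      ∀ x, dist x c = r → ∃ k ∈ iterSymmetral l X, dist x k < ε := by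
  -- If this fails, each iterate of circumradius at most `r + δ n` misses the open `ε`-ball about
  -- some point `x n` of the circle. The bounds in `δ` make the assumption applicable and keep the
  -- caps in the hemisphere.
  by_contra! hcon
  let δ : ℕ → ℝ := fun n => min (1 / (n + 1)) (min ε ((π / 2 - r) / 2))
  have hδ0 : ∀ n, 0 < δ n := fun n =>
    lt_min (by positivity) (lt_min hε (by linarith))
  have hδε : ∀ n, δ n ≤ ε := fun n => (min_le_right _ _).trans (min_le_left _ _)
  have hδr : ∀ n, r + δ n < π / 2 := fun n => by
    linarith [(min_le_right _ _).trans (min_le_right _ _) (a := δ n)]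
  have hδ : Tendsto δ atTop (𝓝 0) := by
    have := (tendsto_one_div_add_atTop_nhds_zero_nat (𝕜 := ℝ)).min
      (tendsto_const_nhds (x := min ε ((π / 2 - r) / 2)))
    rwa [min_eq_left (lt_min hε (by linarith)).le] at this
  have hanti : Antitone δ := fun m n h => min_le_min_right _ (Nat.one_div_le_one_div h)
  have hex : ∀ n, ∃ l x, CenteredAt c l ∧ iterSymmetral l X ⊆ Metric.closedBall c (r + δ n) ∧
      dist x c = r ∧ ∀ k ∈ iterSymmetral l X, ε ≤ dist x k := by
    intro n
    obtain ⟨s, ⟨-, l, hl, hs⟩, hsr⟩ := (isGLB_lt_iff hglb).1 (lt_add_of_pos_right r (hδ0 n))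
    have hsub := hs.trans (Metric.closedBall_subset_closedBall hsr.le)
    obtain ⟨x, hx, hk⟩ := hcon l hl
      (hsub.trans (Metric.closedBall_subset_closedBall (by linarith [hδε n])))
    exact ⟨l, x, hl, hsub, hx, hk⟩
  choose l x hl hsub hx hk using hex
  obtain ⟨y, -, ν, hν, hlim⟩ := (isCompact_univ (X := S2)).tendsto_subseq (x := x) fun _ => mem_univ _
  have hy : dist y c = r := by
    refine tendsto_nhds_unique (hlim.dist tendsto_const_nhds) ?_
    simp [hx]
  obtain ⟨l', hl', hpush⟩ := exists_list_push hr0.le hr (half_pos hε) hy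
  -- By compactness of the sphere, the gaps accumulate at `y`. The sets `Y j` decrease to a part of
  -- the cap of radius `r` that avoids a ball around `y`; the fixed list `l'` pushes this limit off
  -- the circle.
  let Y : ℕ → Set S2 := fun j => Metric.closedBall c (r + δ j) \ Metric.ball y (ε / 2)
  have hYc : ∀ j, IsCompact (Y j) := fun j =>
    (Metric.isClosed_closedBall.sdiff Metric.isOpen_ball).isCompact
  have hYb : ∀ j, Y j ⊆ Metric.closedBall c (r + δ 0) := fun j =>
    sdiff_subset.trans (Metric.closedBall_subset_closedBall (by linarith [hanti j.zero_le]))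
  have hYa : Antitone Y := fun i j h =>
    sdiff_subset_sdiff_left (Metric.closedBall_subset_closedBall (by linarith [hanti h]))
  have hR0 : 0 ≤ r + δ 0 := by linarith [hδ0 0]
  have hinter : ∀ p ∈ ⋂ j, iterSymmetral l' (Y j), dist p c < r := by
    intro p hp
    refine hpush (⋂ j, Y j) (isClosed_iInter fun j => (hYc j).isClosed).isCompact ?_ ?_ p
      (iInter_iter_subset hl' hR0 (hδr 0) hYc hYa hYb hp)
    · intro q hq
      have h3 : Tendsto (fun n => r + δ n) atTop (𝓝 (r + 0)) := hδ.const_add r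
      rw [add_zero] at h3
      exact ge_of_tendsto' h3 fun n => (mem_iInter.1 hq n).1
    · intro q hq
      exact not_lt.1 (mem_iInter.1 hq 0).2
  have hZc : ∀ j, IsCompact (iterSymmetral l' (Y j)) := fun j =>
    (iter_compact hl' hR0 (hδr 0) (hYc j) (hYb j)).1
  have hZa : Antitone fun j => iterSymmetral l' (Y j) := fun i j h =>
    iter_mono hl' hR0 (hδr 0) (hYc j) (hYa h) (hYc i) (hYb i)
  -- Compactness transfers this from the intersection to a single `Y j`, and then to an iterate of
  -- `X` contained in it; its circumradius falls below the infimum `r`.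
  obtain ⟨j, hj⟩ := exists_subset_nhds_of_isCompact (U := Metric.ball c r) hZa.directed_ge hZc
    fun p hp => Metric.isOpen_ball.mem_nhds (hinter p hp)
  obtain ⟨s, hs0, hsr, hs⟩ := (hZc j).exists_subset_closedBall_lt hr0 fun p hp => hj hp
  obtain ⟨i, hi, hij⟩ : ∃ i, dist (x (ν i)) y < ε / 2 ∧ j ≤ i :=
    ((hlim.eventually (Metric.ball_mem_nhds y (half_pos hε))).and (eventually_ge_atTop j)).exists
  have hXY : iterSymmetral (l (ν i)) X ⊆ Y j := by
    intro p hp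
    refine ⟨Metric.closedBall_subset_closedBall (by linarith [hanti (hij.trans (hν.id_le i))])
      (hsub _ hp), fun hpy => ?_⟩
    have h1 := hk _ p hp
    have h2 := dist_triangle_right (x (ν i)) p y
    have h3 := Metric.mem_ball.1 hpy
    linarith
  have hmem : s ∈ reachableRadii c X := by
    refine ⟨hs0, l (ν i) ++ l', (hl _).append hl', ?_⟩
    rw [iterSymmetral_append]
    exact (iter_mono hl' hR0 (hδr 0) (hcomp _ (hl _)) hXY (hYc j) (hYb j)).trans hs
  exact absurd (hglb.1 hmem) (not_le.2 hsr)

end SteinerFrame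

open SteinerFrame in
/-- Symmetrizations with a common centre bring a centrally symmetric convex disk near to a cap. -/
theorem CentralDisk.exists_iter_near_cap {c : S2} {ρ : ℝ} {A : ℝ≥0∞} {X : Set S2} (h0 : 0 < ρ)
    (hρ : ρ < π / 2) (h : CentralDisk c ρ A X) : ∃ r, 0 < r ∧ r < π / 2 ∧
      ∀ ε, 0 < ε → ∃ l, CenteredAt c l ∧
        Metric.closedBall c (r - ε) ⊆ iterSymmetral l X ∧
        iterSymmetral l X ⊆ Metric.closedBall c (r + ε) := by
  obtain ⟨s, hs0, hs, hsX⟩ := h.isConvexDisk.isCompact.exists_subset_closedBall_lt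
    (by positivity : 0 < π / 2) fun p hp => h.subset_hemisphere hp
  have hiter : ∀ l, CenteredAt c l → CentralDisk c ρ A (iterSymmetral l X) := fun l hl =>
    h.iter h0.le hρ hl
  -- The cap of radius `ρ` survives every symmetrization centred at `c`, so the limit radius cannot
  -- be zero.
  have hlow : ρ ∈ lowerBounds (reachableRadii c X) := by
    rintro s ⟨-, l, hl, hls⟩
    exact le_of_closedBall_subset h0.le (by linarith [Real.pi_pos])
      ((hiter l hl).closedBall_subset.trans hls)
  have hsmem : s ∈ reachableRadii c X := ⟨hs0, [], by simp [CenteredAt], hsX⟩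
  obtain ⟨r, hglb⟩ : ∃ r, IsGLB (reachableRadii c X) r := ⟨_, isGLB_csInf ⟨s, hsmem⟩ ⟨ρ, hlow⟩⟩
  have hr0 : 0 < r := h0.trans_le (hglb.2 hlow)
  have hr : r < π / 2 := (hglb.1 hsmem).trans_lt hs
  refine ⟨r, hr0, hr, fun ε hε => ?_⟩
  obtain ⟨l, hl, hsub, hnear⟩ := exists_iter_near hε
    (fun l hl => (hiter l hl).isConvexDisk.isCompact) hglb hr0 hr
  have hd := hiter l hl
  exact ⟨l, hl, closedBall_subset_of_forall_near hd.isConvexDisk.isCompact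
    (hd.closedBall_subset (Metric.mem_closedBall_self h0.le)) hd.isConvexDisk.sphConvex.2 hr0 hr hnear,
    hsub⟩

/-! ### Proof of the theorem -/

open SteinerFrame in
theorem mainTheorem10 (K : Set S2) (hK : IsConvexDisk K) (hdiam : Metric.diam K < π / 2) :
    ∃ (Km : ℕ → Set S2) (D : Set S2),
      (∀ m, Km m ∈ steinerFamily K) ∧
      IsSphericalCap D ∧ sphArea D = sphArea K ∧
      Tendsto (fun m => Metric.hausdorffEDist (Km m) D) atTop (𝓝 0) := by
  obtain ⟨F, hF⟩ := exists_good hK hdiam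
  have hF2 := hF.swap
  have hconv : IsConvexDisk (F.swap.symmetral (F.symmetral K)) := hF2.isConvexDisk_symmetral
  have hsub : F.swap.symmetral (F.symmetral K) ⊆ openHemisphere F.center := symmetral_subset_S _
  obtain ⟨ρ, h0, hρ, hball⟩ := exists_closedBall_subset hconv hsub hF.centSym_swap
  have hX : CentralDisk F.center ρ (sphArea K) (F.swap.symmetral (F.symmetral K)) :=
    ⟨hconv, hsub, hF.centSym_swap, hball, hF2.sphArea_symmetral.trans hF.sphArea_symmetral⟩
  obtain ⟨r, hr0, hr, hnear⟩ := hX.exists_iter_near_cap h0 hρ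
  choose! l hl hin hout using hnear
  -- Bounding the tolerance by `r` satisfies the condition `ε ≤ r` in the Hausdorff estimate.
  let u : ℕ → ℝ := fun n => min (1 / (n + 1)) r
  have hu0 : ∀ n, 0 < u n := fun n => lt_min (by positivity) hr0
  have hur : ∀ n, u n ≤ r := fun n => min_le_right _ _
  have hu : Tendsto u atTop (𝓝 0) := by
    have := (tendsto_one_div_add_atTop_nhds_zero_nat (𝕜 := ℝ)).min (tendsto_const_nhds (x := r))
    rwa [min_eq_left hr0.le] at this
  refine ⟨fun m => iterSymmetral ([F, F.swap] ++ l (u m)) K, Metric.closedBall F.center r,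
    fun m => ⟨[F, F.swap] ++ l (u m), by simp, applicable_append ?_ ?_, IsometryEquiv.refl S2, ?_⟩,
    ⟨F.center, r, hr0, by linarith [Real.pi_pos], rfl⟩, ?_, ?_⟩
  · exact ⟨⟨hF.subset_S, hF.angularMonotonicity⟩, ⟨hF2.subset_S, hF2.angularMonotonicity⟩, trivial⟩
  · exact hX.applicable h0.le hρ (hl _ (hu0 m))
  · exact (image_id _).symm
  -- All iterates have the area of `K` and are squeezed between caps of radii `r - ε` and `r + ε`;
  -- the bound `1` on `ε` is arbitrary.
  · refine sphArea_closedBall_eq one_pos (fun ε hε _ => ?_) fun ε hε _ => ?_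
    · rw [← (hX.iter h0.le hρ (hl ε hε)).area_eq]
      exact measure_mono (hin ε hε)
    · rw [← (hX.iter h0.le hρ (hl ε hε)).area_eq]
      exact measure_mono (hout ε hε)
  · have hlim : Tendsto (fun m => ENNReal.ofReal (u m)) atTop (𝓝 0) := by
      simpa using ENNReal.tendsto_ofReal hu
    refine tendsto_of_tendsto_of_tendsto_of_le_of_le tendsto_const_nhds hlim (fun _ => bot_le)
      fun m => ?_
    change Metric.hausdorffEDist (iterSymmetral ([F, F.swap] ++ l (u m)) K) _ ≤ _
    rw [iterSymmetral_append]
    exact hausdorffEDist_closedBall_le (hu0 m).le (hur m) (by linarith [hur m])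
      (hin _ (hu0 m)) (hout _ (hu0 m))
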